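/- Let $\phi\in C^\infty_c(\mathbb R^2)$ be real-valued and radially symmetric, with $\operatorname{supp}\phi\subset B(0;1)$ and $\phi\equiv 1$ on $B(0;1/2)$, and let $\omega_0(x)=\phi(x)/|x|$. For $\nu>0$ let $\omega_\nu(\cdot,t)=H_\nu(\cdot,t)*\omega_0$, with $H_\nu(x,t)=(4\pi\nu t)^{-1}e^{-|x|^2/(4\nu t)}$, be the solution of the heat equation $\partial_t\omega_\nu=\nu\Delta\omega_\nu$ with initial datum $\omega_0$. Let $0<T<\infty$ and $K(x)=x^\perp/(2\pi|x|^2)$, where $(x_1,x_2)^\perp=(-x_2,x_1)$. For a dyadic Littlewood–Paley partition of unity with kernels $(\psi_j)_{j\ge0}$ put $\|f\|_{B^0_{2,\infty}}=\sup_{j\ge 0}\|\psi_j*f\|_{L^2}$ and $\|f\|_{B^0_{2,1}}=\sum_{j\ge 0}\|\psi_j*f\|_{L^2}$. For $1<q\le\infty$, $1/q+1/q'=1$, weak-$*$ convergence in $L^q((0,T);B^0_{2,\infty})$ refers to the duality with $L^{q'}((0,T);B^0_{2,1})$. Terminology. Let $4/3\le p<2$. A function $\omega\in L^\infty([0,T);L^p(\mathbb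 R^2))$ is a *weak solution* of the 2D Euler equations with initial vorticity $\omega_0$ if $u=K*\omega\in L^\infty([0,T);L^2+L^\infty)$ and $$\int_0^T\!\!\int_{\mathbb R^2}(\varphi_t\,\omega+\nabla\varphi\cdot u\,\omega)\,dx\,dt+\int_{\mathbb R^2}\varphi(x,0)\,\omega_0(x)\,dx=0\qquad\text{for all }\varphi\in C^\infty_c([0,T)\times\mathbb R^2).$$ It is a *viscosity solution* if moreover it is the weak-$*$ limit in $L^\infty([0,T);L^p)$ of a sequence of solutions $\omega_k$ of the Navier–Stokes equations $\partial_t\omega_k+u_k\cdot\nabla\omega_k-\nu_k\Delta\omega_k=0$, $u_k=K*\omega_k$, with $\nu_k\to0^+$ and the same initial vorticity $\omega_0$ (smooth for $0<t<T$, with $\omega_k(t)\to\omega_0$ in $L^p$ as $t\to0^+$). Then, for every such partition of unity: 1. $\omega_0\in B^0_{2,\infty}(\mathbb R^2)$. 2. For every $p\in[4/3,2)$, the time-independent function $\omega(x,t)=\omega_0(x)$ is a viscosity solution of the 2D Euler equations with initial vorticity $\omega_0$. 3. $\sup_{\nu>0}\|\omega_\nu\|_{L^\infty((0,T);B^0_{2,\infty})}<\infty$.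 4. $\omega_\nu\rightharpoonup\omega_0$ weak-$*$ in $L^\infty((0,T);B^0_{2,\infty})$ as $\nu\to0^+$. 5. The hypotheses of Eyink's conjecture hold: for every $p\in[4/3,2)$ and every sequence $\nu_k>0$ with $\nu_k\to0$, the $\omega_{\nu_k}$ solve the Navier–Stokes equations with viscosity $\nu_k$ and initial vorticity $\omega_0$ and converge weak-$*$ in $L^\infty([0,T);L^p)$ to the weak solution $\omega_0$ of the 2D Euler equations; $\omega_0\in L^2((0,T);B^0_{2,\infty})$; and $\omega_{\nu_k}\rightharpoonup\omega_0$ weak-$*$ in $L^2((0,T);B^0_{2,\infty})$. -/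

import Mathlib

open MeasureTheory Filter Topology
open scoped ENNReal NNReal ContDiff SchwartzMap Gradient Laplacian

noncomputable section

/-- The Euclidean plane. -/
abbrev Plane : Type := EuclideanSpace ℝ (Fin 2)

/-- Lebesgue measure on the time interval `(0,T)`. -/
abbrev timeMeasure (T : ℝ) : Measure ℝ := (volume : Measure ℝ).restrict (Set.Ioo 0 T)

/-- Lebesgue measure on the space-time slab `(0,T) × ℝ²`. -/
abbrev slabMeasure (T : ℝ) : Measure (ℝ × Plane) := (timeMeasure T).prod volume

/-! ## Fluid mechanics -/

/-- The Biot-Savart kernel `K(x) = x^⊥ / (2π|x|²)`, with `(x₁,x₂)^⊥ = (-x₂,x₁)`. -/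
def biotSavart (x : Plane) : Plane :=
  (2 * Real.pi * ‖x‖ ^ 2)⁻¹ • !₂[-(x 1), x 0]

/-- The velocity `u = K ∗ w` generated by a vorticity `w`. -/
def velocity (w : Plane → ℝ) (x : Plane) : Plane :=
  ∫ y, w y • biotSavart (x - y)

/-- Absolute convergence, at the point `x`, of the integral defining `K ∗ w`. -/
def VelocityConverges (w : Plane → ℝ) (x : Plane) : Prop :=
  Integrable (fun y => w y • biotSavart (x - y))

/-- `w ∈ L^∞([0,T); L^p(ℝ²))`. -/
def MemLinftyLp (p : ℝ≥0∞) (T : ℝ) (w : ℝ → Plane → ℝ) : Prop :=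
  AEStronglyMeasurable (Function.uncurry w) (slabMeasure T) ∧
    eLpNorm (fun t => eLpNorm (w t) p volume) ⊤ (timeMeasure T) < ⊤

/-- Convergence `ws i ⇀ w` along the filter `l`, weak-* in
`L^∞([0,T); L^p(ℝ²)) = (L¹([0,T); L^{p'}(ℝ²)))^*`, for `1 < p ≤ ∞`. -/
def TendstoWeakStarLinftyLp {ι : Type*} (p : ℝ≥0∞) (T : ℝ) (l : Filter ι)
    (ws : ι → ℝ → Plane → ℝ) (w : ℝ → Plane → ℝ) : Prop :=
  (∀ᶠ i in l, MemLinftyLp p T (ws i)) ∧ MemLinftyLp p T w ∧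
    ∀ p' : ℝ≥0∞, p.HolderConjugate p' → ∀ g : ℝ → Plane → ℝ,
      AEStronglyMeasurable (Function.uncurry g) (slabMeasure T) →
      eLpNorm (fun t => eLpNorm (g t) p' volume) 1 (timeMeasure T) < ⊤ →
      Tendsto (fun i => ∫ z, ws i z.1 z.2 * g z.1 z.2 ∂(slabMeasure T)) l
        (𝓝 (∫ z, w z.1 z.2 * g z.1 z.2 ∂(slabMeasure T)))

/-- `u ∈ L^∞([0,T); L²(ℝ²) + L^∞(ℝ²))` for the velocity `u = K ∗ w`. -/
def VelocityMemLinfty (T : ℝ) (w : ℝ → Plane → ℝ) : Prop :=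
  ∃ C : ℝ≥0, ∀ᵐ t ∂(timeMeasure T), ∃ a b : Plane → Plane,
    AEStronglyMeasurable a volume ∧ AEStronglyMeasurable b volume ∧
    eLpNorm a 2 volume ≤ C ∧ eLpNorm b ⊤ volume ≤ C ∧
    ∀ᵐ x, velocity (w t) x = a x + b x

/-- `w ∈ L^∞([0,T); L^p(ℝ²))`, `p ≥ 4/3`, is a weak solution of the initial value problem for the
vorticity formulation of the 2D Euler equations `∂ₜw + u·∇w = 0`, `u = K ∗ w`, with initial
vorticity `ω₀`. A test function in `C_c^∞([0,T) × ℝ²)` is the restriction to `[0,T) × ℝ²` of a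
smooth function on `ℝ × ℝ²` with compact support contained in `(-∞,T) × ℝ²`. -/
structure IsWeakEulerSolution (p : ℝ≥0∞) (T : ℝ) (ω₀ : Plane → ℝ) (w : ℝ → Plane → ℝ) :
    Prop where
  exponent : 4 / 3 ≤ p
  initial_mem : MemLp ω₀ p volume
  mem : MemLinftyLp p T w
  velocity_converges : ∀ᵐ t ∂(timeMeasure T), ∀ᵐ x, VelocityConverges (w t) x
  velocity_mem : VelocityMemLinfty T w
  weak_form : ∀ ψ : ℝ × Plane → ℝ, ContDiff ℝ ∞ ψ → HasCompactSupport ψ →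
    tsupport ψ ⊆ Set.Iio T ×ˢ Set.univ →
    Integrable (fun z : ℝ × Plane => deriv (fun s => ψ (s, z.2)) z.1 * w z.1 z.2 +
        inner ℝ (∇ (fun y => ψ (z.1, y)) z.2) (velocity (w z.1) z.2) * w z.1 z.2)
      (slabMeasure T) ∧
    Integrable (fun x => ψ (0, x) * ω₀ x) volume ∧
    (∫ z : ℝ × Plane, (deriv (fun s => ψ (s, z.2)) z.1 * w z.1 z.2 +
        inner ℝ (∇ (fun y => ψ (z.1, y)) z.2) (velocity (w z.1) z.2) * w z.1 z.2)
      ∂(slabMeasure T)) + ∫ x, ψ (0, x) * ω₀ x = 0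

/-- `w` is a solution on `(0,T)` of the 2D Navier-Stokes equations in vorticity form,
`∂ₜw + u·∇w - νΔw = 0`, `u = K ∗ w`, smooth and classical for positive times, with initial
vorticity `ω₀` attained in `L^p`. -/
structure IsNavierStokesSolution (p : ℝ≥0∞) (ν T : ℝ) (ω₀ : Plane → ℝ) (w : ℝ → Plane → ℝ) :
    Prop where
  smooth : ContDiffOn ℝ ∞ (Function.uncurry w) (Set.Ioo 0 T ×ˢ Set.univ)
  velocity_converges : ∀ t ∈ Set.Ioo 0 T, ∀ x, VelocityConverges (w t) x
  equation : ∀ t ∈ Set.Ioo 0 T, ∀ x,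
    deriv (fun s => w s x) t + inner ℝ (velocity (w t) x) (∇ (w t) x) - ν * Δ (w t) x = 0
  initial : Tendsto (fun t => eLpNorm (w t - ω₀) p volume) (𝓝[>] 0) (𝓝 0)

/-- The weak solution `w` of the Euler equations is the vanishing viscosity limit of the solutions
`ws k` of the Navier-Stokes equations with viscosities `νs k → 0⁺` and the same initial
vorticity `ω₀`. -/
structure IsVanishingViscosityLimit (p : ℝ≥0∞) (T : ℝ) (ω₀ : Plane → ℝ)
    (νs : ℕ → ℝ) (ws : ℕ → ℝ → Plane → ℝ) (w : ℝ → Plane → ℝ) : Prop where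
  weak_solution : IsWeakEulerSolution p T ω₀ w
  viscosity_pos : ∀ k, 0 < νs k
  viscosity_tendsto : Tendsto νs atTop (𝓝 0)
  navierStokes : ∀ k, IsNavierStokesSolution p (νs k) T ω₀ (ws k)
  weakStar : TendstoWeakStarLinftyLp p T atTop ws w

/-- `w` is a viscosity solution of the 2D Euler equations with initial vorticity `ω₀`: a weak
solution that is a vanishing viscosity limit. -/
def IsViscositySolution (p : ℝ≥0∞) (T : ℝ) (ω₀ : Plane → ℝ) (w : ℝ → Plane → ℝ) : Prop :=
  ∃ (νs : ℕ → ℝ) (ws : ℕ → ℝ → Plane → ℝ), IsVanishingViscosityLimit p T ω₀ νs ws w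

/-- The solution `H_ν(t) ∗ ω₀` of the heat equation `∂ₜw = νΔw` with initial datum `ω₀`,
where `H_ν(x,t) = (4πνt)⁻¹ exp(-|x|²/(4νt))`. -/
def heatEvolution (ν : ℝ) (ω₀ : Plane → ℝ) (t : ℝ) (x : Plane) : ℝ :=
  if 0 < t then
    ∫ y, (4 * Real.pi * ν * t)⁻¹ * Real.exp (-‖x - y‖ ^ 2 / (4 * ν * t)) * ω₀ y
  else ω₀ x

/-! ## Besov spaces -/

/-- An inhomogeneous dyadic (Littlewood-Paley) partition of unity on the frequency plane:
`low(ξ) + ∑_{j ≥ 1} shell(2^{-j} ξ) = 1`. -/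
structure LittlewoodPaley where
  low : Plane → ℝ
  shell : Plane → ℝ
  low_smooth : ContDiff ℝ ∞ low
  shell_smooth : ContDiff ℝ ∞ shell
  low_support : ∀ ξ, low ξ ≠ 0 → ‖ξ‖ ≤ 2
  shell_support : ∀ ξ, shell ξ ≠ 0 → 1 / 2 ≤ ‖ξ‖ ∧ ‖ξ‖ ≤ 2
  partition : ∀ ξ, HasSum (fun j : ℕ => shell (((2 : ℝ) ^ (j + 1))⁻¹ • ξ)) (1 - low ξ)

/-- Littlewood-Paley partitions of unity exist. -/
theorem littlewoodPaley_nonempty : Nonempty LittlewoodPaley := by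
  let b : ContDiffBump (0 : Plane) := ⟨1, 2, by norm_num, by norm_num⟩
  have hb1 : ∀ ξ : Plane, ‖ξ‖ ≤ 1 → b ξ = 1 := fun ξ h =>
    b.one_of_mem_closedBall (by simpa using h)
  have hb0 : ∀ ξ : Plane, 2 ≤ ‖ξ‖ → b ξ = 0 := fun ξ h =>
    b.zero_of_le_dist (by simpa using h)
  refine ⟨⟨fun ξ => b ξ, fun ξ => b ξ - b ((2 : ℝ) • ξ), b.contDiff,
    b.contDiff.sub (b.contDiff.comp (contDiff_const_smul (2 : ℝ))), ?_, ?_, ?_⟩⟩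
  · intro ξ h
    by_contra! h2
    exact h (hb0 ξ h2.le)
  · intro ξ h
    have hn : ‖(2 : ℝ) • ξ‖ = 2 * ‖ξ‖ := by simp [norm_smul]
    constructor
    · by_contra! h2
      exact h (by simp only [hb1 ξ (by linarith), hb1 ((2 : ℝ) • ξ) (by linarith), sub_self])
    · by_contra! h2
      exact h (by simp only [hb0 ξ h2.le, hb0 ((2 : ℝ) • ξ) (by linarith), sub_self])
  · intro ξ
    have hsc : ∀ j : ℕ, (2 : ℝ) • ((((2 : ℝ) ^ (j + 1))⁻¹) • ξ) = ((2 : ℝ) ^ j)⁻¹ • ξ := by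
      intro j
      rw [smul_smul]
      congr 1
      field_simp
      ring
    have hn : ∀ j : ℕ, ‖((2 : ℝ) ^ j)⁻¹ • ξ‖ = ‖ξ‖ / 2 ^ j := by
      intro j
      simp [norm_smul, div_eq_inv_mul]
    obtain ⟨N, hN⟩ := pow_unbounded_of_one_lt ‖ξ‖ (one_lt_two : (1 : ℝ) < 2)
    have hbig : ∀ j, N ≤ j → b (((2 : ℝ) ^ j)⁻¹ • ξ) = 1 := by
      intro j hj
      apply hb1
      rw [hn, div_le_one (by positivity)]
      exact hN.le.trans (pow_le_pow_right₀ one_le_two hj)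
    have hfin := hasSum_sum_of_ne_finset_zero (L := SummationFilter.unconditional ℕ) (s := Finset.range N)
      (f := fun j : ℕ => b (((2 : ℝ) ^ (j + 1))⁻¹ • ξ) -
        b ((2 : ℝ) • ((((2 : ℝ) ^ (j + 1))⁻¹) • ξ))) (by
        intro j hj
        have hj' : N ≤ j := by simpa using hj
        simp only [hsc, hbig j hj', hbig (j + 1) (by omega), sub_self])
    have hsum : ∑ j ∈ Finset.range N, (b (((2 : ℝ) ^ (j + 1))⁻¹ • ξ) -
        b ((2 : ℝ) • ((((2 : ℝ) ^ (j + 1))⁻¹) • ξ))) = 1 - b ξ := by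
      simp only [hsc]
      rw [Finset.sum_range_sub (fun j => b (((2 : ℝ) ^ j)⁻¹ • ξ)), hbig N le_rfl]
      simp
    rw [hsum] at hfin
    exact hfin

namespace LittlewoodPaley

/-- The Fourier multiplier of the `j`-th dyadic block. -/
def symbol (P : LittlewoodPaley) : ℕ → Plane → ℝ
  | 0 => P.low
  | j + 1 => fun ξ => P.shell (((2 : ℝ) ^ (j + 1))⁻¹ • ξ)

/-- The `j`-th dyadic block `ψ_j ∗ F` of a tempered distribution, `ψ_j` being the inverse Fourier
transform of `symbol j`. -/
def block (P : LittlewoodPaley) (j : ℕ) (F : 𝓢'(Plane, ℂ)) : 𝓢'(Plane, ℂ) :=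
  TemperedDistribution.fourierMultiplierCLM ℂ (fun ξ => (P.symbol j ξ : ℂ)) F

end LittlewoodPaley

/-- The `L²` norm of a tempered distribution, `∞` if it does not belong to `L²`. -/
def distL2ENorm (F : 𝓢'(Plane, ℂ)) : ℝ≥0∞ :=
  ⨅ (u : Lp ℂ 2 (volume : Measure Plane)) (_ : (u : 𝓢'(Plane, ℂ)) = F), ‖u‖ₑ

open scoped Classical in
/-- The element of `L²` representing a tempered distribution (`0` if there is none). -/
def distL2Rep (F : 𝓢'(Plane, ℂ)) : Lp ℂ 2 (volume : Measure Plane) :=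
  if h : ∃ u : Lp ℂ 2 (volume : Measure Plane), (u : 𝓢'(Plane, ℂ)) = F then h.choose else 0

/-- The norm of `B⁰_{2,∞}(ℝ²)`: `sup_j ‖ψ_j ∗ F‖_{L²}`. -/
def besovInftyENorm (P : LittlewoodPaley) (F : 𝓢'(Plane, ℂ)) : ℝ≥0∞ :=
  ⨆ j, distL2ENorm (P.block j F)

/-- The norm of `B⁰_{2,1}(ℝ²)`, the predual of `B⁰_{2,∞}(ℝ²)`: `∑_j ‖ψ_j ∗ F‖_{L²}`. -/
def besovOneENorm (P : LittlewoodPaley) (F : 𝓢'(Plane, ℂ)) : ℝ≥0∞ :=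
  ∑' j, distL2ENorm (P.block j F)

/-- The duality pairing `⟨F, G⟩ = ∑_{j,k} ∫ (ψ_j ∗ F)(ψ_k ∗ G) dx` of `F ∈ B⁰_{2,∞}` and
`G ∈ B⁰_{2,1}`. The terms with `|j - k| > 1` vanish, and the sum converges absolutely; for a
Schwartz function `G` it is the value `F(G)`. -/
def besovPairing (P : LittlewoodPaley) (F G : 𝓢'(Plane, ℂ)) : ℂ :=
  ∑' jk : ℕ × ℕ, ∫ x, distL2Rep (P.block jk.1 F) x * distL2Rep (P.block jk.2 G) x

/-- The tempered distribution `F` is given by the function `f`. -/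
def RepresentsFun (F : 𝓢'(Plane, ℂ)) (f : Plane → ℝ) : Prop :=
  ∀ s : 𝓢(Plane, ℂ), Integrable (fun x => (f x : ℂ) * s x) ∧ F s = ∫ x, (f x : ℂ) * s x

/-- The function `f` defines a tempered distribution. -/
def IsTemperedFun (f : Plane → ℝ) : Prop := ∃ F : 𝓢'(Plane, ℂ), RepresentsFun F f

open scoped Classical in
/-- The tempered distribution defined by the function `f` (`0` if there is none). -/
def funDist (f : Plane → ℝ) : 𝓢'(Plane, ℂ) :=
  if h : IsTemperedFun f then h.choose else 0

/-- The function `f` belongs to `B⁰_{2,∞}(ℝ²)`. -/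
def MemBesov (P : LittlewoodPaley) (f : Plane → ℝ) : Prop :=
  IsTemperedFun f ∧ besovInftyENorm P (funDist f) < ⊤

/-- The norm of `w` in `L^q((0,T); B⁰_{2,∞}(ℝ²))`. -/
def besovTimeENorm (P : LittlewoodPaley) (q : ℝ≥0∞) (T : ℝ) (w : ℝ → Plane → ℝ) : ℝ≥0∞ :=
  eLpNorm (fun t => besovInftyENorm P (funDist (w t))) q (timeMeasure T)

/-- `w ∈ L^q((0,T); B⁰_{2,∞}(ℝ²))`, where measurability in time is the weak-* one: the space is,
for `1 < q ≤ ∞`, the dual of `L^{q'}((0,T); B⁰_{2,1}(ℝ²))`. -/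
def MemTimeBesov (P : LittlewoodPaley) (q : ℝ≥0∞) (T : ℝ) (w : ℝ → Plane → ℝ) : Prop :=
  (∀ᵐ t ∂(timeMeasure T), IsTemperedFun (w t)) ∧
    (∀ g : Lp ℂ 2 (volume : Measure Plane), besovOneENorm P (g : 𝓢'(Plane, ℂ)) < ⊤ →
      AEStronglyMeasurable (fun t => besovPairing P (funDist (w t)) (g : 𝓢'(Plane, ℂ)))
        (timeMeasure T)) ∧
    besovTimeENorm P q T w < ⊤

/-- Convergence `ws i ⇀ w` along the filter `l`, weak-* in `L^q((0,T); B⁰_{2,∞}(ℝ²))`, the dual of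
`L^{q'}((0,T); B⁰_{2,1}(ℝ²))`, for `1 < q ≤ ∞`. As `B⁰_{2,1}` is a separable Banach space
continuously embedded in `L²`, a function of time with values in `B⁰_{2,1}` is strongly measurable
in `B⁰_{2,1}` if and only if it is so in `L²`. -/
def TendstoWeakStarBesov {ι : Type*} (P : LittlewoodPaley) (q : ℝ≥0∞) (T : ℝ) (l : Filter ι)
    (ws : ι → ℝ → Plane → ℝ) (w : ℝ → Plane → ℝ) : Prop :=
  (∀ᶠ i in l, MemTimeBesov P q T (ws i)) ∧ MemTimeBesov P q T w ∧
    ∀ q' : ℝ≥0∞, q.HolderConjugate q' → ∀ g : ℝ → Lp ℂ 2 (volume : Measure Plane),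
      AEStronglyMeasurable g (timeMeasure T) →
      eLpNorm (fun t => besovOneENorm P (g t : 𝓢'(Plane, ℂ))) q' (timeMeasure T) < ⊤ →
      Tendsto
        (fun i => ∫ t, besovPairing P (funDist (ws i t)) (g t : 𝓢'(Plane, ℂ)) ∂(timeMeasure T)) l
        (𝓝 (∫ t, besovPairing P (funDist (w t)) (g t : 𝓢'(Plane, ℂ)) ∂(timeMeasure T)))

/-- The hypotheses of Eyink's conjecture: `w` is a weak solution of the 2D Euler equations obtained
by the vanishing viscosity method, `w ∈ L²((0,T); B⁰_{2,∞})`, and the approximating solutions of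
the Navier-Stokes equations converge to it weak-* in `L²((0,T); B⁰_{2,∞})`. -/
structure EyinkHypotheses (P : LittlewoodPaley) (p : ℝ≥0∞) (T : ℝ) (ω₀ : Plane → ℝ)
    (νs : ℕ → ℝ) (ws : ℕ → ℝ → Plane → ℝ) (w : ℝ → Plane → ℝ) : Prop where
  limit : IsVanishingViscosityLimit p T ω₀ νs ws w
  mem : MemTimeBesov P 2 T w
  weakStar : TendstoWeakStarBesov P 2 T atTop ws w

end

/-! The datum is radial, and radial symmetry removes the nonlinearity. The velocity of a radial
vorticity is orthogonal to the position vector (`inner_velocity_self`), while the derivative of a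
smooth radial function vanishes in such directions (`fderiv_eq_zero_of_radial`). Heat evolutions of
`ω₀` stay radial and smooth, so they solve the Navier-Stokes equations exactly
(`isNavierStokesSolution`). For the singular profile `ω₀` itself the transport term is treated
weakly: on each circle about the origin the integrand is the derivative of the test function along
the circle times a constant, so its rotational average is zero (`integral_transport_eq_zero`). Hence
`ω₀` is a stationary weak Euler solution.

For `1 < p < 2`, convergence of the heat evolutions in `L^p`, and weak-* in `L^∞(L^p)`, is dominated
convergence: they converge pointwise off the origin and are bounded, uniformly in time and
viscosity, by a multiple of `decay`, which lies in `L^p`.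

The Besov statements rest on the bound `|ξ| |𝓕 ω₀(ξ)| ≤ C`, inherited from the fact that `1/|x|` is,
up to a constant, its own Fourier transform in the plane (`exists_norm_fourier_inv_norm_mul_le`). A
dyadic shell of radius about `2^j` has area of order `4^j`, so a transform of size `2^{-j}` there
has `L²` norm bounded independently of `j`. The heat multiplier is at most `1`, which gives the same
bound for every viscosity and time (`exists_norm_heatMode_le`).

For weak-* convergence the pairing with an element of `B⁰_{2,1}` is a double series concentrated
near the diagonal. It is dominated by a summable series independent of the diffusion time `s = νt`,
hence continuous in `s` down to `s = 0` (`continuous_heatPairing`), and the stationary vorticity is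
the flow with `ν = 0`. Dominated convergence in time finishes the argument (`tendstoWeakStarBesov`).
-/

/-! ### Singular radial vortices and integrability of powers of the norm. -/

/-- A radial, compactly supported function with a singularity of order `1 / ‖x‖` at the origin. -/
structure IsSingularVortex (M : ℝ) (w : Plane → ℝ) : Prop where
  nonneg : 0 ≤ M
  abs_le : ∀ x, |w x| ≤ M * ‖x‖⁻¹
  eq_zero : ∀ x, 1 < ‖x‖ → w x = 0
  radial : ∀ x y, ‖x‖ = ‖y‖ → w x = w y
  continuousAt : ∀ x, x ≠ 0 → ContinuousAt w x

theorem integrableOn_norm_rpow_ball {a : ℝ} (ha : a < 2) (R : ℝ) :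
    IntegrableOn (fun y : Plane => ‖y‖ ^ (-a)) (Metric.ball 0 R) := by
  rcases le_or_gt R 0 with hR | hR
  · simp [Metric.ball_eq_empty.2 hR]
  rw [integrableOn_fun_norm_addHaar (μ := (volume : Measure Plane)) (f := fun r => r ^ (-a))]
  simp only [finrank_euclideanSpace, Fintype.card_fin, Nat.add_one_sub_one, pow_one, smul_eq_mul]
  have h := (intervalIntegral.integrableOn_Ioo_rpow_iff (s := 1 - a) hR).2 (by linarith)
  refine h.congr_fun (fun r hr => ?_) measurableSet_Ioo
  simp only [sub_eq_add_neg]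
  rw [Real.rpow_add hr.1, Real.rpow_one]

theorem integrableOn_norm_rpow_compl_ball {a : ℝ} (ha : 2 < a) {R : ℝ} (hR : 0 < R) :
    IntegrableOn (fun y : Plane => ‖y‖ ^ (-a)) (Metric.ball 0 R)ᶜ := by
  rw [← integrable_indicator_iff Metric.isOpen_ball.measurableSet.compl]
  have key : Integrable (fun y : Plane => (Set.Ici R).indicator (fun r => r ^ (-a)) ‖y‖) := by
    rw [integrable_fun_norm_addHaar (μ := (volume : Measure Plane))
      (f := (Set.Ici R).indicator (fun r => r ^ (-a)))]
    simp only [finrank_euclideanSpace, Fintype.card_fin, Nat.add_one_sub_one, pow_one, smul_eq_mul]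
    have h := (integrableOn_Ioi_rpow_iff (s := 1 - a) hR).2 (by linarith)
    rw [← integrableOn_Ici_iff_integrableOn_Ioi, ← integrable_indicator_iff measurableSet_Ici] at h
    refine (h.integrableOn (s := Set.Ioi 0)).congr_fun (fun r hr => ?_) measurableSet_Ioi
    by_cases hrR : R ≤ r
    · simp only [Set.indicator_of_mem (show r ∈ Set.Ici R from hrR), sub_eq_add_neg]
      rw [Real.rpow_add hr, Real.rpow_one]
    · simp [Set.indicator_of_notMem (show r ∉ Set.Ici R from hrR)]
  refine key.congr (ae_of_all _ fun y => ?_)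
  simp [Set.indicator, not_lt]

theorem integral_norm_inv_ball {R : ℝ} (hR : 0 < R) :
    ∫ y in Metric.ball (0 : Plane) R, ‖y‖⁻¹ = 2 * Real.pi * R := by
  have h := integral_fun_norm_addHaar (volume : Measure Plane)
    ((Set.Iio R).indicator (fun r => r⁻¹))
  rw [← integral_indicator Metric.isOpen_ball.measurableSet]
  have e : ∀ y : Plane, (Metric.ball (0 : Plane) R).indicator (fun y => ‖y‖⁻¹) y
      = (Set.Iio R).indicator (fun r => r⁻¹) ‖y‖ := by
    intro y; simp [Set.indicator]
  simp_rw [e]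
  rw [h]
  have e2 : ∫ y in Set.Ioi (0 : ℝ), y ^ (Module.finrank ℝ Plane - 1) •
      (Set.Iio R).indicator (fun r => r⁻¹) y = R := by
    have : ∀ y ∈ Set.Ioi (0 : ℝ), y ^ (Module.finrank ℝ Plane - 1) •
      (Set.Iio R).indicator (fun r => r⁻¹) y = (Set.Iio R).indicator (fun _ => (1 : ℝ)) y := by
      intro y hy
      have hy : y ≠ 0 := ne_of_gt hy
      by_cases hyR : y < R <;> simp [hyR, hy]
    rw [setIntegral_congr_fun measurableSet_Ioi this, setIntegral_indicator measurableSet_Iio]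
    simp [Set.Ioi_inter_Iio, hR.le]
  rw [e2]
  simp [measureReal_def, ENNReal.toReal_ofReal Real.pi_pos.le, mul_assoc]

theorem integrableOn_norm_inv_ball (R : ℝ) :
    IntegrableOn (fun y : Plane => ‖y‖⁻¹) (Metric.ball 0 R) := by
  simpa [Real.rpow_neg_one] using integrableOn_norm_rpow_ball (a := 1) (by norm_num) R

/-- The profile dominating all heat evolutions of a singular vortex. -/
noncomputable def decay (x : Plane) : ℝ := min ‖x‖⁻¹ (‖x‖ ^ 2)⁻¹

theorem decay_nonneg (x : Plane) : 0 ≤ decay x := le_min (by positivity) (by positivity)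

theorem measurable_decay : Measurable decay := by unfold decay; fun_prop

/-- The factor `|x|⁻¹` controls the origin, where `p < 2` is needed, and `|x|⁻²` controls infinity,
where `2p > 2` is needed. -/
theorem memLp_decay {p : ℝ≥0∞} (hp : 1 < p) (hp2 : p < 2) : MemLp decay p volume := by
  have hpt : p ≠ ⊤ := ne_top_of_lt hp2
  have hp0 : p ≠ 0 := (zero_lt_one.trans hp).ne'
  have h1 : 1 < p.toReal := by
    simpa using (ENNReal.toReal_lt_toReal ENNReal.one_ne_top hpt).2 hp
  have h2 : p.toReal < 2 := by
    simpa using (ENNReal.toReal_lt_toReal hpt ENNReal.ofNat_ne_top).2 hp2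
  rw [← integrable_norm_rpow_iff measurable_decay.aestronglyMeasurable hp0 hpt]
  rw [← integrableOn_univ, ← Set.union_compl_self (Metric.ball (0 : Plane) 1), integrableOn_union]
  have hm : ∀ s, AEStronglyMeasurable (fun x : Plane => ‖decay x‖ ^ p.toReal)
      (volume.restrict s) := fun s =>
    (measurable_decay.norm.pow_const _).aestronglyMeasurable
  constructor
  · refine (integrableOn_norm_rpow_ball h2 1).mono' (hm _) (ae_of_all _ fun x => ?_)
    rw [Real.norm_of_nonneg (by positivity), Real.norm_of_nonneg (decay_nonneg x),
      Real.rpow_neg (norm_nonneg _), ← Real.inv_rpow (norm_nonneg _)]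
    exact Real.rpow_le_rpow (decay_nonneg x) (min_le_left _ _) (by linarith)
  · refine (integrableOn_norm_rpow_compl_ball (a := 2 * p.toReal) (by linarith) one_pos).mono' (hm _)
      (ae_of_all _ fun x => ?_)
    rw [Real.norm_of_nonneg (by positivity), Real.norm_of_nonneg (decay_nonneg x),
      Real.rpow_neg (norm_nonneg _), Real.rpow_mul (norm_nonneg _), ← Real.inv_rpow (by positivity)]
    refine Real.rpow_le_rpow (decay_nonneg x) ((min_le_right _ _).trans (by simp)) (by linarith)

theorem le_decay {C a : ℝ} {x : Plane} (hC : 0 ≤ C) (h1 : a ≤ C * ‖x‖⁻¹)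
    (h2 : a ≤ C * (‖x‖ ^ 2)⁻¹) : a ≤ C * decay x := by
  rw [decay, mul_min_of_nonneg _ _ hC]
  exact le_min h1 h2

namespace IsSingularVortex

variable {M : ℝ} {w : Plane → ℝ}

theorem measurable (h : IsSingularVortex M w) : Measurable w :=
  measurable_of_continuousOn_compl_singleton 0
    fun x hx => (h.continuousAt x hx).continuousWithinAt

theorem abs_le_decay (h : IsSingularVortex M w) (x : Plane) : |w x| ≤ M * decay x := by
  refine le_decay h.nonneg (h.abs_le x) ?_
  rcases le_or_gt ‖x‖ 1 with hx | hx
  · refine (h.abs_le x).trans (mul_le_mul_of_nonneg_left ?_ h.nonneg)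
    rcases (norm_nonneg x).eq_or_lt with h0 | h0
    · simp [← h0]
    · exact inv_anti₀ (by positivity) (by nlinarith)
  · rw [h.eq_zero x hx, abs_zero]
    have := h.nonneg
    positivity

theorem abs_le_indicator (h : IsSingularVortex M w) {R : ℝ} (hR : 1 < R) (x : Plane) :
    |w x| ≤ M * (Metric.ball (0 : Plane) R).indicator (fun y => ‖y‖⁻¹) x := by
  by_cases hx : x ∈ Metric.ball (0 : Plane) R
  · rw [Set.indicator_of_mem hx]
    exact h.abs_le x
  · rw [Set.indicator_of_notMem hx, h.eq_zero x, abs_zero, mul_zero]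
    simp only [Metric.mem_ball, dist_zero_right, not_lt] at hx
    linarith

theorem integrable (h : IsSingularVortex M w) : Integrable w := by
  refine (((integrableOn_norm_inv_ball 2).integrable_indicator
    Metric.isOpen_ball.measurableSet).const_mul M).mono' h.measurable.aestronglyMeasurable
    (ae_of_all _ fun x => h.abs_le_indicator one_lt_two x)

theorem integral_abs_le (h : IsSingularVortex M w) : ∫ x, |w x| ≤ M * (4 * Real.pi) := by
  calc ∫ x, |w x| ≤ ∫ x, M * (Metric.ball (0 : Plane) 2).indicator (fun y => ‖y‖⁻¹) x :=
        integral_mono h.integrable.abs (((integrableOn_norm_inv_ball 2).integrable_indicator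
          Metric.isOpen_ball.measurableSet).const_mul M)
          (fun x => h.abs_le_indicator one_lt_two x)
    _ = M * (4 * Real.pi) := by
      rw [integral_const_mul, integral_indicator Metric.isOpen_ball.measurableSet,
        integral_norm_inv_ball two_pos]
      ring

theorem memLp (h : IsSingularVortex M w) {p : ℝ≥0∞} (hp : 1 < p) (hp2 : p < 2) :
    MemLp w p volume :=
  ((memLp_decay hp hp2).const_mul M).mono' h.measurable.aestronglyMeasurable
    (ae_of_all _ fun x => h.abs_le_decay x)

end IsSingularVortex

/-! ### Biot-Savart kernel and heat kernel. -/

theorem norm_biotSavart (x : Plane) : ‖biotSavart x‖ = (2 * Real.pi)⁻¹ * ‖x‖⁻¹ := by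
  have h : ‖(!₂[-(x 1), x 0] : Plane)‖ = ‖x‖ := by
    simp [EuclideanSpace.norm_eq, Fin.sum_univ_two, add_comm]
  rw [biotSavart, norm_smul, h, Real.norm_of_nonneg (by positivity)]
  rcases eq_or_ne ‖x‖ 0 with h0 | h0
  · simp [h0]
  · field_simp

theorem measurable_biotSavart : Measurable biotSavart := by
  have h : Measurable fun x : Plane => (!₂[-(x 1), x 0] : Plane) := by
    apply Continuous.measurable
    refine (PiLp.continuous_toLp 2 _).comp (continuous_pi fun i => ?_)
    fin_cases i <;> simp <;> fun_prop
  unfold biotSavart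
  exact ((measurable_norm.pow_const 2).const_mul _).inv.smul h

/-- The two-dimensional heat kernel at diffusion time `s`. -/
noncomputable def heatKernel (s : ℝ) (z : Plane) : ℝ :=
  (4 * Real.pi * s)⁻¹ * Real.exp (-‖z‖ ^ 2 / (4 * s))

/-- The convolution of `w` with the heat kernel at diffusion time `s`. -/
noncomputable def heatAverage (s : ℝ) (w : Plane → ℝ) (x : Plane) : ℝ :=
  ∫ y, heatKernel s (x - y) * w y

theorem heatEvolution_of_pos (ν : ℝ) (w : Plane → ℝ) {t : ℝ} (ht : 0 < t) (x : Plane) :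
    heatEvolution ν w t x = heatAverage (ν * t) w x := by
  simp only [heatEvolution, if_pos ht, heatAverage, heatKernel, mul_assoc]

theorem heatKernel_nonneg {s : ℝ} (hs : 0 < s) (z : Plane) : 0 ≤ heatKernel s z := by
  unfold heatKernel; positivity

theorem heatKernel_eq (s : ℝ) (z : Plane) :
    heatKernel s z = (4 * Real.pi * s)⁻¹ * Real.exp (-(4 * s)⁻¹ * ‖z‖ ^ 2) := by
  unfold heatKernel; congr 2; ring

theorem continuous_heatKernel (s : ℝ) : Continuous (heatKernel s) := by
  unfold heatKernel; fun_prop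

theorem integral_heatKernel {s : ℝ} (hs : 0 < s) : ∫ z, heatKernel s z = 1 := by
  simp_rw [heatKernel_eq]
  rw [integral_const_mul, GaussianFourier.integral_rexp_neg_mul_sq_norm (by positivity)]
  simp
  field_simp

theorem integrable_heatKernel {s : ℝ} (hs : 0 < s) : Integrable (heatKernel s) :=
  integrable_of_integral_eq_one (integral_heatKernel hs)

/-- From `exp(-r) ≤ 1/r`. The bound is free of `s`, which is what makes the later majorants uniform
in time and viscosity. -/
theorem heatKernel_le {s : ℝ} (hs : 0 < s) {z : Plane} (hz : z ≠ 0) :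
    heatKernel s z ≤ (Real.pi * ‖z‖ ^ 2)⁻¹ := by
  have hz : 0 < ‖z‖ := norm_pos_iff.2 hz
  have h1 : ‖z‖ ^ 2 / (4 * s) ≤ Real.exp (‖z‖ ^ 2 / (4 * s)) :=
    (by linarith : ‖z‖ ^ 2 / (4 * s) ≤ ‖z‖ ^ 2 / (4 * s) + 1).trans (Real.add_one_le_exp _)
  have h2 : Real.exp (-‖z‖ ^ 2 / (4 * s)) ≤ (‖z‖ ^ 2 / (4 * s))⁻¹ := by
    rw [neg_div, Real.exp_neg]
    exact inv_anti₀ (by positivity) h1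
  calc heatKernel s z ≤ (4 * Real.pi * s)⁻¹ * (‖z‖ ^ 2 / (4 * s))⁻¹ :=
        mul_le_mul_of_nonneg_left h2 (by positivity)
    _ = _ := by field_simp

theorem heatKernel_le_const {s : ℝ} (hs : 0 < s) (z : Plane) :
    heatKernel s z ≤ (4 * Real.pi * s)⁻¹ := by
  have : Real.exp (-‖z‖ ^ 2 / (4 * s)) ≤ 1 := Real.exp_le_one_iff.2 (by
    rw [neg_div]; have : 0 ≤ ‖z‖ ^ 2 / (4 * s) := by positivity
    linarith)
  exact mul_le_of_le_one_right (by positivity) this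

/-! ### Heat averages of a singular vortex: uniform bounds, limit at time zero, symmetry. -/

namespace IsSingularVortex

variable {M : ℝ} {w : Plane → ℝ}

theorem integrable_heatKernel_mul (h : IsSingularVortex M w) {s : ℝ} (hs : 0 < s) (x : Plane) :
    Integrable fun y => heatKernel s (x - y) * w y := by
  refine h.integrable.bdd_mul (c := (4 * Real.pi * s)⁻¹)
    ((continuous_heatKernel s).comp (by fun_prop)).aestronglyMeasurable (ae_of_all _ fun y => ?_)
  rw [Real.norm_of_nonneg (heatKernel_nonneg hs _)]
  exact heatKernel_le_const hs _

theorem heatKernel_far_le {s : ℝ} (hs : 0 < s) {x y : Plane} (hx : x ≠ 0) (hy : ‖y‖ ≤ ‖x‖ / 2) :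
    heatKernel s (x - y) ≤ 4 * (Real.pi * ‖x‖ ^ 2)⁻¹ := by
  have hx : 0 < ‖x‖ := norm_pos_iff.2 hx
  have h1 : ‖x‖ / 2 ≤ ‖x - y‖ := by
    have := norm_sub_norm_le x y
    linarith
  have h0 : x - y ≠ 0 := norm_pos_iff.1 (by linarith)
  refine (heatKernel_le hs h0).trans ?_
  rw [← inv_inv (4 : ℝ), ← mul_inv]
  refine inv_anti₀ (by positivity) ?_
  have : (‖x‖ / 2) ^ 2 ≤ ‖x - y‖ ^ 2 := by gcongr
  nlinarith [Real.pi_pos]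

/-- Split at `|y| = |x|/2`. For smaller `y` the kernel is at most `4/(π|x|²)` and `1/|y|` integrates
to `π|x|`, contributing `4M/|x|`; for larger `y` the vortex is at most `2M/|x|` and the kernel has
mass one. -/
theorem abs_heatAverage_le_inv (h : IsSingularVortex M w) {s : ℝ} (hs : 0 < s) {x : Plane}
    (hx0 : x ≠ 0) : |heatAverage s w x| ≤ 6 * M * ‖x‖⁻¹ := by
  have hx : 0 < ‖x‖ := norm_pos_iff.2 hx0
  have hM := h.nonneg
  have i1 : Integrable fun y => 2 * M * ‖x‖⁻¹ * heatKernel s (x - y) :=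
    ((integrable_heatKernel hs).comp_sub_left x).const_mul _
  have i2 : Integrable fun y : Plane => 4 * (Real.pi * ‖x‖ ^ 2)⁻¹ * M *
      (Metric.ball (0 : Plane) (‖x‖ / 2)).indicator (fun y => ‖y‖⁻¹) y :=
    ((integrableOn_norm_inv_ball _).integrable_indicator
      Metric.isOpen_ball.measurableSet).const_mul _
  calc |heatAverage s w x| ≤ ∫ y, |heatKernel s (x - y) * w y| := abs_integral_le_integral_abs
    _ ≤ ∫ y, (2 * M * ‖x‖⁻¹ * heatKernel s (x - y) + 4 * (Real.pi * ‖x‖ ^ 2)⁻¹ * M *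
      (Metric.ball (0 : Plane) (‖x‖ / 2)).indicator (fun y => ‖y‖⁻¹) y) := by
        refine integral_mono (h.integrable_heatKernel_mul hs x).abs (i1.add i2) fun y => ?_
        have hk := heatKernel_nonneg hs (x - y)
        simp only [abs_mul, abs_of_nonneg hk]
        by_cases hy : y ∈ Metric.ball (0 : Plane) (‖x‖ / 2)
        · rw [Set.indicator_of_mem hy]
          have hy' : ‖y‖ ≤ ‖x‖ / 2 := by simpa using (Metric.mem_ball.1 hy).le
          have := mul_le_mul (heatKernel_far_le hs hx0 hy') (h.abs_le y) (abs_nonneg _)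
            (by positivity)
          have h3 : 0 ≤ 2 * M * ‖x‖⁻¹ * heatKernel s (x - y) := by positivity
          linarith
        · rw [Set.indicator_of_notMem hy]
          have hy' : ‖x‖ / 2 ≤ ‖y‖ := by simpa using hy
          have : |w y| ≤ M * (2 * ‖x‖⁻¹) := (h.abs_le y).trans
            (mul_le_mul_of_nonneg_left ((inv_anti₀ (by positivity) hy').trans (by
              rw [inv_div]; exact le_of_eq (div_eq_mul_inv _ _))) hM)
          nlinarith
    _ = 6 * M * ‖x‖⁻¹ := by
        rw [integral_add i1 i2, integral_const_mul, integral_const_mul,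
          integral_sub_left_eq_self (heatKernel s) volume x, integral_heatKernel hs,
          integral_indicator Metric.isOpen_ball.measurableSet,
          integral_norm_inv_ball (by positivity)]
        field_simp
        ring

/-- For `|x| ≤ 2` this follows from the `1/|x|` bound. For `|x| > 2` the whole support of `w` lies
in `|y| ≤ |x|/2`, so the kernel bound multiplies the `L¹` norm, at most `4πM`. -/
theorem abs_heatAverage_le_sq (h : IsSingularVortex M w) {s : ℝ} (hs : 0 < s) {x : Plane}
    (hx0 : x ≠ 0) : |heatAverage s w x| ≤ 16 * M * (‖x‖ ^ 2)⁻¹ := by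
  have hx : 0 < ‖x‖ := norm_pos_iff.2 hx0
  have hM := h.nonneg
  rcases le_or_gt ‖x‖ 2 with h2 | h2
  · refine (h.abs_heatAverage_le_inv hs hx0).trans ?_
    rw [← div_eq_mul_inv, ← div_eq_mul_inv, div_le_div_iff₀ hx (by positivity)]
    nlinarith [mul_nonneg hM hx.le]
  · calc |heatAverage s w x| ≤ ∫ y, |heatKernel s (x - y) * w y| := abs_integral_le_integral_abs
      _ ≤ ∫ y, 4 * (Real.pi * ‖x‖ ^ 2)⁻¹ * |w y| := by
        refine integral_mono (h.integrable_heatKernel_mul hs x).abs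
          (h.integrable.abs.const_mul _) fun y => ?_
        simp only [abs_mul, abs_of_nonneg (heatKernel_nonneg hs (x - y))]
        rcases le_or_gt ‖y‖ 1 with hy | hy
        · exact mul_le_mul_of_nonneg_right (heatKernel_far_le hs hx0 (by linarith)) (abs_nonneg _)
        · simp [h.eq_zero y hy]
      _ ≤ 4 * (Real.pi * ‖x‖ ^ 2)⁻¹ * (M * (4 * Real.pi)) := by
        rw [integral_const_mul]
        exact mul_le_mul_of_nonneg_left h.integral_abs_le (by positivity)
      _ = 16 * M * (‖x‖ ^ 2)⁻¹ := by field_simp; ring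

theorem abs_heatAverage_le_decay (h : IsSingularVortex M w) {s : ℝ} (hs : 0 < s) {x : Plane}
    (hx : x ≠ 0) : |heatAverage s w x| ≤ 16 * M * decay x := by
  have hM := h.nonneg
  refine le_decay (by positivity) ((h.abs_heatAverage_le_inv hs hx).trans ?_)
    (h.abs_heatAverage_le_sq hs hx)
  exact mul_le_mul_of_nonneg_right (by linarith) (by positivity)

theorem abs_heatAverage_le_const (h : IsSingularVortex M w) {s : ℝ} (hs : 0 < s) (x : Plane) :
    |heatAverage s w x| ≤ M * s⁻¹ := by
  calc |heatAverage s w x| ≤ ∫ y, |heatKernel s (x - y) * w y| := abs_integral_le_integral_abs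
    _ ≤ ∫ y, (4 * Real.pi * s)⁻¹ * |w y| := by
      refine integral_mono (h.integrable_heatKernel_mul hs x).abs
        (h.integrable.abs.const_mul _) fun y => ?_
      simp only [abs_mul, abs_of_nonneg (heatKernel_nonneg hs (x - y))]
      exact mul_le_mul_of_nonneg_right (heatKernel_le_const hs _) (abs_nonneg _)
    _ ≤ (4 * Real.pi * s)⁻¹ * (M * (4 * Real.pi)) := by
      rw [integral_const_mul]
      exact mul_le_mul_of_nonneg_left h.integral_abs_le (by positivity)
    _ = M * s⁻¹ := by field_simp

/-- The heat kernels are the rescalings of the kernel at time `1`, hence an approximate identity;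
only continuity of `w` at the given point is needed. -/
theorem tendsto_heatAverage (h : IsSingularVortex M w) {x : Plane} (hx : x ≠ 0) :
    Tendsto (fun s => heatAverage s w x) (𝓝[>] 0) (𝓝 (w x)) := by
  have hd : Tendsto (fun z : Plane => ‖z‖ ^ Module.finrank ℝ Plane * heatKernel 1 z)
      (Bornology.cobounded Plane) (𝓝 0) := by
    have h1 : Tendsto (fun r : ℝ => (4 * Real.pi)⁻¹ * 4 * (r ^ 1 * Real.exp (-r))) atTop (𝓝 0) := by
      simpa using (Real.tendsto_pow_mul_exp_neg_atTop_nhds_zero 1).const_mul ((4 * Real.pi)⁻¹ * 4)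
    have h2 : Tendsto (fun z : Plane => ‖z‖ ^ 2 / 4) (Bornology.cobounded Plane) atTop :=
      ((tendsto_pow_atTop two_ne_zero).comp tendsto_norm_cobounded_atTop).atTop_div_const
        (by norm_num)
    refine (h1.comp h2).congr fun z => ?_
    simp [heatKernel, neg_div]
    ring
  have key := tendsto_integral_comp_smul_smul_of_integrable' (μ := (volume : Measure Plane))
    (heatKernel_nonneg one_pos) (integral_heatKernel one_pos) hd h.integrable (h.continuousAt x hx)
  -- Diffusion time `s` corresponds to the dilation factor `s^{-1/2}`, with Jacobian `1/s` in
  -- dimension two.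
  have hc : Tendsto (fun s : ℝ => (√s)⁻¹) (𝓝[>] 0) atTop := by
    refine tendsto_inv_nhdsGT_zero.comp (tendsto_nhdsWithin_iff.2 ⟨?_, ?_⟩)
    · simpa using (Real.continuous_sqrt.tendsto 0).mono_left nhdsWithin_le_nhds
    · filter_upwards [self_mem_nhdsWithin] with s hs using Real.sqrt_pos.2 hs
  refine (key.comp hc).congr' ?_
  filter_upwards [self_mem_nhdsWithin] with s hs
  have hs : 0 < s := hs
  simp only [Function.comp_apply, heatAverage]
  refine integral_congr_ae (ae_of_all _ fun y => ?_)
  have e : ((√s)⁻¹ * ‖x - y‖) ^ 2 = ‖x - y‖ ^ 2 / s := by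
    rw [mul_pow, inv_pow, Real.sq_sqrt hs.le]; ring
  simp only [heatKernel, norm_smul, norm_inv, Real.norm_of_nonneg (Real.sqrt_nonneg s), e,
    smul_eq_mul, finrank_euclideanSpace, Fintype.card_fin, inv_pow, Real.sq_sqrt hs.le]
  rw [show -(‖x - y‖ ^ 2 / s) / (4 * 1) = -‖x - y‖ ^ 2 / (4 * s) by field_simp]
  field_simp

/-- Two points of equal norm are exchanged by the reflection in the line orthogonal to their
difference, and this isometry preserves `w`, the kernel and Lebesgue measure. -/
theorem heatAverage_radial (h : IsSingularVortex M w) (s : ℝ) {x y : Plane} (hxy : ‖x‖ = ‖y‖) :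
    heatAverage s w x = heatAverage s w y := by
  obtain ⟨Q, hQ⟩ : ∃ Q : Plane ≃ₗᵢ[ℝ] Plane, Q x = y :=
    ⟨(Submodule.reflection (Submodule.span ℝ {x - y})ᗮ), Submodule.reflection_sub hxy⟩
  unfold heatAverage
  rw [← hQ, ← Q.measurePreserving.integral_comp Q.toHomeomorph.measurableEmbedding
    (fun z => heatKernel s (Q x - z) * w z)]
  refine integral_congr_ae (ae_of_all _ fun z => ?_)
  simp only [h.radial (Q z) z (Q.norm_map z), ← map_sub, heatKernel, Q.norm_map]

end IsSingularVortex

/-! ### Smoothness of heat averages and the heat equation. -/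

/-- Since `w` vanishes outside the unit ball, the derivative of the kernel needs a bound only on a
compact set of parameters and points; continuity supplies it and no growth condition enters. -/
theorem hasDerivAt_integral_mul_of_compact_support {w : Plane → ℝ} (hw : Integrable w)
    (hw0 : ∀ y, 1 < ‖y‖ → w y = 0) {U : Set ℝ} (hU : IsOpen U) {k k' : ℝ → Plane → ℝ}
    (hk : ∀ r ∈ U, Continuous (k r)) (hk' : ContinuousOn (Function.uncurry k') (U ×ˢ Set.univ))
    (hd : ∀ r ∈ U, ∀ y, HasDerivAt (fun r => k r y) (k' r y) r) {r₀ : ℝ} (hr₀ : r₀ ∈ U) :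
    HasDerivAt (fun r => ∫ y, k r y * w y) (∫ y, k' r₀ y * w y) r₀ := by
  obtain ⟨ε, hε, hεU⟩ := Metric.isOpen_iff.1 hU r₀ hr₀
  have hsub : Metric.closedBall r₀ (ε / 2) ⊆ U :=
    (Metric.closedBall_subset_ball (by linarith)).trans hεU
  have hcomp : IsCompact (Metric.closedBall r₀ (ε / 2) ×ˢ Metric.closedBall (0 : Plane) 1) :=
    (isCompact_closedBall _ _).prod (isCompact_closedBall _ _)
  obtain ⟨C, hC⟩ := hcomp.exists_bound_of_continuousOn
    (hk'.mono (Set.prod_mono hsub (Set.subset_univ _)))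
  obtain ⟨C', hC'⟩ := (isCompact_closedBall (0 : Plane) 1).exists_bound_of_continuousOn
    (hk r₀ hr₀).continuousOn
  have hcont' : Continuous (k' r₀) := by
    rw [← continuousOn_univ]
    exact hk'.comp (f := fun y : Plane => (r₀, y)) (by fun_prop) fun y _ => ⟨hr₀, Set.mem_univ _⟩
  refine (hasDerivAt_integral_of_dominated_loc_of_deriv_le (bound := fun y => C * |w y|)
    (F' := fun r y => k' r y * w y)
    (Metric.closedBall_mem_nhds r₀ (half_pos hε)) ?_ ?_ ?_ ?_ (hw.abs.const_mul C) ?_).2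
  · filter_upwards [hU.mem_nhds hr₀] with r hr
    exact (hk r hr).aestronglyMeasurable.mul hw.aestronglyMeasurable
  · refine (hw.abs.const_mul C').mono' ((hk r₀ hr₀).aestronglyMeasurable.mul
      hw.aestronglyMeasurable) (ae_of_all _ fun y => ?_)
    rw [norm_mul, Real.norm_eq_abs (w y)]
    rcases le_or_gt ‖y‖ 1 with hy | hy
    · exact mul_le_mul_of_nonneg_right (hC' y (by simpa using hy)) (abs_nonneg _)
    · simp [hw0 y hy]
  · exact hcont'.aestronglyMeasurable.mul hw.aestronglyMeasurable
  · refine ae_of_all _ fun y r hr => ?_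
    rw [norm_mul, Real.norm_eq_abs (w y)]
    rcases le_or_gt ‖y‖ 1 with hy | hy
    · exact mul_le_mul_of_nonneg_right (hC (r, y) ⟨hr, by simpa using hy⟩) (abs_nonneg _)
    · simp [hw0 y hy]
  · exact ae_of_all _ fun y r hr => (hd r (hsub hr) y).mul_const _

/-- Reduces the diagonal entries of the Hessian to derivatives in one variable, so that the
Laplacian can be computed under the integral sign. -/
theorem iteratedFDeriv_two_eq_of_hasDerivAt {f : Plane → ℝ} (hf : ContDiff ℝ 2 f) {x e : Plane}
    {g : ℝ → ℝ} {c : ℝ} (hg : ∀ r, HasDerivAt (fun r : ℝ => f (x + r • e)) (g r) r)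
    (hc : HasDerivAt g c 0) : iteratedFDeriv ℝ 2 f x ![e, e] = c := by
  have hl : ∀ r : ℝ, HasDerivAt (fun r : ℝ => x + r • e) e r := fun r => by
    simpa using ((hasDerivAt_id r).smul_const e).const_add x
  have h1 : ∀ r, g r = fderiv ℝ f (x + r • e) e := fun r =>
    (hg r).unique (((hf.differentiable two_ne_zero) _).hasFDerivAt.comp_hasDerivAt r (hl r))
  have h2 : HasDerivAt (fun r : ℝ => fderiv ℝ f (x + r • e)) (fderiv ℝ (fderiv ℝ f) x e) 0 := by
    have h3 : DifferentiableAt ℝ (fderiv ℝ f) (x + (0 : ℝ) • e) :=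
      (hf.fderiv_right (m := 1) (by norm_num)).differentiable one_ne_zero _
    have h4 := h3.hasFDerivAt.comp_hasDerivAt (0 : ℝ) (hl 0)
    rw [zero_smul, add_zero] at h4
    exact h4
  have h4 : HasDerivAt g (fderiv ℝ (fderiv ℝ f) x e e) 0 := by
    have := h2.clm_apply (hasDerivAt_const (0 : ℝ) e)
    simp only [map_zero, add_zero] at this
    exact this.congr_of_eventuallyEq (Eventually.of_forall h1)
  rw [iteratedFDeriv_two_apply]
  exact (h4.unique hc)

theorem hasDerivAt_heatKernel_time {s : ℝ} (hs : 0 < s) (z : Plane) :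
    HasDerivAt (fun s => heatKernel s z) (heatKernel s z * (‖z‖ ^ 2 / (4 * s ^ 2) - 1 / s)) s := by
  have h1 : HasDerivAt (fun s : ℝ => (4 * Real.pi * s)⁻¹)
      (-(4 * Real.pi * 1) / (4 * Real.pi * s) ^ 2) s :=
    ((hasDerivAt_id s).const_mul (4 * Real.pi)).inv (by positivity)
  have h2 : HasDerivAt (fun s : ℝ => -‖z‖ ^ 2 / (4 * s))
      ((0 * (4 * s) - -‖z‖ ^ 2 * (4 * 1)) / (4 * s) ^ 2) s :=
    (hasDerivAt_const s (-‖z‖ ^ 2)).div ((hasDerivAt_id s).const_mul 4) (by positivity)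
  refine (h1.mul h2.exp).congr_deriv ?_
  unfold heatKernel
  field_simp
  ring

theorem hasDerivAt_heatKernel_line (s : ℝ) (z e : Plane) (r : ℝ) :
    HasDerivAt (fun r : ℝ => heatKernel s (z + r • e))
      (heatKernel s (z + r • e) * (-inner ℝ (z + r • e) e / (2 * s))) r := by
  have hl : HasDerivAt (fun r : ℝ => z + r • e) e r := by
    simpa using ((hasDerivAt_id r).smul_const e).const_add z
  have h2 := ((hl.norm_sq.neg).div_const (4 * s)).exp.const_mul ((4 * Real.pi * s)⁻¹)
  refine h2.congr_deriv ?_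
  unfold heatKernel
  simp only [Pi.neg_apply]
  ring

theorem hasDerivAt_heatKernel_line_two (s : ℝ) (z e : Plane) (r : ℝ) :
    HasDerivAt (fun r : ℝ => heatKernel s (z + r • e) * (-inner ℝ (z + r • e) e / (2 * s)))
      (heatKernel s (z + r • e) *
        (inner ℝ (z + r • e) e ^ 2 / (4 * s ^ 2) - ‖e‖ ^ 2 / (2 * s))) r := by
  have hl : HasDerivAt (fun r : ℝ => z + r • e) e r := by
    simpa using ((hasDerivAt_id r).smul_const e).const_add z
  have h1 := (hl.inner ℝ (hasDerivAt_const r e)).neg.div_const (2 * s)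
  refine ((hasDerivAt_heatKernel_line s z e r).mul h1).congr_deriv ?_
  simp only [inner_zero_right, zero_add, real_inner_self_eq_norm_sq, Pi.neg_apply]
  ring

theorem contDiffOn_heatKernel :
    ContDiffOn ℝ ∞ (fun q : ℝ × Plane => heatKernel q.1 q.2) (Set.Ioi 0 ×ˢ Set.univ) := by
  intro q hq
  have hq0 : q.1 ≠ 0 := ne_of_gt hq.1
  refine ContDiffAt.contDiffWithinAt ?_
  unfold heatKernel
  refine ContDiffAt.mul (ContDiffAt.inv (by fun_prop) (by positivity)) (ContDiffAt.exp ?_)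
  refine ContDiffAt.div ?_ (by fun_prop) (by positivity)
  exact (contDiffAt_snd.norm_sq ℝ).neg

namespace IsSingularVortex

variable {M : ℝ} {w : Plane → ℝ}

theorem contDiffOn_heatAverage (h : IsSingularVortex M w) :
    ContDiffOn ℝ ∞ (fun q : ℝ × Plane => heatAverage q.1 w q.2) (Set.Ioi 0 ×ˢ Set.univ) := by
  intro q hq
  set R := ‖q.2‖ + 1
  have hR : 0 < R := by positivity
  -- The theorem on convolutions with a parameter asks for a kernel of compact support in space.
  -- Near `q` the cutoff changes nothing: `|x| < R` and `|y| ≤ 1` put `x - y` inside the ball where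
  -- `b` equals one.
  let b : ContDiffBump (0 : Plane) := ⟨R + 2, R + 3, by linarith, by linarith⟩
  have hb1 : ∀ ξ : Plane, ‖ξ‖ ≤ R + 2 → b ξ = 1 := fun ξ h =>
    b.one_of_mem_closedBall (by simpa using h)
  have hb0 : ∀ ξ : Plane, R + 3 ≤ ‖ξ‖ → b ξ = 0 := fun ξ h =>
    b.zero_of_le_dist (by simpa using h)
  have key := contDiffOn_convolution_right_with_param (n := ⊤) (μ := (volume : Measure Plane))
    (ContinuousLinearMap.mul ℝ ℝ) (f := w) (g := fun (s : ℝ) z => b z * heatKernel s z)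
    (k := Metric.closedBall 0 (R + 3)) isOpen_Ioi (isCompact_closedBall _ _)
    (fun p x _ hx => by
      rw [hb0 x (by simpa using (not_le.1 fun h' => hx (by simpa using h')).le), zero_mul])
    h.integrable.locallyIntegrable
    ((b.contDiff.comp contDiff_snd).contDiffOn.mul contDiffOn_heatKernel)
  refine ((key.contDiffAt ((isOpen_Ioi.prod isOpen_univ).mem_nhds hq)).congr_of_eventuallyEq
    ?_).contDiffWithinAt
  have hball : {p : ℝ × Plane | ‖p.2‖ < R} ∈ 𝓝 q :=
    (isOpen_lt (by fun_prop) continuous_const).mem_nhds (by simp [R])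
  filter_upwards [hball] with p hp
  simp only [convolution, ContinuousLinearMap.mul_apply', heatAverage]
  refine integral_congr_ae (ae_of_all _ fun y => ?_)
  rcases le_or_gt ‖y‖ 1 with hy | hy
  · have hn : ‖p.2 - y‖ ≤ R + 2 := by
      have := norm_sub_le p.2 y
      have hp : ‖p.2‖ < R := hp
      linarith
    simp only [hb1 _ hn]
    ring
  · simp [h.eq_zero y hy]

theorem contDiff_heatAverage (h : IsSingularVortex M w) {s : ℝ} (hs : 0 < s) :
    ContDiff ℝ ∞ (heatAverage s w) := by
  rw [← contDiffOn_univ]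
  exact h.contDiffOn_heatAverage.comp (f := fun x : Plane => (s, x)) (by fun_prop)
    fun x _ => ⟨hs, Set.mem_univ _⟩

/-- Differentiate under the integral, once in time and twice along each coordinate axis; the
identity then holds pointwise for the explicit kernel. -/
theorem heatAverage_heat_equation (h : IsSingularVortex M w) {s : ℝ} (hs : 0 < s) (x : Plane) :
    HasDerivAt (fun s => heatAverage s w x) (Δ (heatAverage s w) x) s := by
  have ht := hasDerivAt_integral_mul_of_compact_support h.integrable h.eq_zero isOpen_Ioi
    (k := fun s y => heatKernel s (x - y))
    (k' := fun s y => heatKernel s (x - y) * (‖x - y‖ ^ 2 / (4 * s ^ 2) - 1 / s))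
    (fun s _ => (continuous_heatKernel s).comp (by fun_prop))
    (by
      refine ContinuousOn.mul (contDiffOn_heatKernel.continuousOn.comp
        (f := fun p : ℝ × Plane => (p.1, x - p.2)) (by fun_prop) fun p hp => ⟨hp.1, Set.mem_univ _⟩) ?_
      refine ContinuousOn.sub (ContinuousOn.div (by fun_prop) (by fun_prop) fun p hp => ?_)
        (ContinuousOn.div (by fun_prop) (by fun_prop) fun p hp => ne_of_gt hp.1)
      have : p.1 ≠ 0 := ne_of_gt hp.1
      positivity)
    (fun s hs y => hasDerivAt_heatKernel_time hs _) hs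
  have hline : ∀ e : Plane, iteratedFDeriv ℝ 2 (heatAverage s w) x ![e, e] =
      ∫ y, heatKernel s (x - y) * (inner ℝ (x - y) e ^ 2 / (4 * s ^ 2) - ‖e‖ ^ 2 / (2 * s)) * w y := by
    intro e
    have hshift : ∀ (y : Plane) (r : ℝ), x + r • e - y = x - y + r • e := fun y r => by abel
    have c0 : Continuous fun p : ℝ × Plane => x - p.2 + p.1 • e := by fun_prop
    have hc : Continuous fun p : ℝ × Plane => heatKernel s (x - p.2 + p.1 • e) :=
      (continuous_heatKernel s).comp c0
    have hc1 : Continuous (Function.uncurry fun r (y : Plane) => heatKernel s (x - y + r • e) *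
        (-inner ℝ (x - y + r • e) e / (2 * s))) :=
      hc.mul ((c0.inner continuous_const).neg.div_const _)
    have hc2 : Continuous (Function.uncurry fun r (y : Plane) => heatKernel s (x - y + r • e) *
        (inner ℝ (x - y + r • e) e ^ 2 / (4 * s ^ 2) - ‖e‖ ^ 2 / (2 * s))) :=
      hc.mul ((((c0.inner continuous_const).pow 2).div_const _).sub continuous_const)
    refine iteratedFDeriv_two_eq_of_hasDerivAt (contDiff_infty.1 (h.contDiff_heatAverage hs) 2)
      (g := fun r => ∫ y, heatKernel s (x - y + r • e) *
        (-inner ℝ (x - y + r • e) e / (2 * s)) * w y) (fun r => ?_) ?_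
    · simp only [heatAverage, hshift]
      exact hasDerivAt_integral_mul_of_compact_support h.integrable h.eq_zero isOpen_univ
        (k := fun r y => heatKernel s (x - y + r • e))
        (fun r _ => hc.comp (f := fun y : Plane => (r, y)) (by fun_prop)) hc1.continuousOn
        (fun r _ y => hasDerivAt_heatKernel_line s _ e r) (Set.mem_univ r)
    · have := hasDerivAt_integral_mul_of_compact_support h.integrable h.eq_zero isOpen_univ
        (k := fun r y => heatKernel s (x - y + r • e) * (-inner ℝ (x - y + r • e) e / (2 * s)))
        (fun r _ => hc1.comp (f := fun y : Plane => (r, y)) (by fun_prop)) hc2.continuousOn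
        (fun r _ y => hasDerivAt_heatKernel_line_two s _ e r) (Set.mem_univ 0)
      simpa using this
  have hint : ∀ e : Plane, Integrable fun y => heatKernel s (x - y) *
      (inner ℝ (x - y) e ^ 2 / (4 * s ^ 2) - ‖e‖ ^ 2 / (2 * s)) * w y := by
    intro e
    have hc : Continuous fun y => heatKernel s (x - y) *
      (inner ℝ (x - y) e ^ 2 / (4 * s ^ 2) - ‖e‖ ^ 2 / (2 * s)) := by
      have c0 : Continuous fun y : Plane => x - y := by fun_prop
      exact ((continuous_heatKernel s).comp c0).mul
        ((((c0.inner continuous_const).pow 2).div_const _).sub continuous_const)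
    obtain ⟨C, hC⟩ := (isCompact_closedBall (0 : Plane) 1).exists_bound_of_continuousOn
      hc.continuousOn
    refine (h.integrable.abs.const_mul C).mono' (hc.aestronglyMeasurable.mul
      h.integrable.aestronglyMeasurable) (ae_of_all _ fun y => ?_)
    rw [norm_mul, Real.norm_eq_abs (w y)]
    rcases le_or_gt ‖y‖ 1 with hy | hy
    · exact mul_le_mul_of_nonneg_right (hC y (by simpa using hy)) (abs_nonneg _)
    · simp [h.eq_zero y hy]
  refine ht.congr_deriv ?_
  rw [InnerProductSpace.laplacian_eq_iteratedFDeriv_orthonormalBasis _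
    (EuclideanSpace.basisFun (Fin 2) ℝ)]
  simp only [hline]
  rw [Fin.sum_univ_two, ← integral_add (hint _) (hint _)]
  refine integral_congr_ae (ae_of_all _ fun y => ?_)
  simp only [EuclideanSpace.real_norm_sq_eq, Fin.sum_univ_two, EuclideanSpace.basisFun_apply,
    EuclideanSpace.inner_single_right]
  simp
  ring

end IsSingularVortex

/-! ### Rotations, and the velocity of a radial vorticity. -/

/-- The rotation by a right angle. -/
noncomputable def perp : Plane →ₗ[ℝ] Plane where
  toFun x := !₂[-(x 1), x 0]
  map_add' x y := by ext i; fin_cases i <;> simp; ring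
  map_smul' c x := by ext i; fin_cases i <;> simp

theorem perp_zero_coord (x : Plane) : perp x 0 = -(x 1) := rfl

theorem perp_one_coord (x : Plane) : perp x 1 = x 0 := rfl

theorem inner_plane (x y : Plane) : inner ℝ x y = x 0 * y 0 + x 1 * y 1 := by
  simp [PiLp.inner_apply, Fin.sum_univ_two]; ring

theorem inner_perp_left (x y : Plane) : inner ℝ (perp x) y = -inner ℝ x (perp y) := by
  simp only [inner_plane, perp_zero_coord, perp_one_coord]; ring

theorem inner_perp_self (x : Plane) : inner ℝ x (perp x) = 0 := by
  simp only [inner_plane, perp_zero_coord, perp_one_coord]; ring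

theorem norm_perp (x : Plane) : ‖perp x‖ = ‖x‖ := by
  simp [EuclideanSpace.norm_eq, Fin.sum_univ_two, perp_zero_coord, perp_one_coord, add_comm]

theorem perp_perp (x : Plane) : perp (perp x) = -x := by
  ext i; fin_cases i <;> simp [perp_zero_coord, perp_one_coord]

theorem continuous_perp : Continuous perp := perp.continuous_of_finiteDimensional

theorem biotSavart_eq (x : Plane) : biotSavart x = (2 * Real.pi * ‖x‖ ^ 2)⁻¹ • perp x := rfl

theorem eq_smul_perp {u x : Plane} (hx : x ≠ 0) (h : inner ℝ u x = 0) :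
    u = (inner ℝ u (perp x) / ‖x‖ ^ 2) • perp x := by
  have hn : ‖x‖ ^ 2 = x 0 ^ 2 + x 1 ^ 2 := by
    simp [EuclideanSpace.real_norm_sq_eq, Fin.sum_univ_two]
  have hx' : x 0 ^ 2 + x 1 ^ 2 ≠ 0 := by
    rw [← hn]; exact pow_ne_zero _ (norm_ne_zero_iff.2 hx)
  rw [inner_plane] at h
  ext i
  fin_cases i
  · simp only [inner_plane, perp_zero_coord, perp_one_coord, hn, Fin.zero_eta, PiLp.smul_apply,
      smul_eq_mul]
    field_simp
    linear_combination x 0 * h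
  · simp only [inner_plane, perp_zero_coord, perp_one_coord, hn, Fin.mk_one, PiLp.smul_apply,
      smul_eq_mul]
    field_simp
    linear_combination x 1 * h

/-- The rotation of the plane by the angle `θ`. -/
noncomputable def planeRotation (θ : ℝ) : Plane ≃ₗᵢ[ℝ] Plane :=
  LinearIsometryEquiv.mk
    (LinearEquiv.ofLinearMap (Real.cos θ • LinearMap.id + Real.sin θ • perp)
      (Real.cos θ • LinearMap.id - Real.sin θ • perp)
      (by
        ext x i
        have := Real.sin_sq_add_cos_sq θ
        fin_cases i <;> simp [perp_zero_coord, perp_one_coord]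
        · linear_combination (x 0) * this
        · linear_combination (x 1) * this)
      (by
        ext x i
        have := Real.sin_sq_add_cos_sq θ
        fin_cases i <;> simp [perp_zero_coord, perp_one_coord]
        · linear_combination (x 0) * this
        · linear_combination (x 1) * this))
    (fun x => by
      have h : ‖Real.cos θ • x + Real.sin θ • perp x‖ ^ 2 = ‖x‖ ^ 2 := by
        rw [norm_add_sq_real, norm_smul, norm_smul, norm_perp, inner_smul_left, inner_smul_right,
          inner_perp_self]
        simp only [Real.norm_eq_abs, mul_pow, sq_abs]
        linear_combination ‖x‖ ^ 2 * Real.sin_sq_add_cos_sq θ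
      exact (sq_eq_sq₀ (norm_nonneg _) (norm_nonneg _)).1 h)

theorem planeRotation_apply (θ : ℝ) (x : Plane) :
    planeRotation θ x = Real.cos θ • x + Real.sin θ • perp x := rfl

theorem planeRotation_perp (θ : ℝ) (x : Plane) :
    planeRotation θ (perp x) = perp (planeRotation θ x) := by
  simp [planeRotation_apply]

theorem hasDerivAt_planeRotation (θ : ℝ) (x : Plane) :
    HasDerivAt (fun θ => planeRotation θ x) (planeRotation θ (perp x)) θ := by
  refine (((Real.hasDerivAt_cos θ).smul_const x).add
    ((Real.hasDerivAt_sin θ).smul_const (perp x))).congr_deriv ?_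
  rw [planeRotation_apply, perp_perp]
  simp [add_comm]

theorem continuous_planeRotation :
    Continuous fun p : ℝ × Plane => planeRotation p.1 p.2 := by
  simp only [planeRotation_apply]
  have := continuous_perp
  fun_prop

section Velocity

variable {w : Plane → ℝ}

theorem velocity_planeRotation (hw : ∀ x y, ‖x‖ = ‖y‖ → w x = w y) (θ : ℝ) (x : Plane) :
    velocity w (planeRotation θ x) = planeRotation θ (velocity w x) := by
  -- A continuous linear equivalence commutes with the integral without any integrability, so points
  -- where the defining integral diverges need no separate treatment.
  have hc := (planeRotation θ).toContinuousLinearEquiv.integral_comp_comm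
    (μ := volume) (fun y => w y • biotSavart (x - y))
  change _ = (planeRotation θ).toContinuousLinearEquiv _
  rw [velocity, velocity, ← hc,
    ← (planeRotation θ).measurePreserving.integral_comp
      (planeRotation θ).toHomeomorph.measurableEmbedding]
  refine integral_congr_ae (ae_of_all _ fun y => ?_)
  change w (planeRotation θ y) • biotSavart (planeRotation θ x - planeRotation θ y) =
    planeRotation θ (w y • biotSavart (x - y))
  rw [hw _ y ((planeRotation θ).norm_map y), ← map_sub, biotSavart_eq, biotSavart_eq, map_smul,
    map_smul, planeRotation_perp, (planeRotation θ).norm_map]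

/-- The reflection across the line through `x` preserves `w` and `|x - y|` but changes the sign of
`x · (x - y)^⊥`, so the integrand of the radial component is odd. -/
theorem inner_velocity_self (hw : ∀ x y, ‖x‖ = ‖y‖ → w x = w y) (x : Plane) :
    inner ℝ (velocity w x) x = 0 := by
  by_cases hi : Integrable fun y => w y • biotSavart (x - y)
  swap
  · rw [velocity, integral_undef hi, inner_zero_left]
  rw [velocity, real_inner_comm, ← integral_inner hi]
  let R := Submodule.reflection (Submodule.span ℝ {x})
  have hRx : R x = x := Submodule.reflection_mem_subspace_eq_self
    (Submodule.mem_span_singleton_self x)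
  have hRp : R (perp x) = -perp x := by
    refine Submodule.reflection_mem_subspace_orthogonalComplement_eq_neg ?_
    rw [Submodule.mem_orthogonal_singleton_iff_inner_right]
    exact inner_perp_self x
  have hinv : ∀ a b : Plane, inner ℝ (R a) b = inner ℝ a (R b) := fun a b => by
    rw [← R.inner_map_map a (R b), Submodule.reflection_reflection]
  have hodd : ∀ y, inner ℝ x (w (R y) • biotSavart (x - R y)) =
      -inner ℝ x (w y • biotSavart (x - y)) := by
    intro y
    have e1 : ‖x - R y‖ = ‖x - y‖ := by
      rw [← R.norm_map (x - y), map_sub, hRx]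
    rw [hw _ y (R.norm_map y), biotSavart_eq, biotSavart_eq, e1, map_sub, map_sub]
    have e2 : inner ℝ x (perp (R y)) = -inner ℝ x (perp y) := by
      rw [real_inner_comm, real_inner_comm (perp y), inner_perp_left, inner_perp_left, hinv,
        hRp, inner_neg_right]
    simp only [inner_smul_right, inner_sub_right, inner_perp_self, e2]
    ring
  have h := R.measurePreserving.integral_comp R.toHomeomorph.measurableEmbedding
    (fun y => inner ℝ x (w y • biotSavart (x - y)))
  have h' : ∫ y, inner ℝ x (w (R y) • biotSavart (x - R y)) =
      -∫ y, inner ℝ x (w y • biotSavart (x - y)) := by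
    simp_rw [hodd]; exact integral_neg _
  linarith [h.symm.trans h']

theorem stronglyMeasurable_velocity (hw : Measurable w) : StronglyMeasurable (velocity w) := by
  have : StronglyMeasurable fun p : Plane × Plane => w p.2 • biotSavart (p.1 - p.2) :=
    ((hw.comp measurable_snd).smul
      (measurable_biotSavart.comp (measurable_fst.sub measurable_snd))).stronglyMeasurable
  exact this.integral_prod_right

theorem velocityConverges_of_bounded (hw : Integrable w) {B : ℝ} (hB : ∀ y, |w y| ≤ B)
    (x : Plane) : VelocityConverges w x := by
  have hB0 : 0 ≤ B := (abs_nonneg _).trans (hB 0)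
  have i1 : Integrable fun y : Plane =>
      (Metric.ball (0 : Plane) 1).indicator (fun z => ‖z‖⁻¹) (x - y) :=
    ((integrableOn_norm_inv_ball 1).integrable_indicator
      Metric.isOpen_ball.measurableSet).comp_sub_left x
  refine ((i1.const_mul B).add hw.abs).mono' (hw.aestronglyMeasurable.smul
    (measurable_biotSavart.comp (measurable_const.sub measurable_id)).aestronglyMeasurable)
    (ae_of_all _ fun y => ?_)
  have hk : ‖biotSavart (x - y)‖ ≤ ‖x - y‖⁻¹ := by
    rw [norm_biotSavart]
    refine mul_le_of_le_one_left (by positivity) (inv_le_one_of_one_le₀ ?_)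
    linarith [Real.pi_gt_three]
  rw [norm_smul, Real.norm_eq_abs]
  by_cases hy : x - y ∈ Metric.ball (0 : Plane) 1
  · simp only [Set.indicator_of_mem hy, Pi.add_apply]
    have := mul_le_mul (hB y) hk (norm_nonneg _) hB0
    linarith [abs_nonneg (w y)]
  · simp only [Set.indicator_of_notMem hy, Pi.add_apply, mul_zero, zero_add]
    refine mul_le_of_le_one_right (abs_nonneg _) (hk.trans (inv_le_one_of_one_le₀ ?_))
    simpa using hy

/-- If `v` is orthogonal to `x`, then `x + rv` and `x - rv` have the same norm, so `r ↦ w (x + r v)`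
is even and its derivative at `0` vanishes. -/
theorem fderiv_eq_zero_of_radial (hw : ∀ x y, ‖x‖ = ‖y‖ → w x = w y) (hd : Differentiable ℝ w)
    {x v : Plane} (hv : inner ℝ v x = 0) : fderiv ℝ w x v = 0 := by
  have hl : ∀ v : Plane, HasDerivAt (fun r : ℝ => x + r • v) v 0 := fun v => by
    simpa using ((hasDerivAt_id (0 : ℝ)).smul_const v).const_add x
  have hd' : ∀ v : Plane, HasDerivAt (fun r : ℝ => w (x + r • v)) (fderiv ℝ w x v) 0 := fun v => by
    have h0 : HasFDerivAt w (fderiv ℝ w x) (x + (0 : ℝ) • v) := by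
      simpa using (hd x).hasFDerivAt
    exact h0.comp_hasDerivAt (0 : ℝ) (hl v)
  have he : (fun r : ℝ => w (x + r • v)) = fun r : ℝ => w (x + r • -v) := by
    funext r
    refine hw _ _ ((sq_eq_sq₀ (norm_nonneg _) (norm_nonneg _)).1 ?_)
    rw [norm_add_sq_real, norm_add_sq_real]
    simp [inner_smul_right, real_inner_comm v x, hv]
  have h1 := hd' v
  rw [he] at h1
  have h2 := h1.unique (hd' (-v))
  rw [map_neg] at h2
  linarith

end Velocity

/-! ### Growth of the velocity at the origin, and vanishing of the weak transport term. -/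

/-- The larger of `a` and `b` is at least `r/2`, so half a power of it can be traded for `r^{-1/2}`.
With `a = |y|`, `b = |x - y|`, `r = |x|` this separates the two singularities into terms of order
`-3/2`, locally integrable in the plane. -/
theorem inv_mul_inv_le {a b r : ℝ} (ha : 0 ≤ a) (hb : 0 ≤ b) (hr : 0 < r) (h : r ≤ a + b) :
    a⁻¹ * b⁻¹ ≤ 2 * (√r)⁻¹ * ((√a ^ 3)⁻¹ + (√b ^ 3)⁻¹) := by
  wlog hab : a ≤ b generalizing a b
  · have := this hb ha (by linarith) (le_of_not_ge hab)
    rw [mul_comm a⁻¹, add_comm (√a ^ 3)⁻¹]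
    exact this
  rcases ha.eq_or_lt with h0 | h0
  · rw [← h0]; simp; positivity
  have hb0 : 0 < b := h0.trans_le hab
  have hA : 0 < √a := Real.sqrt_pos.2 h0
  have hB : 0 < √b := Real.sqrt_pos.2 hb0
  have hR : 0 < √r := Real.sqrt_pos.2 hr
  have hAB : √a ≤ √b := Real.sqrt_le_sqrt hab
  have hRB : √r ≤ 2 * √b := by
    rw [show (2 : ℝ) * √b = √(4 * b) by
      rw [Real.sqrt_mul (by norm_num), show (4 : ℝ) = 2 ^ 2 by norm_num, Real.sqrt_sq two_pos.le]]
    exact Real.sqrt_le_sqrt (by linarith)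
  have h1 : a⁻¹ * b⁻¹ ≤ 2 * (√r)⁻¹ * (√a ^ 3)⁻¹ := by
    nth_rewrite 1 [← Real.sq_sqrt ha, ← Real.sq_sqrt hb]
    rw [← mul_inv, mul_assoc, ← mul_inv, ← div_eq_mul_inv, inv_eq_one_div,
      div_le_div_iff₀ (by positivity) (by positivity), one_mul]
    calc √r * √a ^ 3 ≤ (2 * √b) * (√a ^ 2 * √b) := by
          refine mul_le_mul hRB ?_ (by positivity) (by positivity)
          rw [pow_succ]
          gcongr
      _ = 2 * (√a ^ 2 * √b ^ 2) := by ring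
  have : 0 ≤ 2 * (√r)⁻¹ * (√b ^ 3)⁻¹ := by positivity
  linarith

theorem sqrt_cube_inv_eq_rpow {r : ℝ} (hr : 0 ≤ r) : (√r ^ 3)⁻¹ = r ^ (-(3 / 2 : ℝ)) := by
  rw [Real.sqrt_eq_rpow, ← Real.rpow_natCast, ← Real.rpow_mul hr, ← Real.rpow_neg hr]
  norm_num

theorem integrable_indicator_sqrt_cube_inv (R : ℝ) :
    Integrable ((Metric.ball (0 : Plane) R).indicator fun z => (√‖z‖ ^ 3)⁻¹) := by
  rw [integrable_indicator_iff Metric.isOpen_ball.measurableSet]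
  simp_rw [fun z : Plane => sqrt_cube_inv_eq_rpow (norm_nonneg z)]
  exact integrableOn_norm_rpow_ball (by norm_num) R

namespace IsSingularVortex

variable {M : ℝ} {w : Plane → ℝ}

/-- The singular terms are cut off at radius `2` to be integrable on the whole plane. Where `|x - y|
≥ 2` the discarded term is at most one, which the last indicator pays for on the support of `w`. The
factor `1/(2π) ≤ 1/2` absorbs the `2` of `inv_mul_inv_le`. -/
theorem norm_smul_biotSavart_le (h : IsSingularVortex M w) {x : Plane} (hx : x ≠ 0) (y : Plane) :
    ‖w y • biotSavart (x - y)‖ ≤ M * (√‖x‖)⁻¹ *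
      ((Metric.ball (0 : Plane) 2).indicator (fun z => (√‖z‖ ^ 3)⁻¹) y +
        ((Metric.ball (0 : Plane) 2).indicator (fun z => (√‖z‖ ^ 3)⁻¹) (x - y) +
          (Metric.ball (0 : Plane) 2).indicator (fun _ => 1) y)) := by
  have hM := h.nonneg
  have hx : 0 < ‖x‖ := norm_pos_iff.2 hx
  have hS : ∀ z, 0 ≤ (Metric.ball (0 : Plane) 2).indicator (fun z => (√‖z‖ ^ 3)⁻¹) z := fun z =>
    Set.indicator_nonneg (fun _ _ => by positivity) z
  rcases lt_or_ge 1 ‖y‖ with hy | hy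
  · rw [h.eq_zero y hy, zero_smul, norm_zero]
    have := hS y
    have := hS (x - y)
    have : 0 ≤ (Metric.ball (0 : Plane) 2).indicator (fun _ => (1 : ℝ)) y :=
      Set.indicator_nonneg (fun _ _ => zero_le_one) y
    positivity
  have hyb : y ∈ Metric.ball (0 : Plane) 2 := by simp; linarith
  rw [Set.indicator_of_mem hyb, Set.indicator_of_mem hyb]
  have h1 : (√‖x - y‖ ^ 3)⁻¹ ≤
      (Metric.ball (0 : Plane) 2).indicator (fun z => (√‖z‖ ^ 3)⁻¹) (x - y) + 1 := by
    by_cases hz : x - y ∈ Metric.ball (0 : Plane) 2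
    · rw [Set.indicator_of_mem hz]; linarith
    · rw [Set.indicator_of_notMem hz, zero_add]
      refine inv_le_one_of_one_le₀ (one_le_pow₀ (Real.one_le_sqrt.2 ?_))
      have : 2 ≤ ‖x - y‖ := by simpa using hz
      linarith
  have h2 : ‖y‖⁻¹ * ‖x - y‖⁻¹ ≤ 2 * (√‖x‖)⁻¹ * ((√‖y‖ ^ 3)⁻¹ + (√‖x - y‖ ^ 3)⁻¹) :=
    inv_mul_inv_le (norm_nonneg _) (norm_nonneg _) hx (by
      simpa using norm_add_le y (x - y))
  have hpi : (2 * Real.pi)⁻¹ ≤ 2⁻¹ := inv_anti₀ two_pos (by linarith [Real.pi_gt_three])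
  calc ‖w y • biotSavart (x - y)‖ ≤ (M * ‖y‖⁻¹) * (2⁻¹ * ‖x - y‖⁻¹) := by
        rw [norm_smul, norm_biotSavart, Real.norm_eq_abs]
        have := h.abs_le y
        gcongr
    _ = M * 2⁻¹ * (‖y‖⁻¹ * ‖x - y‖⁻¹) := by ring
    _ ≤ M * 2⁻¹ * (2 * (√‖x‖)⁻¹ * ((√‖y‖ ^ 3)⁻¹ + (√‖x - y‖ ^ 3)⁻¹)) := by gcongr
    _ = M * (√‖x‖)⁻¹ * ((√‖y‖ ^ 3)⁻¹ + (√‖x - y‖ ^ 3)⁻¹) := by ring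
    _ ≤ _ := by gcongr

theorem integrable_majorant (x : Plane) : Integrable fun y =>
    ((Metric.ball (0 : Plane) 2).indicator (fun z => (√‖z‖ ^ 3)⁻¹) y +
        ((Metric.ball (0 : Plane) 2).indicator (fun z => (√‖z‖ ^ 3)⁻¹) (x - y) +
          (Metric.ball (0 : Plane) 2).indicator (fun _ => (1 : ℝ)) y)) :=
  (integrable_indicator_sqrt_cube_inv 2).add
    (((integrable_indicator_sqrt_cube_inv 2).comp_sub_left x).add
      ((integrable_indicator_iff Metric.isOpen_ball.measurableSet).2
        (integrableOn_const measure_ball_lt_top.ne)))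

theorem velocityConverges (h : IsSingularVortex M w) {x : Plane} (hx : x ≠ 0) :
    VelocityConverges w x :=
  ((integrable_majorant x).const_mul (M * (√‖x‖)⁻¹)).mono'
    (h.measurable.smul (measurable_biotSavart.comp
      (measurable_const.sub measurable_id))).aestronglyMeasurable
    (ae_of_all _ (h.norm_smul_biotSavart_le hx))

/-- This rate is not sharp, but it suffices: `|x|^{-1/2}` is square integrable near the origin and
bounded away from it, and its product with `|x|⁻¹` is locally integrable. -/
theorem exists_norm_velocity_le (h : IsSingularVortex M w) :
    ∃ C, 0 ≤ C ∧ ∀ x, x ≠ 0 → ‖velocity w x‖ ≤ C * (√‖x‖)⁻¹ := by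
  have hM := h.nonneg
  let I := ∫ y, (Metric.ball (0 : Plane) 2).indicator (fun z => (√‖z‖ ^ 3)⁻¹) y
  let V := ∫ y, (Metric.ball (0 : Plane) 2).indicator (fun _ => (1 : ℝ)) y
  have hI : 0 ≤ I := integral_nonneg fun y => Set.indicator_nonneg (fun _ _ => by positivity) y
  have hV : 0 ≤ V := integral_nonneg fun y => Set.indicator_nonneg (fun _ _ => zero_le_one) y
  refine ⟨M * (I + (I + V)), by positivity, fun x hx => ?_⟩
  refine (norm_integral_le_of_norm_le ((integrable_majorant x).const_mul (M * (√‖x‖)⁻¹))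
    (ae_of_all _ (h.norm_smul_biotSavart_le hx))).trans (le_of_eq ?_)
  have i1 := integrable_indicator_sqrt_cube_inv 2
  have i2 : Integrable ((Metric.ball (0 : Plane) 2).indicator (fun _ => (1 : ℝ))) :=
    (integrable_indicator_iff Metric.isOpen_ball.measurableSet).2
        (integrableOn_const measure_ball_lt_top.ne)
  have i3 : Integrable fun y =>
      (Metric.ball (0 : Plane) 2).indicator (fun z => (√‖z‖ ^ 3)⁻¹) (x - y) +
        (Metric.ball (0 : Plane) 2).indicator (fun _ => (1 : ℝ)) y := (i1.comp_sub_left x).add i2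
  rw [integral_const_mul, integral_add i1 i3, integral_add (i1.comp_sub_left x) i2,
    integral_sub_left_eq_self ((Metric.ball (0 : Plane) 2).indicator fun z => (√‖z‖ ^ 3)⁻¹)]
  ring

theorem velocityMemLinfty (h : IsSingularVortex M w) (T : ℝ) :
    VelocityMemLinfty T (fun _ => w) := by
  obtain ⟨C, hC, hu⟩ := h.exists_norm_velocity_le
  let B := Metric.ball (0 : Plane) 1
  have hB : MeasurableSet B := Metric.isOpen_ball.measurableSet
  have hm := (stronglyMeasurable_velocity h.measurable)
  have hg : MemLp (B.indicator fun x : Plane => (√‖x‖)⁻¹) 2 volume := by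
    rw [memLp_two_iff_integrable_sq]
    · have : (fun x => (B.indicator (fun x : Plane => (√‖x‖)⁻¹) x) ^ 2) =
          B.indicator fun x : Plane => ‖x‖⁻¹ := by
        funext x
        by_cases hx : x ∈ B
        · simp [hx, Real.sq_sqrt]
        · simp [hx]
      rw [this]
      exact (integrableOn_norm_inv_ball 1).integrable_indicator hB
    · exact (Measurable.indicator (by fun_prop) hB).aestronglyMeasurable
  have h2 : MemLp (B.indicator (velocity w)) 2 volume := by
    refine (hg.const_mul C).mono' (hm.indicator hB).aestronglyMeasurable ?_
    filter_upwards [compl_mem_ae_iff.2 (measure_singleton (0 : Plane))] with x hx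
    by_cases hxB : x ∈ B
    · simpa [hxB] using hu x hx
    · simp [hxB]
  have h3 : eLpNorm (Bᶜ.indicator (velocity w)) ⊤ volume ≤ ENNReal.ofReal C := by
    rw [eLpNorm_exponent_top]
    refine eLpNormEssSup_le_of_ae_bound (ae_of_all _ fun x => ?_)
    by_cases hxB : x ∈ B
    · simpa [hxB] using hC
    · have hx1 : 1 ≤ ‖x‖ := by simpa [B] using hxB
      have hx0 : x ≠ 0 := norm_pos_iff.1 (by linarith)
      rw [Set.indicator_of_mem (show x ∈ Bᶜ from hxB)]
      exact (hu x hx0).trans (mul_le_of_le_one_right hC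
        (inv_le_one_of_one_le₀ (Real.one_le_sqrt.2 hx1)))
  refine ⟨(eLpNorm (B.indicator (velocity w)) 2 volume).toNNReal + C.toNNReal,
    ae_of_all _ fun t => ⟨B.indicator (velocity w), Bᶜ.indicator (velocity w),
      (hm.indicator hB).aestronglyMeasurable, (hm.indicator hB.compl).aestronglyMeasurable, ?_, ?_,
      ae_of_all _ fun x => ?_⟩⟩
  · rw [ENNReal.coe_add, ENNReal.coe_toNNReal h2.eLpNorm_ne_top]
    exact le_self_add
  · exact h3.trans (by rw [ENNReal.coe_add]; exact le_add_self)
  · exact (Set.indicator_self_add_compl_apply B (velocity w) x).symm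

/-- The majorant of the transport term of the weak formulation. -/
theorem exists_abs_velocity_mul_le (h : IsSingularVortex M w) :
    ∃ G : Plane → ℝ, Integrable G ∧ ∀ x, x ≠ 0 → ‖velocity w x‖ * |w x| ≤ G x := by
  obtain ⟨C, hC, hu⟩ := h.exists_norm_velocity_le
  refine ⟨_, (integrable_indicator_sqrt_cube_inv 2).const_mul (C * M), fun x hx => ?_⟩
  have hx' : 0 < ‖x‖ := norm_pos_iff.2 hx
  have h1 := mul_le_mul (hu x hx) (h.abs_le_indicator one_lt_two x) (abs_nonneg _) (by positivity)
  refine h1.trans (le_of_eq ?_)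
  by_cases hxB : x ∈ Metric.ball (0 : Plane) 2
  · rw [Set.indicator_of_mem hxB, Set.indicator_of_mem hxB, pow_succ, Real.sq_sqrt hx'.le, mul_inv]
    ring
  · simp [hxB]

/-- On the circle through `x` the vortex is constant and the velocity is a fixed multiple of the
tangent, so the integrand is the derivative of `c * w x * f` along the circle; a full turn returns
to the starting point. -/
theorem integral_rotation_transport_eq_zero (h : IsSingularVortex M w) {f : Plane → ℝ}
    (hf : ContDiff ℝ 1 f) {x : Plane} (hx : x ≠ 0) :
    ∫ θ in Set.Ioc 0 (2 * Real.pi), fderiv ℝ f (planeRotation θ x)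
      (velocity w (planeRotation θ x)) * w (planeRotation θ x) = 0 := by
  have hcf : Continuous (fderiv ℝ f) := hf.continuous_fderiv one_ne_zero
  let F : Plane → ℝ := fun x => fderiv ℝ f x (velocity w x) * w x
  change ∫ θ in Set.Ioc 0 (2 * Real.pi), F (planeRotation θ x) = 0
  set c := inner ℝ (velocity w x) (perp x) / ‖x‖ ^ 2
  have hc : velocity w x = c • perp x := eq_smul_perp hx (inner_velocity_self h.radial x)
  have hder : ∀ θ : ℝ, HasDerivAt (fun θ => c * w x * f (planeRotation θ x))
      (F (planeRotation θ x)) θ := by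
    intro θ
    have := (((hf.differentiable one_ne_zero) (planeRotation θ x)).hasFDerivAt.comp_hasDerivAt θ
      (hasDerivAt_planeRotation θ x)).const_mul (c * w x)
    refine this.congr_deriv ?_
    simp only [F]
    rw [velocity_planeRotation h.radial, h.radial _ x ((planeRotation θ).norm_map x), hc,
      map_smul, map_smul, smul_eq_mul]
    ring
  have hcont : Continuous fun θ => F (planeRotation θ x) := by
    have : (fun θ => F (planeRotation θ x)) = fun θ =>
        fderiv ℝ f (planeRotation θ x) (planeRotation θ (velocity w x)) * w x := by
      funext θ
      simp only [F]
      rw [velocity_planeRotation h.radial, h.radial _ x ((planeRotation θ).norm_map x)]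
    rw [this]
    have c1 : ∀ v : Plane, Continuous fun θ => planeRotation θ v := fun v =>
      continuous_iff_continuousAt.2 fun θ => (hasDerivAt_planeRotation θ v).continuousAt
    exact ((hcf.comp (c1 x)).clm_apply (c1 _)).mul continuous_const
  rw [← intervalIntegral.integral_of_le (by positivity),
    intervalIntegral.integral_eq_sub_of_hasDerivAt (fun θ _ => hder θ)
      (hcont.intervalIntegrable _ _)]
  simp [planeRotation_apply]

/-- Rotating the variable does not change the integral, so `2π` times it is the integral over all
angles; by Fubini the angular integral can be taken inside, where it vanishes. No derivative of the
singular `w` is ever taken. -/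
theorem integral_transport_eq_zero (h : IsSingularVortex M w) {f : Plane → ℝ}
    (hf : ContDiff ℝ 1 f) {B : ℝ} (hB : ∀ x, ‖fderiv ℝ f x‖ ≤ B) :
    ∫ x, fderiv ℝ f x (velocity w x) * w x = 0 := by
  obtain ⟨G, hG, hGle⟩ := h.exists_abs_velocity_mul_le
  have hB0 : 0 ≤ B := (norm_nonneg _).trans (hB 0)
  have hcf : Continuous (fderiv ℝ f) := hf.continuous_fderiv one_ne_zero
  let F : Plane → ℝ := fun x => fderiv ℝ f x (velocity w x) * w x
  have hFm : Measurable F :=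
    (isBoundedBilinearMap_apply.continuous.comp_stronglyMeasurable (hcf.stronglyMeasurable.prodMk
      (stronglyMeasurable_velocity h.measurable))).measurable.mul h.measurable
  have hFle : ∀ θ x, x ≠ 0 → ‖F (planeRotation θ x)‖ ≤ B * G x := by
    intro θ x hx
    simp only [F, norm_mul, Real.norm_eq_abs (w _)]
    calc _ ≤ (‖fderiv ℝ f (planeRotation θ x)‖ * ‖velocity w (planeRotation θ x)‖) *
          |w (planeRotation θ x)| := by gcongr; exact ContinuousLinearMap.le_opNorm _ _
      _ = ‖fderiv ℝ f (planeRotation θ x)‖ * (‖velocity w x‖ * |w x|) := by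
        rw [velocity_planeRotation h.radial, (planeRotation θ).norm_map,
          h.radial _ x ((planeRotation θ).norm_map x), mul_assoc]
      _ ≤ B * G x := mul_le_mul (hB _) (hGle x hx) (by positivity) hB0
  have hint : Integrable (Function.uncurry fun θ x => F (planeRotation θ x))
      ((volume.restrict (Set.Ioc 0 (2 * Real.pi))).prod volume) := by
    refine ((hG.const_mul B).comp_snd (volume.restrict (Set.Ioc 0 (2 * Real.pi)))).mono'
      (hFm.comp continuous_planeRotation.measurable).aestronglyMeasurable ?_
    have : ∀ᵐ z ∂((volume.restrict (Set.Ioc 0 (2 * Real.pi))).prod (volume : Measure Plane)),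
        z.2 ≠ 0 := Measure.quasiMeasurePreserving_snd.ae
          (compl_mem_ae_iff.2 (measure_singleton (0 : Plane)))
    filter_upwards [this] with z hz using hFle z.1 z.2 hz
  have hswap : ∫ θ in Set.Ioc 0 (2 * Real.pi), (∫ x, F (planeRotation θ x)) =
      ∫ x, (∫ θ in Set.Ioc 0 (2 * Real.pi), F (planeRotation θ x)) := integral_integral_swap hint
  have hinner : ∀ θ, ∫ x, F (planeRotation θ x) = ∫ x, F x := fun θ =>
    (planeRotation θ).measurePreserving.integral_comp
      (planeRotation θ).toHomeomorph.measurableEmbedding F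
  have hright : ∫ x, (∫ θ in Set.Ioc 0 (2 * Real.pi), F (planeRotation θ x)) = 0 := by
    refine integral_eq_zero_of_ae ?_
    filter_upwards [compl_mem_ae_iff.2 (measure_singleton (0 : Plane))] with x hx
    exact h.integral_rotation_transport_eq_zero hf hx
  rw [hright] at hswap
  simp only [hinner] at hswap
  rw [setIntegral_const, smul_eq_mul, mul_eq_zero] at hswap
  refine hswap.resolve_left ?_
  simp [measureReal_def, Real.pi_pos.le, Real.pi_ne_zero]

end IsSingularVortex

/-! ### Weak Euler solution, Navier-Stokes solutions and the vanishing viscosity limit in `L^p`. -/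

theorem eLpNorm_top_le_of_le {α : Type*} [MeasurableSpace α] {μ : Measure α} {f : α → ℝ≥0∞}
    {C : ℝ≥0∞} (h : ∀ᵐ t ∂μ, f t ≤ C) : eLpNorm f ⊤ μ ≤ C := by
  rw [eLpNorm_exponent_top, eLpNormEssSup_eq_essSup_enorm]
  exact essSup_le_of_ae_le _ (by simpa [EventuallyLE] using h)

theorem slabMeasure_eq_restrict (T : ℝ) :
    slabMeasure T = (volume : Measure (ℝ × Plane)).restrict (Set.Ioo 0 T ×ˢ Set.univ) := by
  rw [slabMeasure, timeMeasure, Measure.volume_eq_prod, ← Measure.prod_restrict,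
    Measure.restrict_univ]

theorem ae_slabMeasure_mem (T : ℝ) : ∀ᵐ z ∂(slabMeasure T), z.1 ∈ Set.Ioo 0 T ∧ z.2 ≠ 0 := by
  have h1 : ∀ᵐ z ∂(slabMeasure T), z.1 ∈ Set.Ioo 0 T :=
    Measure.quasiMeasurePreserving_fst.ae (ae_restrict_mem measurableSet_Ioo)
  have h2 : ∀ᵐ z ∂(slabMeasure T), z.2 ≠ 0 :=
    Measure.quasiMeasurePreserving_snd.ae (compl_mem_ae_iff.2 (measure_singleton (0 : Plane)))
  filter_upwards [h1, h2] with z a b using ⟨a, b⟩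

theorem ne_zero_ae : ∀ᵐ x : Plane, x ≠ 0 := compl_mem_ae_iff.2 (measure_singleton (0 : Plane))

section TestFunction

variable {ψ : ℝ × Plane → ℝ}

theorem hasDerivAt_time_slice (hψ : ContDiff ℝ ∞ ψ) (t : ℝ) (x : Plane) :
    HasDerivAt (fun s => ψ (s, x)) (fderiv ℝ ψ (t, x) (1, 0)) t :=
  ((hψ.differentiable (by simp)) (t, x)).hasFDerivAt.comp_hasDerivAt t
    ((hasDerivAt_id t).prodMk (hasDerivAt_const t x))

theorem fderiv_space_slice (hψ : ContDiff ℝ ∞ ψ) (t : ℝ) (x v : Plane) :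
    fderiv ℝ (fun y => ψ (t, y)) x v = fderiv ℝ ψ (t, x) (0, v) := by
  have h := ((hψ.differentiable (by simp)) (t, x)).hasFDerivAt.comp x
    ((hasFDerivAt_const t x).prodMk (hasFDerivAt_id x))
  have h' : fderiv ℝ (fun y => ψ (t, y)) x = _ := h.fderiv
  rw [h']
  simp

theorem inner_gradient_space_slice (hψ : ContDiff ℝ ∞ ψ) (t : ℝ) (x v : Plane) :
    inner ℝ (∇ (fun y => ψ (t, y)) x) v = fderiv ℝ ψ (t, x) (0, v) := by
  rw [gradient, InnerProductSpace.toDual_symm_apply, fderiv_space_slice hψ]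

end TestFunction

namespace IsSingularVortex

variable {M : ℝ} {w : Plane → ℝ}

theorem memLinftyLp_const (h : IsSingularVortex M w) {p : ℝ≥0∞} (hp : 1 < p) (hp2 : p < 2)
    (T : ℝ) : MemLinftyLp p T fun _ => w :=
  ⟨(h.measurable.comp measurable_snd).aestronglyMeasurable,
    (eLpNorm_top_le_of_le (ae_of_all _ fun _ => le_rfl)).trans_lt (h.memLp hp hp2).2⟩

theorem integral_transport_slab_eq_zero (h : IsSingularVortex M w) (T : ℝ) {ψ : ℝ × Plane → ℝ}
    (hψ : ContDiff ℝ ∞ ψ) (hψc : HasCompactSupport ψ) :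
    Integrable (fun z : ℝ × Plane => fderiv ℝ ψ z (0, velocity w z.2) * w z.2) (slabMeasure T) ∧
      ∫ z : ℝ × Plane, fderiv ℝ ψ z (0, velocity w z.2) * w z.2 ∂(slabMeasure T) = 0 := by
  have hcd : Continuous (fderiv ℝ ψ) := hψ.continuous_fderiv (by simp)
  obtain ⟨B, hB⟩ := (hψc.fderiv ℝ).exists_bound_of_continuous hcd
  have hB0 : 0 ≤ B := (norm_nonneg _).trans (hB 0)
  obtain ⟨G, hG, hGle⟩ := h.exists_abs_velocity_mul_le
  have hi : Integrable (fun z : ℝ × Plane => fderiv ℝ ψ z (0, velocity w z.2) * w z.2)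
      (slabMeasure T) := by
    refine ((hG.const_mul B).comp_snd (timeMeasure T)).mono' ?_ ?_
    · refine ((isBoundedBilinearMap_apply.continuous.comp_stronglyMeasurable
        (hcd.stronglyMeasurable.prodMk (stronglyMeasurable_const.prodMk
        ((stronglyMeasurable_velocity h.measurable).comp_measurable
        measurable_snd)))).measurable.mul (h.measurable.comp measurable_snd)).aestronglyMeasurable
    · filter_upwards [ae_slabMeasure_mem T] with z hz
      rw [norm_mul, Real.norm_eq_abs (w _)]
      calc _ ≤ (‖fderiv ℝ ψ z‖ * ‖((0 : ℝ), velocity w z.2)‖) * |w z.2| := by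
            gcongr; exact ContinuousLinearMap.le_opNorm _ _
        _ = ‖fderiv ℝ ψ z‖ * (‖velocity w z.2‖ * |w z.2|) := by
            rw [Prod.norm_mk, norm_zero, max_eq_right (norm_nonneg _), mul_assoc]
        _ ≤ B * G z.2 := mul_le_mul (hB z) (hGle _ hz.2) (by positivity) hB0
  refine ⟨hi, ?_⟩
  rw [integral_prod _ hi]
  refine integral_eq_zero_of_ae (ae_of_all _ fun t => ?_)
  have hf : ContDiff ℝ ∞ fun y => ψ (t, y) := hψ.comp (by fun_prop)
  have := h.integral_transport_eq_zero (f := fun y => ψ (t, y)) (hf.of_le (by simp)) (B := B)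
    (fun x => by
      refine ContinuousLinearMap.opNorm_le_bound _ hB0 fun v => ?_
      rw [fderiv_space_slice hψ]
      refine ((fderiv ℝ ψ (t, x)).le_opNorm _).trans ?_
      rw [Prod.norm_mk, norm_zero, max_eq_right (norm_nonneg _)]
      exact mul_le_mul_of_nonneg_right (hB _) (norm_nonneg _))
  simp only [fderiv_space_slice hψ] at this
  exact this

/-- As `w` does not depend on time, this is the fundamental theorem of calculus in `t` for each
fixed `x`. -/
theorem integral_time_deriv_slab (h : IsSingularVortex M w) {T : ℝ} (hT : 0 < T)
    {ψ : ℝ × Plane → ℝ} (hψ : ContDiff ℝ ∞ ψ) (hψc : HasCompactSupport ψ)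
    (hψT : tsupport ψ ⊆ Set.Iio T ×ˢ Set.univ) :
    Integrable (fun z : ℝ × Plane => fderiv ℝ ψ z (1, 0) * w z.2) (slabMeasure T) ∧
      ∫ z : ℝ × Plane, fderiv ℝ ψ z (1, 0) * w z.2 ∂(slabMeasure T) =
        -∫ x, ψ (0, x) * w x := by
  have hcd : Continuous (fderiv ℝ ψ) := hψ.continuous_fderiv (by simp)
  have hcd1 : Continuous fun z => fderiv ℝ ψ z (1, 0) := hcd.clm_apply continuous_const
  obtain ⟨B, hB⟩ := (hψc.fderiv_apply ℝ (1, 0)).exists_bound_of_continuous hcd1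
  have hi : Integrable (fun z : ℝ × Plane => fderiv ℝ ψ z (1, 0) * w z.2) (slabMeasure T) :=
    (h.integrable.comp_snd (timeMeasure T)).bdd_mul hcd1.aestronglyMeasurable (ae_of_all _ hB)
  refine ⟨hi, ?_⟩
  rw [integral_prod_symm _ hi, ← integral_neg]
  refine integral_congr_ae (ae_of_all _ fun x => ?_)
  -- The support of `ψ` lies strictly before time `T`, so only the boundary term at time zero
  -- survives.
  have hTx : ψ (T, x) = 0 := image_eq_zero_of_notMem_tsupport fun hmem =>
    lt_irrefl T (hψT hmem).1
  have hft : ∫ t in Set.Ioo 0 T, fderiv ℝ ψ (t, x) (1, 0) = ψ (T, x) - ψ (0, x) := by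
    rw [← integral_Ioc_eq_integral_Ioo, ← intervalIntegral.integral_of_le hT.le]
    exact intervalIntegral.integral_eq_sub_of_hasDerivAt
      (fun t _ => hasDerivAt_time_slice hψ t x)
      ((hcd1.comp (by fun_prop : Continuous fun t : ℝ => (t, x))).intervalIntegrable _ _)
  simp only [integral_mul_const]
  rw [hft, hTx]
  ring

theorem isWeakEulerSolution (h : IsSingularVortex M w) {p : ℝ≥0∞} (hp : 4 / 3 ≤ p) (hp2 : p < 2)
    {T : ℝ} (hT : 0 < T) : IsWeakEulerSolution p T w fun _ => w := by
  have hp1 : 1 < p := lt_of_lt_of_le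
    ((ENNReal.lt_div_iff_mul_lt (by simp) (by simp)).2 (by norm_num)) hp
  refine ⟨hp, h.memLp hp1 hp2, h.memLinftyLp_const hp1 hp2 T, ?_, h.velocityMemLinfty T, ?_⟩
  · refine ae_of_all _ fun t => ?_
    filter_upwards [ne_zero_ae] with x hx using h.velocityConverges hx
  · intro ψ hψ hψc hψT
    have h1 := h.integral_time_deriv_slab hT hψ hψc hψT
    have h2 := h.integral_transport_slab_eq_zero T hψ hψc
    have hc0 : HasCompactSupport fun x : Plane => ψ (0, x) := by
      exact HasCompactSupport.of_support_subset_isCompact (hψc.isCompact.image continuous_snd)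
        fun x hx => ⟨(0, x), subset_tsupport ψ hx, rfl⟩
    have hcont0 : Continuous fun x : Plane => ψ (0, x) := hψ.continuous.comp (by fun_prop)
    obtain ⟨B, hB⟩ := hc0.exists_bound_of_continuous hcont0
    have h3 : Integrable fun x => ψ (0, x) * w x :=
      h.integrable.bdd_mul hcont0.aestronglyMeasurable (ae_of_all _ hB)
    simp only [fun t x => (hasDerivAt_time_slice hψ t x).deriv, inner_gradient_space_slice hψ]
    refine ⟨h1.1.add h2.1, h3, ?_⟩
    rw [integral_add h1.1 h2.1, h1.2, h2.2]
    ring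

theorem integrable_heatAverage (h : IsSingularVortex M w) {s : ℝ} (hs : 0 < s) :
    Integrable (heatAverage s w) := by
  refine (h.integrable.integrable_convolution (ContinuousLinearMap.mul ℝ ℝ)
    (integrable_heatKernel hs)).congr (ae_of_all _ fun x => ?_)
  simp only [convolution, ContinuousLinearMap.mul_apply', heatAverage, mul_comm]

theorem tendsto_eLpNorm_heatAverage_sub (h : IsSingularVortex M w) {p : ℝ≥0∞} (hp : 1 < p)
    (hp2 : p < 2) : Tendsto (fun s => eLpNorm (heatAverage s w - w) p volume) (𝓝[>] 0) (𝓝 0) := by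
  have hpt : p ≠ ⊤ := ne_top_of_lt hp2
  have hp0 : p ≠ 0 := (zero_lt_one.trans hp).ne'
  have hr : 0 < p.toReal := ENNReal.toReal_pos hp0 hpt
  have hM := h.nonneg
  have key : Tendsto (fun s => ∫⁻ x, ‖(heatAverage s w - w) x‖ₑ ^ p.toReal) (𝓝[>] 0)
      (𝓝 (∫⁻ _ : Plane, 0)) := by
    refine tendsto_lintegral_filter_of_dominated_convergence
      -- The constant is `16 M` for the heat average plus `M` for `w`.
      (fun x => ‖17 * M * decay x‖ₑ ^ p.toReal) ?_ ?_ ?_ ?_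
    · filter_upwards [self_mem_nhdsWithin] with s hs
      exact ((h.contDiff_heatAverage hs).continuous.measurable.sub h.measurable).enorm.pow_const _
    · filter_upwards [self_mem_nhdsWithin] with s hs
      filter_upwards [ne_zero_ae] with x hx
      refine ENNReal.rpow_le_rpow (enorm_le_iff_norm_le.2 ?_) hr.le
      have h0 := decay_nonneg x
      rw [Real.norm_of_nonneg (by positivity : 0 ≤ 17 * M * decay x), Pi.sub_apply]
      refine (norm_sub_le _ _).trans ?_
      have := h.abs_heatAverage_le_decay hs hx
      have := h.abs_le_decay x
      simp only [Real.norm_eq_abs]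
      linarith
    · exact ((eLpNorm_lt_top_iff_lintegral_rpow_enorm_lt_top hp0 hpt).1
        ((memLp_decay hp hp2).const_mul (17 * M)).2).ne
    · filter_upwards [ne_zero_ae] with x hx
      have h1 : Tendsto (fun s => heatAverage s w x - w x) (𝓝[>] 0) (𝓝 0) := by
        simpa using (h.tendsto_heatAverage hx).sub_const (w x)
      have h2 := (ENNReal.continuous_rpow_const (y := p.toReal)).tendsto _ |>.comp h1.enorm
      simp only [enorm_zero, ENNReal.zero_rpow_of_pos hr] at h2
      exact h2
  have h3 := (ENNReal.continuous_rpow_const (y := 1 / p.toReal)).tendsto _ |>.comp key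
  have h4 : (0 : ℝ≥0∞) ^ (1 / p.toReal) = 0 := ENNReal.zero_rpow_of_pos (by positivity)
  rw [lintegral_zero, h4] at h3
  refine h3.congr fun s => ?_
  rw [Function.comp_apply, eLpNorm_eq_lintegral_rpow_enorm_toReal hp0 hpt]

theorem contDiffOn_heatEvolution (h : IsSingularVortex M w) {ν : ℝ} (hν : 0 < ν) (T : ℝ) :
    ContDiffOn ℝ ∞ (Function.uncurry (heatEvolution ν w)) (Set.Ioo 0 T ×ˢ Set.univ) := by
  have h1 : ContDiffOn ℝ ∞ (fun q : ℝ × Plane => heatAverage (ν * q.1) w q.2)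
      (Set.Ioo 0 T ×ˢ Set.univ) :=
    h.contDiffOn_heatAverage.comp (f := fun q : ℝ × Plane => (ν * q.1, q.2)) (by fun_prop)
      fun q hq => ⟨mul_pos hν hq.1.1, Set.mem_univ _⟩
  exact h1.congr fun q hq => heatEvolution_of_pos ν w hq.1.1 q.2

theorem isNavierStokesSolution (h : IsSingularVortex M w) {p : ℝ≥0∞} (hp : 1 < p) (hp2 : p < 2)
    {ν : ℝ} (hν : 0 < ν) (T : ℝ) : IsNavierStokesSolution p ν T w (heatEvolution ν w) := by
  have hev : ∀ {t : ℝ}, 0 < t → heatEvolution ν w t = heatAverage (ν * t) w := fun ht =>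
    funext fun x => heatEvolution_of_pos ν w ht x
  refine ⟨h.contDiffOn_heatEvolution hν T, fun t ht x => ?_, fun t ht x => ?_, ?_⟩
  · rw [hev ht.1]
    have hs := mul_pos hν ht.1
    exact velocityConverges_of_bounded (h.integrable_heatAverage hs)
      (h.abs_heatAverage_le_const hs) x
  · have hs := mul_pos hν ht.1
    have hrad : ∀ x y : Plane, ‖x‖ = ‖y‖ → heatAverage (ν * t) w x = heatAverage (ν * t) w y :=
      fun x y => h.heatAverage_radial _
    have h1 : HasDerivAt (fun t => heatAverage (ν * t) w x) (Δ (heatAverage (ν * t) w) x * ν) t := by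
      have := (hasDerivAt_id t).const_mul ν
      rw [mul_one] at this
      exact (h.heatAverage_heat_equation hs x).comp t this
    have h2 : (fun s => heatEvolution ν w s x) =ᶠ[𝓝 t] fun t => heatAverage (ν * t) w x := by
      filter_upwards [isOpen_Ioi.mem_nhds ht.1] with s hs' using heatEvolution_of_pos ν w hs' x
    -- The transport term is the derivative of a radial function in a direction orthogonal to `x`,
    -- hence zero; only the heat equation remains.
    rw [h2.deriv_eq, h1.deriv, hev ht.1, real_inner_comm, gradient,
      InnerProductSpace.toDual_symm_apply, fderiv_eq_zero_of_radial hrad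
        ((h.contDiff_heatAverage hs).differentiable (by simp)) (inner_velocity_self hrad x)]
    ring
  · have hc : Tendsto (fun t : ℝ => ν * t) (𝓝[>] 0) (𝓝[>] 0) := by
      refine tendsto_nhdsWithin_iff.2 ⟨?_, ?_⟩
      · have : Tendsto (fun t : ℝ => ν * t) (𝓝 0) (𝓝 (ν * 0)) := by
          exact (continuous_const.mul continuous_id).tendsto 0
        rw [mul_zero] at this
        exact this.mono_left nhdsWithin_le_nhds
      · filter_upwards [self_mem_nhdsWithin] with t ht using mul_pos hν ht
    refine ((h.tendsto_eLpNorm_heatAverage_sub hp hp2).comp hc).congr' ?_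
    filter_upwards [self_mem_nhdsWithin] with t ht
    rw [Function.comp_apply, hev ht]

theorem memLinftyLp_heatEvolution (h : IsSingularVortex M w) {p : ℝ≥0∞} (hp : 1 < p) (hp2 : p < 2)
    {ν : ℝ} (hν : 0 < ν) (T : ℝ) : MemLinftyLp p T (heatEvolution ν w) := by
  refine ⟨?_, lt_of_le_of_lt (eLpNorm_top_le_of_le ?_)
    ((memLp_decay hp hp2).const_mul (16 * M)).2⟩
  · rw [slabMeasure_eq_restrict]
    exact (h.contDiffOn_heatEvolution hν T).continuousOn.aestronglyMeasurable
      (measurableSet_Ioo.prod MeasurableSet.univ)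
  · filter_upwards [ae_restrict_mem measurableSet_Ioo] with t ht
    refine eLpNorm_mono_ae_real ?_
    filter_upwards [ne_zero_ae] with x hx
    rw [heatEvolution_of_pos ν w ht.1]
    exact h.abs_heatAverage_le_decay (mul_pos hν ht.1) hx

theorem tendsto_heatEvolution (h : IsSingularVortex M w) {ι : Type*} {l : Filter ι} {νs : ι → ℝ}
    (hνs : Tendsto νs l (𝓝[>] 0)) {t : ℝ} (ht : 0 < t) {x : Plane} (hx : x ≠ 0) :
    Tendsto (fun i => heatEvolution (νs i) w t x) l (𝓝 (w x)) := by
  have hc : Tendsto (fun i => νs i * t) l (𝓝[>] 0) := by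
    refine tendsto_nhdsWithin_iff.2 ⟨?_, ?_⟩
    · simpa using (tendsto_nhds_of_tendsto_nhdsWithin hνs).mul_const t
    · filter_upwards [(tendsto_nhdsWithin_iff.1 hνs).2] with i hi using mul_pos hi ht
  simpa only [heatEvolution_of_pos _ w ht, Function.comp_def] using
    (h.tendsto_heatAverage hx).comp hc

/-- Dominated convergence on the slab: `decay` times `|g|` is integrable by Hölder in space followed
by the `L¹` bound in time. -/
theorem tendstoWeakStarLinftyLp (h : IsSingularVortex M w) {p : ℝ≥0∞} (hp : 1 < p) (hp2 : p < 2)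
    (T : ℝ) {ι : Type*} {l : Filter ι} [l.IsCountablyGenerated] {νs : ι → ℝ}
    (hνs : Tendsto νs l (𝓝[>] 0)) :
    TendstoWeakStarLinftyLp p T l (fun i => heatEvolution (νs i) w) fun _ => w := by
  have hpos : ∀ᶠ i in l, 0 < νs i := (tendsto_nhdsWithin_iff.1 hνs).2
  refine ⟨hpos.mono fun i hi => h.memLinftyLp_heatEvolution hp hp2 hi T,
    h.memLinftyLp_const hp hp2 T, fun p' hpp' g hg hgfin => ?_⟩
  have hM := h.nonneg
  have hD := memLp_decay hp hp2
  refine tendsto_integral_filter_of_dominated_convergence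
    (fun z => 16 * M * decay z.2 * ‖g z.1 z.2‖) ?_ ?_ ?_ ?_
  · filter_upwards [hpos] with i hi
    exact (h.memLinftyLp_heatEvolution hp hp2 hi T).1.mul hg
  · filter_upwards [hpos] with i hi
    filter_upwards [ae_slabMeasure_mem T] with z hz
    rw [norm_mul, heatEvolution_of_pos _ w hz.1.1]
    exact mul_le_mul_of_nonneg_right
      (h.abs_heatAverage_le_decay (mul_pos hi hz.1.1) hz.2) (norm_nonneg _)
  · have hm : AEStronglyMeasurable (fun z : ℝ × Plane => decay z.2 * g z.1 z.2)
        (slabMeasure T) := (measurable_decay.comp measurable_snd).aestronglyMeasurable.mul hg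
    have hfin : HasFiniteIntegral (fun z : ℝ × Plane => decay z.2 * g z.1 z.2)
        (slabMeasure T) := by
      rw [HasFiniteIntegral, lintegral_prod _ hm.enorm]
      have hslice : ∀ᵐ t ∂(timeMeasure T), AEStronglyMeasurable (g t) volume := hg.prodMk_left
      calc ∫⁻ t, ∫⁻ x, ‖decay x * g t x‖ₑ ∂volume ∂(timeMeasure T)
          ≤ ∫⁻ t, eLpNorm decay p volume * eLpNorm (g t) p' volume ∂(timeMeasure T) := by
            refine lintegral_mono_ae ?_
            filter_upwards [hslice] with t ht
            have := eLpNorm_smul_le_mul_eLpNorm (p := p) (q := p') (r := 1) ht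
              measurable_decay.aestronglyMeasurable
            rwa [eLpNorm_one_eq_lintegral_enorm] at this
        _ = eLpNorm decay p volume * ∫⁻ t, eLpNorm (g t) p' volume ∂(timeMeasure T) :=
            lintegral_const_mul' _ _ hD.2.ne
        _ < ⊤ := by
            refine ENNReal.mul_lt_top hD.2 ?_
            simpa [eLpNorm_one_eq_lintegral_enorm] using hgfin
    refine ((Integrable.norm ⟨hm, hfin⟩).const_mul (16 * M)).congr (ae_of_all _ fun z => ?_)
    simp only [norm_mul, Real.norm_of_nonneg (decay_nonneg _)]
    ring
  · filter_upwards [ae_slabMeasure_mem T] with z hz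
    exact (h.tendsto_heatEvolution hνs hz.1.1 hz.2).mul_const _

theorem isVanishingViscosityLimit (h : IsSingularVortex M w) {p : ℝ≥0∞} (hp : 4 / 3 ≤ p)
    (hp2 : p < 2) {T : ℝ} (hT : 0 < T) {νs : ℕ → ℝ} (hpos : ∀ k, 0 < νs k)
    (hνs : Tendsto νs atTop (𝓝 0)) :
    IsVanishingViscosityLimit p T w νs (fun k => heatEvolution (νs k) w) fun _ => w := by
  have hp1 : 1 < p := lt_of_lt_of_le
    ((ENNReal.lt_div_iff_mul_lt (by simp) (by simp)).2 (by norm_num)) hp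
  exact ⟨h.isWeakEulerSolution hp hp2 hT, hpos, hνs,
    fun k => h.isNavierStokesSolution hp1 hp2 (hpos k) T,
    h.tendstoWeakStarLinftyLp hp1 hp2 T
      (tendsto_nhdsWithin_iff.2 ⟨hνs, Eventually.of_forall hpos⟩)⟩

end IsSingularVortex

/-! ### Decay of the Fourier transform of a Schwartz function divided by the norm. -/

open scoped FourierTransform

theorem integral_fourier_mul_eq_integral_mul_fourier {f g : Plane → ℂ} (hf : Integrable f)
    (hg : Integrable g) : ∫ ξ, 𝓕 f ξ * g ξ = ∫ x, f x * 𝓕 g x := by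
  simpa using! VectorFourier.integral_bilin_fourierIntegral_eq_flip (ContinuousLinearMap.mul ℂ ℂ)
    (L := innerₗ Plane) Real.continuous_fourierChar continuous_inner hf hg

theorem norm_fourier_le_integral_norm (f : Plane → ℂ) (ξ : Plane) : ‖𝓕 f ξ‖ ≤ ∫ x, ‖f x‖ := by
  rw [Real.fourier_eq]
  refine (norm_integral_le_integral_norm _).trans (le_of_eq ?_)
  simp

/-- The Fourier transform is moved from `h` to the modulated Gaussian, whose transform is explicit
and positive up to translation; only then is the modulus taken inside. -/
theorem norm_gaussian_pairing_le (h : 𝓢(Plane, ℂ)) {τ : ℝ} (hτ : 0 < τ) (ξ : Plane) :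
    ‖∫ x, 𝓕 (h : Plane → ℂ) x * Complex.exp (-((τ ^ 2 : ℝ) : ℂ) * ‖x‖ ^ 2 +
      2 * Real.pi * Complex.I * (inner ℝ (-ξ) x : ℝ))‖ ≤
    ∫ η, ‖h η‖ * (Real.pi / τ ^ 2 * Real.exp (-Real.pi ^ 2 * ‖ξ + η‖ ^ 2 / τ ^ 2)) := by
  have hb : 0 < (((τ ^ 2 : ℝ) : ℂ)).re := by rw [Complex.ofReal_re]; positivity
  have hg := GaussianFourier.integrable_cexp_neg_mul_sq_norm_add hb (2 * Real.pi * Complex.I) (-ξ)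
  rw [integral_fourier_mul_eq_integral_mul_fourier h.integrable hg]
  refine (norm_integral_le_integral_norm _).trans (le_of_eq ?_)
  refine integral_congr_ae (ae_of_all _ fun η => ?_)
  simp only [norm_mul]
  rw [fourier_gaussian_innerProductSpace' hb]
  have e1 : ((Module.finrank ℝ Plane : ℂ) / 2) = 1 := by simp
  have e2 : ‖-ξ - η‖ = ‖ξ + η‖ := by rw [← norm_neg]; congr 1; abel
  rw [e1, Complex.cpow_one, norm_mul, Complex.norm_exp, e2]
  congr 2
  · rw [← Complex.ofReal_div, Complex.norm_real, Real.norm_of_nonneg (by positivity)]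
  · congr 1
    rw [show (-(Real.pi : ℂ) ^ 2 * (‖ξ + η‖ : ℂ) ^ 2 / ((τ ^ 2 : ℝ) : ℂ)) =
      ((-Real.pi ^ 2 * ‖ξ + η‖ ^ 2 / τ ^ 2 : ℝ) : ℂ) by push_cast; ring, Complex.ofReal_re]

theorem inv_norm_eq_integral_gaussian {x : Plane} (hx : x ≠ 0) :
    ‖x‖⁻¹ = 2 / √Real.pi * ∫ τ in Set.Ioi (0 : ℝ), Real.exp (-‖x‖ ^ 2 * τ ^ 2) := by
  have hx : 0 < ‖x‖ := norm_pos_iff.2 hx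
  have hp : 0 < √Real.pi := Real.sqrt_pos.2 Real.pi_pos
  rw [integral_gaussian_Ioi, Real.sqrt_div Real.pi_pos.le, Real.sqrt_sq hx.le]
  field_simp

/-- Split at `τ = b`: below, `exp(-r) ≤ 1/r` bounds the integrand by `b⁻²`; above, it is at most
`τ⁻²`. Each piece contributes `1/b`. -/
theorem lintegral_inverse_gaussian_le {b : ℝ} (hb : 0 < b) :
    ∫⁻ τ in Set.Ioi (0 : ℝ), ENNReal.ofReal (1 / τ ^ 2 * Real.exp (-b ^ 2 / τ ^ 2)) ≤
      ENNReal.ofReal (2 * b⁻¹) := by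
  rw [← Set.Ioc_union_Ioi_eq_Ioi hb.le]
  refine (lintegral_union_le _ _ _).trans ?_
  rw [two_mul, ENNReal.ofReal_add (by positivity) (by positivity)]
  refine add_le_add ?_ ?_
  · calc ∫⁻ τ in Set.Ioc 0 b, ENNReal.ofReal (1 / τ ^ 2 * Real.exp (-b ^ 2 / τ ^ 2))
        ≤ ∫⁻ _ in Set.Ioc 0 b, ENNReal.ofReal ((b ^ 2)⁻¹) := by
          refine setLIntegral_mono measurable_const fun τ hτ => ENNReal.ofReal_le_ofReal ?_
          have h0 : 0 < τ := hτ.1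
          have h1 : b ^ 2 / τ ^ 2 ≤ Real.exp (b ^ 2 / τ ^ 2) :=
            (by linarith : b ^ 2 / τ ^ 2 ≤ b ^ 2 / τ ^ 2 + 1).trans (Real.add_one_le_exp _)
          rw [neg_div, Real.exp_neg]
          calc 1 / τ ^ 2 * (Real.exp (b ^ 2 / τ ^ 2))⁻¹ ≤ 1 / τ ^ 2 * (b ^ 2 / τ ^ 2)⁻¹ := by
                gcongr
            _ = (b ^ 2)⁻¹ := by field_simp
      _ = ENNReal.ofReal b⁻¹ := by
          rw [setLIntegral_const, Real.volume_Ioc, ← ENNReal.ofReal_mul (by positivity)]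
          congr 1
          field_simp
          ring
  · calc ∫⁻ τ in Set.Ioi b, ENNReal.ofReal (1 / τ ^ 2 * Real.exp (-b ^ 2 / τ ^ 2))
        ≤ ∫⁻ τ in Set.Ioi b, ENNReal.ofReal (τ ^ (-2 : ℝ)) := by
          refine setLIntegral_mono (by fun_prop) fun τ hτ => ENNReal.ofReal_le_ofReal ?_
          have h0 : 0 < τ := hb.trans hτ
          rw [Real.rpow_neg h0.le, Real.rpow_two, one_div]
          refine mul_le_of_le_one_right (by positivity) (Real.exp_le_one_iff.2 ?_)
          rw [neg_div]
          have : 0 ≤ b ^ 2 / τ ^ 2 := by positivity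
          linarith
      _ = ENNReal.ofReal b⁻¹ := by
          rw [← ofReal_integral_eq_lintegral_ofReal (integrableOn_Ioi_rpow_of_lt (by norm_num) hb)
            ((ae_restrict_mem measurableSet_Ioi).mono fun τ hτ =>
              Real.rpow_nonneg (hb.trans hτ).le _), integral_Ioi_rpow_of_lt (by norm_num) hb]
          congr 1
          norm_num
          rw [Real.rpow_neg_one]

/-- Write `|ξ| ≤ |ξ + η| + |η|`. The first term cancels the singularity. In the second, `|η| |h(η)|`
is integrable where `|ξ + η| ≥ 1`, and is bounded against the locally integrable `1/|z|` where `|ξ +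
η| < 1`. -/
theorem exists_lintegral_riesz_le (h : 𝓢(Plane, ℂ)) : ∃ C : ℝ, ∀ ξ : Plane,
    ∫⁻ η, ENNReal.ofReal (‖ξ‖ * ‖h η‖ * ‖ξ + η‖⁻¹) ≤ ENNReal.ofReal C := by
  obtain ⟨K, hK⟩ : ∃ K, ∀ η, ‖η‖ * ‖h η‖ ≤ K :=
    ⟨_, fun η => by simpa using SchwartzMap.norm_pow_mul_le_seminorm ℂ h 1 η⟩
  have hK0 : 0 ≤ K := le_trans (by positivity) (hK 0)
  have i1 : Integrable fun η => ‖h η‖ := h.integrable.norm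
  have i2 : Integrable fun η => ‖η‖ * ‖h η‖ := by simpa using h.integrable_pow_mul volume 1
  have i3 : Integrable ((Metric.ball (0 : Plane) 1).indicator fun z => ‖z‖⁻¹) :=
    (integrableOn_norm_inv_ball 1).integrable_indicator Metric.isOpen_ball.measurableSet
  let I := ∫ z, (Metric.ball (0 : Plane) 1).indicator (fun z => ‖z‖⁻¹) z
  refine ⟨(∫ η, ‖h η‖) + (∫ η, ‖η‖ * ‖h η‖) + K * I, fun ξ => ?_⟩
  have i4 : Integrable fun η =>
      K * (Metric.ball (0 : Plane) 1).indicator (fun z => ‖z‖⁻¹) (ξ + η) :=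
    (i3.comp_add_left ξ).const_mul K
  have i12 : Integrable fun η => ‖h η‖ + ‖η‖ * ‖h η‖ := i1.add i2
  have hle : ∀ η, ‖ξ‖ * ‖h η‖ * ‖ξ + η‖⁻¹ ≤ ‖h η‖ + ‖η‖ * ‖h η‖ +
      K * (Metric.ball (0 : Plane) 1).indicator (fun z => ‖z‖⁻¹) (ξ + η) := by
    intro η
    have hI0 : 0 ≤ (Metric.ball (0 : Plane) 1).indicator (fun z => ‖z‖⁻¹) (ξ + η) :=
      Set.indicator_nonneg (fun _ _ => by positivity) _
    rcases (norm_nonneg (ξ + η)).eq_or_lt with h0 | h0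
    · rw [← h0, inv_zero, mul_zero]; positivity
    have htri : ‖ξ‖ ≤ ‖ξ + η‖ + ‖η‖ := by simpa using norm_sub_le (ξ + η) η
    have h1 : ‖ξ‖ * ‖h η‖ * ‖ξ + η‖⁻¹ ≤ ‖h η‖ + ‖η‖ * ‖h η‖ * ‖ξ + η‖⁻¹ := by
      calc ‖ξ‖ * ‖h η‖ * ‖ξ + η‖⁻¹ ≤ (‖ξ + η‖ + ‖η‖) * ‖h η‖ * ‖ξ + η‖⁻¹ := by gcongr
        _ = _ := by field_simp
    refine h1.trans ?_
    by_cases hz : ξ + η ∈ Metric.ball (0 : Plane) 1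
    · rw [Set.indicator_of_mem hz]
      have := mul_le_mul_of_nonneg_right (hK η) (inv_nonneg.2 h0.le)
      have : 0 ≤ ‖η‖ * ‖h η‖ := by positivity
      linarith
    · have h2 : ‖ξ + η‖⁻¹ ≤ 1 := inv_le_one_of_one_le₀ (by simpa using hz)
      have : ‖η‖ * ‖h η‖ * ‖ξ + η‖⁻¹ ≤ ‖η‖ * ‖h η‖ := mul_le_of_le_one_right (by positivity) h2
      have := mul_nonneg hK0 hI0
      linarith
  calc _ ≤ ∫⁻ η, ENNReal.ofReal (‖h η‖ + ‖η‖ * ‖h η‖ +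
      K * (Metric.ball (0 : Plane) 1).indicator (fun z => ‖z‖⁻¹) (ξ + η)) :=
        lintegral_mono fun η => ENNReal.ofReal_le_ofReal (hle η)
    _ = ENNReal.ofReal (∫ η, (‖h η‖ + ‖η‖ * ‖h η‖ +
      K * (Metric.ball (0 : Plane) 1).indicator (fun z => ‖z‖⁻¹) (ξ + η))) := by
        have i124 : Integrable fun η => ‖h η‖ + ‖η‖ * ‖h η‖ +
            K * (Metric.ball (0 : Plane) 1).indicator (fun z => ‖z‖⁻¹) (ξ + η) := i12.add i4
        exact (ofReal_integral_eq_lintegral_ofReal i124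
          (ae_of_all _ fun η => le_trans (by positivity) (hle η))).symm
    _ = _ := by
        rw [integral_add i12 i4, integral_add i1 i2, integral_const_mul,
          integral_add_left_eq_self ((Metric.ball (0 : Plane) 1).indicator fun z => ‖z‖⁻¹)]

/-- Writes `1/|x|` as a superposition of Gaussians and exchanges the integrals; integrating the
modulus first in `τ` shows that absolute convergence amounts to integrability of `f/|x|`. -/
theorem fourier_inv_norm_mul_eq {f : Plane → ℂ}
    (hf : Continuous f) (hfi : Integrable fun x => (‖x‖⁻¹ : ℝ) * f x) (ξ : Plane) :
    𝓕 (fun x => ((‖x‖⁻¹ : ℝ) : ℂ) * f x) ξ = ((2 / √Real.pi : ℝ) : ℂ) *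
      ∫ τ in Set.Ioi (0 : ℝ), ∫ x, f x * Complex.exp (-((τ ^ 2 : ℝ) : ℂ) * ‖x‖ ^ 2 +
      2 * Real.pi * Complex.I * (inner ℝ (-ξ) x : ℝ)) := by
  let Φ : Plane → ℝ → ℂ := fun x τ => f x * Complex.exp (-((τ ^ 2 : ℝ) : ℂ) * ‖x‖ ^ 2 +
      2 * Real.pi * Complex.I * (inner ℝ (-ξ) x : ℝ))
  have hΦ : ∀ x τ, Φ x τ = (Real.exp (-‖x‖ ^ 2 * τ ^ 2) : ℂ) *
      (Complex.exp ((↑(-2 * Real.pi * inner ℝ x ξ) * Complex.I)) * f x) := by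
    intro x τ
    simp only [Φ]
    rw [mul_comm (f x), Complex.exp_add, mul_assoc]
    congr 2
    · push_cast; congr 1; ring
    · congr 1; rw [inner_neg_left, real_inner_comm]; push_cast; ring
  have hnorm : ∀ x τ, ‖Φ x τ‖ = Real.exp (-‖x‖ ^ 2 * τ ^ 2) * ‖f x‖ := by
    intro x τ
    rw [hΦ, norm_mul, norm_mul, Complex.norm_exp_ofReal_mul_I, one_mul, Complex.norm_real,
      Real.norm_of_nonneg (Real.exp_pos _).le]
  have hc : Continuous (Function.uncurry Φ) := by
    simp only [Φ, Function.uncurry_def]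
    have := hf
    fun_prop
  have hexp : ∀ x : Plane, x ≠ 0 →
      IntegrableOn (fun τ : ℝ => Real.exp (-‖x‖ ^ 2 * τ ^ 2)) (Set.Ioi 0) := fun x hx =>
    (integrable_exp_neg_mul_sq (pow_pos (norm_pos_iff.2 hx) 2)).integrableOn
  have hint : Integrable (Function.uncurry Φ) (volume.prod (volume.restrict (Set.Ioi (0 : ℝ)))) := by
    rw [integrable_prod_iff hc.aestronglyMeasurable]
    constructor
    · filter_upwards [ne_zero_ae] with x hx
      refine ((hexp x hx).mul_const ‖f x‖).mono'
        (hc.comp (by fun_prop : Continuous fun τ : ℝ => (x, τ))).aestronglyMeasurable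
        (ae_of_all _ fun τ => (hnorm x τ).le)
    · refine (hfi.norm.const_mul ((2 / √Real.pi)⁻¹)).congr ?_
      filter_upwards [ne_zero_ae] with x hx
      have hp : 0 < 2 / √Real.pi := by positivity
      simp only [Function.uncurry_apply_pair, hnorm]
      rw [integral_mul_const, norm_mul, Complex.norm_real, Real.norm_of_nonneg (by positivity),
        inv_norm_eq_integral_gaussian hx, ← mul_assoc, ← mul_assoc, inv_mul_cancel₀ hp.ne', one_mul]
  have hswap : ∫ x, (∫ τ in Set.Ioi (0 : ℝ), Φ x τ) = ∫ τ in Set.Ioi (0 : ℝ), (∫ x, Φ x τ) :=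
    integral_integral_swap hint
  change _ = ((2 / √Real.pi : ℝ) : ℂ) * ∫ τ in Set.Ioi (0 : ℝ), (∫ x, Φ x τ)
  rw [← hswap, Real.fourier_eq', ← integral_const_mul]
  refine integral_congr_ae ?_
  filter_upwards [ne_zero_ae] with x hx
  simp only [hΦ]
  rw [integral_mul_const, integral_complex_ofReal, ← mul_assoc, ← Complex.ofReal_mul,
    ← inv_norm_eq_integral_gaussian hx, smul_eq_mul]
  ring

/-- With `f` the transform of `h`, integrating the Gaussian bounds over `τ` dominates the transform
of `f/|x|` at `ξ` by a Riesz potential: the integral of `|h(η)| / |ξ + η|`, which is of order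
`1/|ξ|`. -/
theorem exists_norm_fourier_inv_norm_mul_le (f : 𝓢(Plane, ℂ))
    (hfi : Integrable fun x => (‖x‖⁻¹ : ℝ) * f x) :
    ∃ C : ℝ, 0 ≤ C ∧ ∀ ξ, ‖ξ‖ * ‖𝓕 (fun x => ((‖x‖⁻¹ : ℝ) : ℂ) * f x) ξ‖ ≤ C := by
  let h : 𝓢(Plane, ℂ) := 𝓕⁻ f
  have hfh : ∀ x, f x = 𝓕 (h : Plane → ℂ) x := fun x => by
    rw [← SchwartzMap.fourier_coe, FourierTransform.fourier_fourierInv_eq]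
  obtain ⟨C, hC⟩ := exists_lintegral_riesz_le h
  -- The factor `2/√π` comes from `inv_norm_eq_integral_gaussian`, the `2` from the `τ`-integral,
  -- and `C` from the Riesz potential; the maximum only secures a nonnegative constant.
  refine ⟨2 / √Real.pi * (2 * max C 0), by positivity, fun ξ => ?_⟩
  rw [fourier_inv_norm_mul_eq f.continuous hfi, norm_mul, Complex.norm_real,
    Real.norm_of_nonneg (by positivity), mul_left_comm]
  refine mul_le_mul_of_nonneg_left ?_ (by positivity)
  rw [← ENNReal.ofReal_le_ofReal_iff (by positivity), ENNReal.ofReal_mul (norm_nonneg _)]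
  let k : ℝ → Plane → ℝ := fun τ η => Real.pi / τ ^ 2 * Real.exp (-Real.pi ^ 2 * ‖ξ + η‖ ^ 2 / τ ^ 2)
  have hk0 : ∀ τ η, 0 ≤ k τ η := fun τ η => by positivity
  have hkm : Measurable (Function.uncurry k) := by
    simp only [k, Function.uncurry_def]
    fun_prop
  have step1 : ∀ τ ∈ Set.Ioi (0 : ℝ), ‖∫ x, f x * Complex.exp (-((τ ^ 2 : ℝ) : ℂ) * ‖x‖ ^ 2 +
      2 * Real.pi * Complex.I * (inner ℝ (-ξ) x : ℝ))‖ₑ ≤ ∫⁻ η, ENNReal.ofReal (‖h η‖ * k τ η) := by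
    intro τ hτ
    simp only [hfh]
    rw [← ofReal_norm]
    refine (ENNReal.ofReal_le_ofReal (norm_gaussian_pairing_le h hτ ξ)).trans ?_
    exact (ENNReal.ofReal_le_ofReal (le_abs_self _)).trans (by
      rw [← Real.norm_eq_abs, ofReal_norm]
      refine (enorm_integral_le_lintegral_enorm _).trans (le_of_eq (lintegral_congr fun η => ?_))
      exact Real.enorm_of_nonneg (mul_nonneg (norm_nonneg _) (hk0 _ _)))
  have step3 : ∀ η, ξ + η ≠ 0 → ∫⁻ τ in Set.Ioi (0 : ℝ), ENNReal.ofReal (k τ η) ≤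
      ENNReal.ofReal (2 * ‖ξ + η‖⁻¹) := by
    intro η hη
    have hn : 0 < ‖ξ + η‖ := norm_pos_iff.2 hη
    have := mul_le_mul_right (lintegral_inverse_gaussian_le (b := Real.pi * ‖ξ + η‖)
      (by positivity)) (ENNReal.ofReal Real.pi)
    rw [← lintegral_const_mul' _ _ ENNReal.ofReal_ne_top,
      ← ENNReal.ofReal_mul Real.pi_pos.le] at this
    simp only [← ENNReal.ofReal_mul Real.pi_pos.le] at this
    refine (le_of_eq ?_).trans (this.trans (le_of_eq ?_))
    · refine lintegral_congr fun τ => ?_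
      congr 1
      simp only [k]
      rw [mul_pow]
      ring_nf
    · congr 1
      have := Real.pi_pos.ne'
      field_simp
  calc ENNReal.ofReal ‖ξ‖ * ENNReal.ofReal ‖∫ τ in Set.Ioi (0 : ℝ), ∫ x, f x *
        Complex.exp (-((τ ^ 2 : ℝ) : ℂ) * ‖x‖ ^ 2 + 2 * Real.pi * Complex.I * (inner ℝ (-ξ) x : ℝ))‖
      ≤ ENNReal.ofReal ‖ξ‖ *
        ∫⁻ τ in Set.Ioi (0 : ℝ), ∫⁻ η, ENNReal.ofReal (‖h η‖ * k τ η) := by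
        rw [ofReal_norm (∫ τ in Set.Ioi (0 : ℝ), _)]
        gcongr
        exact (enorm_integral_le_lintegral_enorm _).trans (setLIntegral_mono' measurableSet_Ioi step1)
    _ = ENNReal.ofReal ‖ξ‖ *
        ∫⁻ η, ∫⁻ τ in Set.Ioi (0 : ℝ), ENNReal.ofReal (‖h η‖ * k τ η) := by
        congr 1
        refine lintegral_lintegral_swap (Measurable.aemeasurable ?_)
        exact ((h.continuous.measurable.comp measurable_snd).norm.mul hkm).ennreal_ofReal
    _ = ∫⁻ η, ENNReal.ofReal (‖ξ‖ * ‖h η‖) *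
          ∫⁻ τ in Set.Ioi (0 : ℝ), ENNReal.ofReal (k τ η) := by
        rw [← lintegral_const_mul' _ _ ENNReal.ofReal_ne_top]
        refine lintegral_congr fun η => ?_
        simp only [ENNReal.ofReal_mul (norm_nonneg _)]
        rw [lintegral_const_mul' _ _ ENNReal.ofReal_ne_top, mul_assoc]
    _ ≤ ∫⁻ η, ENNReal.ofReal 2 * ENNReal.ofReal (‖ξ‖ * ‖h η‖ * ‖ξ + η‖⁻¹) := by
        refine lintegral_mono_ae ?_
        have : ∀ᵐ η : Plane, ξ + η ≠ 0 := by
          filter_upwards [compl_mem_ae_iff.2 (measure_singleton (-ξ))] with η hη h0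
          exact hη (eq_neg_of_add_eq_zero_right h0)
        filter_upwards [this] with η hη
        refine (mul_le_mul_right (step3 η hη) _).trans (le_of_eq ?_)
        rw [← ENNReal.ofReal_mul (by positivity), ← ENNReal.ofReal_mul (by positivity)]
        congr 1
        ring
    _ ≤ ENNReal.ofReal 2 * ENNReal.ofReal C := by
        rw [lintegral_const_mul' _ _ ENNReal.ofReal_ne_top]
        exact mul_le_mul_right (hC ξ) _
    _ ≤ ENNReal.ofReal (2 * max C 0) := by
        rw [← ENNReal.ofReal_mul two_pos.le]
        exact ENNReal.ofReal_le_ofReal (by gcongr; exact le_max_left _ _)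

/-! ### Dyadic symbols, blocks and their `L²` representatives. -/

namespace LittlewoodPaley

variable (P : LittlewoodPaley)

theorem contDiff_symbol (j : ℕ) : ContDiff ℝ ∞ (P.symbol j) := by
  cases j with
  | zero => exact P.low_smooth
  | succ j => exact P.shell_smooth.comp (contDiff_const_smul _)

theorem norm_le_of_symbol_ne_zero {j : ℕ} {ξ : Plane} (h : P.symbol j ξ ≠ 0) :
    ‖ξ‖ ≤ 2 ^ (j + 1) := by
  cases j with
  | zero => simpa using P.low_support ξ h
  | succ j =>
    have h1 := (P.shell_support _ h).2
    rw [norm_smul, norm_inv, norm_pow, Real.norm_two, inv_mul_le_iff₀ (by positivity)] at h1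
    rwa [pow_succ]

theorem le_norm_of_symbol_ne_zero {j : ℕ} {ξ : Plane} (h : P.symbol (j + 1) ξ ≠ 0) :
    2 ^ j ≤ ‖ξ‖ := by
  have h1 := (P.shell_support _ h).1
  rw [norm_smul, norm_inv, norm_pow, Real.norm_two, le_inv_mul_iff₀ (by positivity)] at h1
  rw [pow_succ] at h1
  linarith

theorem hasCompactSupport_symbol (j : ℕ) : HasCompactSupport (P.symbol j) :=
  HasCompactSupport.of_support_subset_isCompact (isCompact_closedBall 0 (2 ^ (j + 1)))
    fun ξ hξ => by simpa using P.norm_le_of_symbol_ne_zero hξ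

theorem exists_abs_symbol_le : ∃ S : ℝ, 0 ≤ S ∧ ∀ j ξ, |P.symbol j ξ| ≤ S := by
  obtain ⟨S₀, h₀⟩ := (P.hasCompactSupport_symbol 0).exists_bound_of_continuous
    (P.contDiff_symbol 0).continuous
  have hc : HasCompactSupport P.shell :=
    HasCompactSupport.of_support_subset_isCompact (isCompact_closedBall 0 2)
      fun ξ hξ => by simpa using (P.shell_support ξ hξ).2
  obtain ⟨S₁, h₁⟩ := hc.exists_bound_of_continuous P.shell_smooth.continuous
  refine ⟨max S₀ S₁, ((norm_nonneg _).trans (h₀ 0)).trans (le_max_left _ _), fun j ξ => ?_⟩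
  cases j with
  | zero => exact (h₀ ξ).trans (le_max_left _ _)
  | succ j => exact (h₁ _).trans (le_max_right _ _)

/-- Block `m` lives in `|ξ| ≤ 2^{m+1}` and block `n ≥ 1` in `|ξ| ≥ 2^{n-1}`; an index gap of three
makes these regions strictly disjoint. The reflection `-ξ` appears because the pairing carries no
complex conjugate. -/
theorem symbol_mul_symbol_neg_eq_zero {j k : ℕ} (h : j + 3 ≤ k ∨ k + 3 ≤ j) (ξ : Plane) :
    P.symbol j ξ * P.symbol k (-ξ) = 0 := by
  by_contra hne
  have h1 := left_ne_zero_of_mul hne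
  have h2 := right_ne_zero_of_mul hne
  have key : ∀ {m n : ℕ} {a b : Plane}, m + 3 ≤ n → ‖a‖ = ‖b‖ → P.symbol m a ≠ 0 →
      P.symbol n b ≠ 0 → False := by
    intro m n a b hmn hab ha hb
    obtain ⟨n, rfl⟩ : ∃ i, n = i + 1 := ⟨n - 1, by omega⟩
    have h3 := P.norm_le_of_symbol_ne_zero ha
    have h4 := P.le_norm_of_symbol_ne_zero hb
    have h5 : (2 : ℝ) ^ (m + 1) < 2 ^ n := pow_lt_pow_right₀ one_lt_two (by omega)
    linarith
  rcases h with h | h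
  · exact key h (norm_neg ξ).symm h1 h2
  · exact key h (norm_neg ξ) h2 h1

theorem hasTemperateGrowth_symbol (j : ℕ) :
    (fun ξ => (P.symbol j ξ : ℂ)).HasTemperateGrowth :=
  ((P.hasCompactSupport_symbol j).comp_left (g := ((↑) : ℝ → ℂ)) rfl).hasTemperateGrowth
    (Complex.ofRealCLM.contDiff.comp (P.contDiff_symbol j))

theorem continuous_symbol_complex (j : ℕ) : Continuous fun ξ => (P.symbol j ξ : ℂ) :=
  Complex.continuous_ofReal.comp (P.contDiff_symbol j).continuous

theorem memLp_symbol (j : ℕ) : MemLp (fun ξ => (P.symbol j ξ : ℂ)) ⊤ volume :=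
  (P.continuous_symbol_complex j).memLp_of_hasCompactSupport
    ((P.hasCompactSupport_symbol j).comp_left (g := ((↑) : ℝ → ℂ)) rfl)

/-- Multiplication by the symbol of the `j`-th dyadic block. -/
noncomputable def symbolMul (j : ℕ) :
    Lp ℂ 2 (volume : Measure Plane) →L[ℂ] Lp ℂ 2 (volume : Measure Plane) :=
  (ContinuousLinearMap.lsmul ℂ ℂ).holderL volume ⊤ 2 2 ((P.memLp_symbol j).toLp _)

theorem symbolMul_eq (j : ℕ) (V : Lp ℂ 2 (volume : Measure Plane)) :
    P.symbolMul j V = (((P.memLp_symbol j).toLp _ : Lp ℂ ⊤ volume) • V : Lp ℂ 2 volume) := rfl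

theorem coeFn_symbolMul (j : ℕ) (V : Lp ℂ 2 (volume : Measure Plane)) :
    P.symbolMul j V =ᵐ[volume] fun ξ => (P.symbol j ξ : ℂ) * V ξ := by
  rw [symbolMul_eq]
  filter_upwards [Lp.coeFn_lpSMul (r := 2) ((P.memLp_symbol j).toLp _) V,
    (P.memLp_symbol j).coeFn_toLp] with ξ h1 h2
  rw [h1, Pi.smul_apply', h2, smul_eq_mul]

theorem block_toTemperedDistribution (j : ℕ) (g : Lp ℂ 2 (volume : Measure Plane)) :
    P.block j (g : 𝓢'(Plane, ℂ)) =
      ((𝓕⁻ (P.symbolMul j (𝓕 g)) : Lp ℂ 2 (volume : Measure Plane)) : 𝓢'(Plane, ℂ)) := by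
  rw [block, TemperedDistribution.fourierMultiplierCLM_apply, Lp.fourier_toTemperedDistribution_eq,
    ← Lp.toTemperedDistribution_smul_eq (p := ⊤) (q := 2) (r := 2) (P.hasTemperateGrowth_symbol j)
      (P.memLp_symbol j), Lp.fourierInv_toTemperedDistribution_eq, symbolMul_eq]

end LittlewoodPaley

/-- Makes the `L²` representative unique, so that the infimum in `distL2ENorm` and the choice in
`distL2Rep` take their intended values. -/
theorem toTemperedDistribution_injective : Function.Injective
    fun u : Lp ℂ 2 (volume : Measure Plane) => (u : 𝓢'(Plane, ℂ)) := by
  have h := Lp.ker_toTemperedDistributionCLM_eq_bot (E := Plane) (F := ℂ) (p := 2)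
    (μ := (volume : Measure Plane))
  exact LinearMap.ker_eq_bot.1 h

theorem distL2ENorm_coe (u : Lp ℂ 2 (volume : Measure Plane)) :
    distL2ENorm (u : 𝓢'(Plane, ℂ)) = ‖u‖ₑ := by
  refine le_antisymm (iInf₂_le (f := fun (v : Lp ℂ 2 (volume : Measure Plane))
    (_ : (v : 𝓢'(Plane, ℂ)) = u) => ‖v‖ₑ) u rfl) (le_iInf₂ fun v hv => ?_)
  rw [toTemperedDistribution_injective hv]

theorem distL2Rep_coe (u : Lp ℂ 2 (volume : Measure Plane)) :
    distL2Rep (u : 𝓢'(Plane, ℂ)) = u := by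
  have h : ∃ v : Lp ℂ 2 (volume : Measure Plane), (v : 𝓢'(Plane, ℂ)) = u := ⟨u, rfl⟩
  rw [distL2Rep, dif_pos h]
  exact toTemperedDistribution_injective h.choose_spec

theorem SchwartzMap.integrable_mul_of_integrable {f : Plane → ℂ} (hf : Integrable f)
    (s : 𝓢(Plane, ℂ)) : Integrable fun x => f x * s x := by
  obtain ⟨K, hK⟩ : ∃ K, ∀ x, ‖s x‖ ≤ K := ⟨_, fun x => s.norm_le_seminorm ℂ x⟩
  exact hf.mul_bdd s.continuous.aestronglyMeasurable (ae_of_all _ hK)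

theorem representsFun_funDist {f : Plane → ℝ} (hf : Integrable f) :
    IsTemperedFun f ∧ RepresentsFun (funDist f) f := by
  have hc : MemLp (fun x => (f x : ℂ)) 1 volume := memLp_one_iff_integrable.2 hf.ofReal
  have h : IsTemperedFun f := by
    refine ⟨(hc.toLp _ : Lp ℂ 1 (volume : Measure Plane)), fun s => ⟨s.integrable_mul_of_integrable hf.ofReal, ?_⟩⟩
    rw [Lp.toTemperedDistribution_apply]
    refine integral_congr_ae ?_
    filter_upwards [hc.coeFn_toLp] with x hx
    rw [hx, smul_eq_mul, mul_comm]
  refine ⟨h, ?_⟩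
  rw [funDist, dif_pos h]
  exact h.choose_spec

/-- For `f` merely integrable, as `1/|x|` singularities are not in `L²` of the plane, its block is
still in `L²` once `U` is. The identity is tested on Schwartz functions, where it is the
multiplication formula for the Fourier transform. -/
theorem block_funDist (P : LittlewoodPaley) (j : ℕ) {f : Plane → ℝ} (hf : Integrable f)
    (U : Lp ℂ 2 (volume : Measure Plane))
    (hU : U =ᵐ[volume] fun ξ => (P.symbol j ξ : ℂ) * 𝓕 (fun x => (f x : ℂ)) ξ) :
    P.block j (funDist f) = ((𝓕⁻ U : Lp ℂ 2 (volume : Measure Plane)) : 𝓢'(Plane, ℂ)) := by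
  ext s
  rw [LittlewoodPaley.block, TemperedDistribution.fourierMultiplierCLM_apply_apply,
    ← Lp.fourierInv_toTemperedDistribution_eq, TemperedDistribution.fourierInv_apply,
    Lp.toTemperedDistribution_apply, ((representsFun_funDist hf).2 _).2]
  have h := integral_fourier_mul_eq_integral_mul_fourier (hf.ofReal (𝕜 := ℂ))
    (SchwartzMap.smulLeftCLM ℂ (fun ξ => (P.symbol j ξ : ℂ)) (𝓕⁻ s)).integrable
  refine h.symm.trans (integral_congr_ae ?_)
  filter_upwards [hU] with ξ hξ
  rw [hξ, SchwartzMap.smulLeftCLM_apply_apply (P.hasTemperateGrowth_symbol j)]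
  simp only [smul_eq_mul]
  change 𝓕 (fun x => (f x : ℂ)) ξ * _ = _
  ring

/-- The bilinear pairing `∫ u v` on `L²`. -/
noncomputable def bilinL2 :
    Lp ℂ 2 (volume : Measure Plane) →L[ℂ] Lp ℂ 2 (volume : Measure Plane) →L[ℂ] ℂ :=
  (ContinuousLinearMap.mul ℂ ℂ).lpPairing volume 2 2

theorem bilinL2_apply (u v : Lp ℂ 2 (volume : Measure Plane)) :
    bilinL2 u v = ∫ x, u x * v x := by
  simp [bilinL2, ContinuousLinearMap.lpPairing_eq_integral]

theorem measurePreserving_neg_plane :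
    MeasurePreserving (fun x : Plane => -x) volume volume := Measure.measurePreserving_neg _

/-- Parseval for the bilinear pairing: without conjugation one factor is reflected. It is checked on
Schwartz functions and extended by density and continuity. -/
theorem bilinL2_fourierInv (U V : Lp ℂ 2 (volume : Measure Plane)) :
    bilinL2 (𝓕⁻ U) (𝓕⁻ V) = bilinL2 U (Lp.compMeasurePreserving _ measurePreserving_neg_plane V) := by
  have hc : Continuous (Lp.compMeasurePreserving (E := ℂ) (p := 2) _ measurePreserving_neg_plane) :=
    (Lp.isometry_compMeasurePreserving measurePreserving_neg_plane).continuous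
  have hF : Continuous fun u : Lp ℂ 2 (volume : Measure Plane) => 𝓕⁻ u :=
    (Lp.fourierTransformₗᵢ Plane ℂ).symm.continuous
  have hd := SchwartzMap.denseRange_toLpCLM (E := Plane) (F := ℂ) (p := 2)
    (μ := (volume : Measure Plane)) ENNReal.ofNat_ne_top
  refine DenseRange.induction_on₂ (p := fun U V => bilinL2 (𝓕⁻ U) (𝓕⁻ V) =
    bilinL2 U (Lp.compMeasurePreserving _ measurePreserving_neg_plane V)) hd ?_ ?_ U V
  · exact isClosed_eq
      ((bilinL2.continuous.comp (hF.comp continuous_fst)).clm_apply (hF.comp continuous_snd))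
      ((bilinL2.continuous.comp continuous_fst).clm_apply (hc.comp continuous_snd))
  · intro f g
    simp only [SchwartzMap.toLpCLM_apply, SchwartzMap.toLp_fourierInv_eq]
    rw [bilinL2_apply, bilinL2_apply]
    have e1 : ∫ x, ((𝓕⁻ f).toLp 2 : Lp ℂ 2 (volume : Measure Plane)) x *
        ((𝓕⁻ g).toLp 2 : Lp ℂ 2 (volume : Measure Plane)) x = ∫ x, 𝓕⁻ f x * 𝓕⁻ g x := by
      refine integral_congr_ae ?_
      filter_upwards [(𝓕⁻ f).coeFn_toLp 2 volume, (𝓕⁻ g).coeFn_toLp 2 volume] with x h1 h2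
      rw [h1, h2]
    rw [e1, SchwartzMap.integral_fourierInv_mul_eq]
    refine integral_congr_ae ?_
    filter_upwards [f.coeFn_toLp 2 volume,
      Lp.coeFn_compMeasurePreserving (g.toLp 2 : Lp ℂ 2 volume) measurePreserving_neg_plane,
      measurePreserving_neg_plane.quasiMeasurePreserving.ae (g.coeFn_toLp 2 volume)] with x h1 h2 h3
    rw [h1, h2, Function.comp_apply, h3]
    congr 1
    rw [SchwartzMap.fourierInv_coe, Real.fourierInv_eq_fourier_neg, ← SchwartzMap.fourier_coe,
      FourierTransform.fourier_fourierInv_eq]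

theorem bilinL2_eq_zero_of_symbols (P : LittlewoodPaley) {j k : ℕ} (h : j + 3 ≤ k ∨ k + 3 ≤ j)
    {U : Lp ℂ 2 (volume : Measure Plane)} {b : Plane → ℂ}
    (hU : U =ᵐ[volume] fun ξ => (P.symbol j ξ : ℂ) * b ξ) (V : Lp ℂ 2 (volume : Measure Plane)) :
    bilinL2 (𝓕⁻ U) (𝓕⁻ (P.symbolMul k V)) = 0 := by
  rw [bilinL2_fourierInv, bilinL2_apply]
  refine integral_eq_zero_of_ae ?_
  filter_upwards [hU, Lp.coeFn_compMeasurePreserving (P.symbolMul k V) measurePreserving_neg_plane,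
      measurePreserving_neg_plane.quasiMeasurePreserving.ae (P.coeFn_symbolMul k V)] with ξ h1 h2 h3
  rw [h1, h2, Function.comp_apply, h3]
  have := P.symbol_mul_symbol_neg_eq_zero h ξ
  have h4 : (P.symbol j ξ : ℂ) * (P.symbol k (-ξ) : ℂ) = 0 := by exact_mod_cast this
  simp only [Pi.zero_apply]
  linear_combination b ξ * V (-ξ) * h4

/-! ### The heat multiplier and uniform bounds on dyadic blocks. -/

theorem fourier_heatAverage {w : Plane → ℝ} (hw : Integrable w) {s : ℝ} (hs : 0 < s) (ξ : Plane) :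
    𝓕 (fun x => (heatAverage s w x : ℂ)) ξ =
      (Real.exp (-(4 * Real.pi ^ 2 * s * ‖ξ‖ ^ 2)) : ℂ) * 𝓕 (fun x => (w x : ℂ)) ξ := by
  have hk : 𝓕 (fun x => (heatKernel s x : ℂ)) ξ =
      (Real.exp (-(4 * Real.pi ^ 2 * s * ‖ξ‖ ^ 2)) : ℂ) := by
    have hb : 0 < ((((4 * s)⁻¹ : ℝ) : ℂ)).re := by rw [Complex.ofReal_re]; positivity
    have e : (fun x : Plane => (heatKernel s x : ℂ)) =
        (((4 * Real.pi * s)⁻¹ : ℝ) : ℂ) •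
          fun x : Plane => Complex.exp (-(((4 * s)⁻¹ : ℝ) : ℂ) * ‖x‖ ^ 2) := by
      funext x
      rw [heatKernel_eq]
      simp only [Pi.smul_apply, smul_eq_mul]
      push_cast
      rfl
    have hpi := Real.pi_pos.ne'
    have e0 : ∀ (c : ℂ) (g : Plane → ℂ), 𝓕 (c • g) ξ = c • 𝓕 g ξ := fun c g =>
      congrFun (VectorFourier.fourierIntegral_const_smul Real.fourierChar volume (innerₗ Plane) g c) ξ
    rw [e, e0, fourier_gaussian_innerProductSpace hb]
    have e1 : ((Module.finrank ℝ Plane : ℂ) / 2) = 1 := by simp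
    rw [e1, Complex.cpow_one, smul_eq_mul, ← mul_assoc, ← Complex.ofReal_div, ← Complex.ofReal_mul,
      show (4 * Real.pi * s)⁻¹ * (Real.pi / (4 * s)⁻¹) = 1 by field_simp, Complex.ofReal_one, one_mul,
      Complex.ofReal_exp]
    congr 1
    have hs' : (s : ℂ) ≠ 0 := by exact_mod_cast hs.ne'
    push_cast
    field_simp
  have hconv : (fun x => (heatAverage s w x : ℂ)) = convolution (fun x => (w x : ℂ))
      (fun x => (heatKernel s x : ℂ)) (ContinuousLinearMap.mul ℂ ℂ) volume := by
    funext x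
    simp only [convolution, ContinuousLinearMap.mul_apply', heatAverage]
    rw [← integral_complex_ofReal]
    refine integral_congr_ae (ae_of_all _ fun y => ?_)
    push_cast
    ring
  have hw' : Integrable fun x => (w x : ℂ) := hw.ofReal
  have hk' : Integrable fun x => (heatKernel s x : ℂ) := (integrable_heatKernel hs).ofReal
  rw [hconv, ← hk, mul_comm]
  exact Real.fourier_mul_convolution_eq hw' hk' ξ

/-- The Fourier multiplier of the heat semigroup at time `s`. -/
noncomputable def heatSymbol (s : ℝ≥0) (ξ : Plane) : ℂ :=
  (Real.exp (-(4 * Real.pi ^ 2 * s * ‖ξ‖ ^ 2)) : ℂ)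

theorem continuous_heatSymbol (s : ℝ≥0) : Continuous (heatSymbol s) := by
  unfold heatSymbol
  fun_prop

theorem heatSymbol_zero (ξ : Plane) : heatSymbol 0 ξ = 1 := by simp [heatSymbol]

theorem norm_heatSymbol_le_one (s : ℝ≥0) (ξ : Plane) : ‖heatSymbol s ξ‖ ≤ 1 := by
  rw [heatSymbol, Complex.norm_real, Real.norm_of_nonneg (Real.exp_pos _).le, Real.exp_le_one_iff]
  have : 0 ≤ 4 * Real.pi ^ 2 * s * ‖ξ‖ ^ 2 := by positivity
  linarith

theorem abs_exp_neg_sub_exp_neg_le {x y : ℝ} (hx : 0 ≤ x) (hy : 0 ≤ y) :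
    |Real.exp (-x) - Real.exp (-y)| ≤ |x - y| := by
  wlog h : x ≤ y generalizing x y
  · rw [abs_sub_comm, abs_sub_comm x]
    exact this hy hx (le_of_not_ge h)
  rw [abs_of_nonneg (sub_nonneg.2 (Real.exp_le_exp.2 (neg_le_neg h))), abs_of_nonpos (by linarith)]
  have h1 := Real.add_one_le_exp (x - y)
  have h2 : Real.exp (-y) = Real.exp (-x) * Real.exp (x - y) := by
    rw [← Real.exp_add]
    congr 1
    ring
  have h3 : Real.exp (-x) ≤ 1 := Real.exp_le_one_iff.2 (by linarith)
  have h4 := Real.exp_pos (-x)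
  rw [h2]
  nlinarith

theorem norm_heatSymbol_sub_le (s s' : ℝ≥0) {ξ : Plane} {R : ℝ} (hξ : ‖ξ‖ ≤ R) :
    ‖heatSymbol s ξ - heatSymbol s' ξ‖ ≤ 4 * Real.pi ^ 2 * R ^ 2 * dist s s' := by
  rw [heatSymbol, heatSymbol, ← Complex.ofReal_sub, Complex.norm_real, Real.norm_eq_abs]
  refine (abs_exp_neg_sub_exp_neg_le (by positivity) (by positivity)).trans ?_
  rw [show 4 * Real.pi ^ 2 * (s : ℝ) * ‖ξ‖ ^ 2 - 4 * Real.pi ^ 2 * s' * ‖ξ‖ ^ 2 =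
    4 * Real.pi ^ 2 * ‖ξ‖ ^ 2 * (s - s') by ring, abs_mul, abs_of_nonneg (by positivity),
    NNReal.dist_eq]
  gcongr

theorem Lp_norm_le_of_norm_le_on_closedBall {U : Lp ℂ 2 (volume : Measure Plane)} {c r : ℝ}
    (hc : 0 ≤ c) (hr : 0 ≤ r) (hU : ∀ᵐ ξ, ‖U ξ‖ ≤ c) (hU0 : ∀ᵐ ξ, r < ‖ξ‖ → U ξ = 0) :
    ‖U‖ ≤ c * r * √Real.pi := by
  rw [Lp.norm_def]
  refine ENNReal.toReal_le_of_le_ofReal (by positivity) ?_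
  have h1 : eLpNorm U 2 volume ≤
      eLpNorm ((Metric.closedBall (0 : Plane) r).indicator fun _ => c) 2 volume := by
    refine eLpNorm_mono_ae_real ?_
    filter_upwards [hU, hU0] with ξ h h0
    by_cases hξ : ‖ξ‖ ≤ r
    · rwa [Set.indicator_of_mem (by simpa using hξ)]
    · rw [Set.indicator_of_notMem (by simpa using hξ), h0 (lt_of_not_ge hξ), norm_zero]
  refine h1.trans (le_of_eq ?_)
  rw [eLpNorm_indicator_const Metric.isClosed_closedBall.measurableSet two_ne_zero
    ENNReal.ofNat_ne_top, EuclideanSpace.volume_closedBall_fin_two, Real.enorm_of_nonneg hc,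
    ← ENNReal.ofReal_pow hr, ← ENNReal.ofReal_mul (by positivity),
    ENNReal.ofReal_rpow_of_nonneg (by positivity) (by positivity), ← ENNReal.ofReal_mul hc,
    ENNReal.toReal_ofNat, ← Real.sqrt_eq_rpow, Real.sqrt_mul (by positivity), Real.sqrt_sq hr,
    mul_assoc]

namespace LittlewoodPaley

variable (P : LittlewoodPaley) {a : Plane → ℂ}

theorem memLp_heatMode (ha : Continuous a) (j : ℕ) (s : ℝ≥0) :
    MemLp (fun ξ => (P.symbol j ξ : ℂ) * (heatSymbol s ξ * a ξ)) 2 volume :=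
  ((P.continuous_symbol_complex j).mul
    ((continuous_heatSymbol s).mul ha)).memLp_of_hasCompactSupport
    (((P.hasCompactSupport_symbol j).comp_left (g := ((↑) : ℝ → ℂ)) rfl).mul_right)

/-- The Fourier transform of the `j`-th dyadic block of the heat evolution at time `s` of a function
with Fourier transform `a`. -/
noncomputable def heatMode (ha : Continuous a) (j : ℕ) (s : ℝ≥0) :
    Lp ℂ 2 (volume : Measure Plane) :=
  (P.memLp_heatMode ha j s).toLp _

theorem coeFn_heatMode (ha : Continuous a) (j : ℕ) (s : ℝ≥0) :
    P.heatMode ha j s =ᵐ[volume] fun ξ => (P.symbol j ξ : ℂ) * (heatSymbol s ξ * a ξ) :=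
  (P.memLp_heatMode ha j s).coeFn_toLp

/-- On the support of the symbol `|ξ| ≤ 2^{j+1}`, so the multiplier is Lipschitz in `s` with a
constant depending on `j`, and the block at `s = 0` serves as the reference function. -/
theorem continuous_heatMode (ha : Continuous a) (j : ℕ) : Continuous (P.heatMode ha j) := by
  refine (LipschitzWith.of_dist_le_mul (K := ⟨4 * Real.pi ^ 2 * (2 ^ (j + 1)) ^ 2 *
    ‖P.heatMode ha j 0‖, by positivity⟩) fun s s' => ?_).continuous
  rw [dist_eq_norm]
  change _ ≤ 4 * Real.pi ^ 2 * (2 ^ (j + 1)) ^ 2 * ‖P.heatMode ha j 0‖ * dist s s'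
  rw [mul_right_comm]
  refine Lp.norm_le_mul_norm_of_ae_le_mul ?_
  filter_upwards [P.coeFn_heatMode ha j s, P.coeFn_heatMode ha j s', P.coeFn_heatMode ha j 0,
    Lp.coeFn_sub (P.heatMode ha j s) (P.heatMode ha j s')] with ξ h1 h2 h3 h4
  rw [h4, Pi.sub_apply, h1, h2, h3, heatSymbol_zero, one_mul, ← mul_sub, ← sub_mul, norm_mul,
    norm_mul, norm_mul]
  by_cases h0 : P.symbol j ξ = 0
  · simp [h0]
  have := norm_heatSymbol_sub_le s s' (P.norm_le_of_symbol_ne_zero h0)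
  calc ‖(P.symbol j ξ : ℂ)‖ * (‖heatSymbol s ξ - heatSymbol s' ξ‖ * ‖a ξ‖)
      ≤ ‖(P.symbol j ξ : ℂ)‖ * ((4 * Real.pi ^ 2 * (2 ^ (j + 1)) ^ 2 * dist s s') * ‖a ξ‖) := by
        gcongr
    _ = _ := by ring

/-- The critical scaling: on block `j + 1` the transform is at most `C / 2^j`, while the support
lies in a ball of radius `2^{j+2}`; since `L²` norm in the plane scales like height times radius,
the powers of two cancel. The low block uses the supremum `A` instead, and the heat multiplier never
exceeds one. -/
theorem exists_norm_heatMode_le (ha : Continuous a) {A C : ℝ} (hA : ∀ ξ, ‖a ξ‖ ≤ A)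
    (hC : ∀ ξ, ‖ξ‖ * ‖a ξ‖ ≤ C) : ∃ K : ℝ≥0, ∀ j s, ‖P.heatMode ha j s‖ ≤ K := by
  obtain ⟨S, hS, hSle⟩ := P.exists_abs_symbol_le
  have hA0 : 0 ≤ A := (norm_nonneg _).trans (hA 0)
  have hC0 : 0 ≤ C := (by positivity : (0 : ℝ) ≤ ‖(0 : Plane)‖ * ‖a 0‖).trans (hC 0)
  have hsym : ∀ j ξ, ‖(P.symbol j ξ : ℂ)‖ ≤ S := fun j ξ => by
    rw [Complex.norm_real]
    exact hSle j ξ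
  have hsupp : ∀ j s, ∀ᵐ ξ, (2 : ℝ) ^ (j + 1) < ‖ξ‖ → P.heatMode ha j s ξ = 0 := by
    intro j s
    filter_upwards [P.coeFn_heatMode ha j s] with ξ h1 h2
    have h0 : P.symbol j ξ = 0 := by
      by_contra h
      exact absurd (P.norm_le_of_symbol_ne_zero h) (not_le.2 h2)
    rw [h1, h0, Complex.ofReal_zero, zero_mul]
  refine ⟨⟨S * A * 2 * √Real.pi + S * C * 4 * √Real.pi, by positivity⟩, fun j s => ?_⟩
  change _ ≤ S * A * 2 * √Real.pi + S * C * 4 * √Real.pi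
  have hE := norm_heatSymbol_le_one s
  cases j with
  | zero =>
    refine (Lp_norm_le_of_norm_le_on_closedBall (c := S * A) (r := 2) (by positivity) two_pos.le ?_
      (by simpa using hsupp 0 s)).trans (le_add_of_nonneg_right (by positivity))
    filter_upwards [P.coeFn_heatMode ha 0 s] with ξ h1
    rw [h1, norm_mul, norm_mul]
    have h2 : ‖heatSymbol s ξ‖ * ‖a ξ‖ ≤ 1 * A :=
      mul_le_mul (hE ξ) (hA ξ) (norm_nonneg _) zero_le_one
    rw [one_mul] at h2
    exact mul_le_mul (hsym _ _) h2 (by positivity) hS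
  | succ j =>
    refine (Lp_norm_le_of_norm_le_on_closedBall (c := S * (C / 2 ^ j)) (r := 2 ^ (j + 2))
      (by positivity) (by positivity) ?_ (hsupp (j + 1) s)).trans ?_
    · filter_upwards [P.coeFn_heatMode ha (j + 1) s] with ξ h1
      rw [h1, norm_mul, norm_mul]
      by_cases h0 : P.symbol (j + 1) ξ = 0
      · rw [h0, Complex.ofReal_zero, norm_zero, zero_mul]
        positivity
      have h2 := P.le_norm_of_symbol_ne_zero h0
      have h3 : ‖a ξ‖ ≤ C / 2 ^ j := by
        rw [le_div_iff₀ (by positivity), mul_comm]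
        exact (mul_le_mul_of_nonneg_right h2 (norm_nonneg _)).trans (hC ξ)
      have h4 : ‖heatSymbol s ξ‖ * ‖a ξ‖ ≤ 1 * (C / 2 ^ j) :=
        mul_le_mul (hE ξ) h3 (norm_nonneg _) zero_le_one
      rw [one_mul] at h4
      exact mul_le_mul (hsym _ _) h4 (by positivity) hS
    · rw [show S * (C / 2 ^ j) * 2 ^ (j + 2) = S * C * 4 by rw [pow_add]; field_simp; norm_num]
      exact le_add_of_nonneg_left (by positivity)

/-- The `k`-th dyadic block on `L²`. -/
noncomputable def blockL2 (k : ℕ) (g : Lp ℂ 2 (volume : Measure Plane)) :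
    Lp ℂ 2 (volume : Measure Plane) :=
  𝓕⁻ (P.symbolMul k (𝓕 g))

theorem continuous_fourierInv_L2 :
    Continuous fun u : Lp ℂ 2 (volume : Measure Plane) => 𝓕⁻ u :=
  (Lp.fourierTransformₗᵢ Plane ℂ).symm.continuous

theorem norm_fourierInv_L2 (u : Lp ℂ 2 (volume : Measure Plane)) : ‖𝓕⁻ u‖ = ‖u‖ :=
  (Lp.fourierTransformₗᵢ Plane ℂ).symm.norm_map u

theorem continuous_blockL2 (k : ℕ) : Continuous (P.blockL2 k) :=
  continuous_fourierInv_L2.comp ((P.symbolMul k).continuous.comp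
    (Lp.fourierTransformₗᵢ Plane ℂ).continuous)

theorem besovOneENorm_coe (g : Lp ℂ 2 (volume : Measure Plane)) :
    besovOneENorm P (g : 𝓢'(Plane, ℂ)) = ∑' k, ‖P.blockL2 k g‖ₑ := by
  simp only [besovOneENorm, P.block_toTemperedDistribution, distL2ENorm_coe, blockL2]

theorem aemeasurable_besovOneENorm {μ : Measure ℝ} {g : ℝ → Lp ℂ 2 (volume : Measure Plane)}
    (hg : AEStronglyMeasurable g μ) :
    AEMeasurable (fun t => besovOneENorm P (g t : 𝓢'(Plane, ℂ))) μ := by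
  simp only [besovOneENorm_coe]
  exact AEMeasurable.tsum fun k =>
    ((P.continuous_blockL2 k).comp_aestronglyMeasurable hg).enorm

/-! ### The Besov duality pairing along the heat flow. -/

/-- The term of index `(j, k)` in the pairing of the heat evolution at time `s` with `g`. -/
noncomputable def pairingTerm (ha : Continuous a) (s : ℝ≥0) (g : Lp ℂ 2 (volume : Measure Plane))
    (jk : ℕ × ℕ) : ℂ :=
  bilinL2 (𝓕⁻ (P.heatMode ha jk.1 s)) (P.blockL2 jk.2 g)

theorem continuous_pairingTerm (ha : Continuous a) (jk : ℕ × ℕ) :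
    Continuous fun z : ℝ≥0 × Lp ℂ 2 (volume : Measure Plane) => P.pairingTerm ha z.1 z.2 jk :=
  (bilinL2.continuous.comp (continuous_fourierInv_L2.comp
    ((P.continuous_heatMode ha jk.1).comp continuous_fst))).clm_apply
    ((P.continuous_blockL2 jk.2).comp continuous_snd)

theorem continuous_pairingTerm_left (ha : Continuous a) (g : Lp ℂ 2 (volume : Measure Plane))
    (jk : ℕ × ℕ) : Continuous fun s => P.pairingTerm ha s g jk :=
  Continuous.comp (g := fun z : ℝ≥0 × Lp ℂ 2 (volume : Measure Plane) =>
    P.pairingTerm ha z.1 z.2 jk) (f := fun s => (s, g)) (P.continuous_pairingTerm ha jk)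
    (continuous_id.prodMk continuous_const)

/-- The majorant of the term of index `(j, k)` in the pairing of `g` with a distribution whose
dyadic blocks have norm at most `K`. -/
noncomputable def pairingBound (K : ℝ≥0) (g : Lp ℂ 2 (volume : Measure Plane)) (jk : ℕ × ℕ) :
    ℝ≥0∞ :=
  if jk.1 ≤ jk.2 + 2 ∧ jk.2 ≤ jk.1 + 2 then ‖bilinL2‖ₑ * K * ‖P.blockL2 jk.2 g‖ₑ else 0

theorem tsum_pairingBound_le (K : ℝ≥0) (g : Lp ℂ 2 (volume : Measure Plane)) :
    ∑' jk, P.pairingBound K g jk ≤ 5 * (‖bilinL2‖ₑ * K) * besovOneENorm P (g : 𝓢'(Plane, ℂ)) := by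
  rw [besovOneENorm_coe, ← ENNReal.tsum_mul_left, ENNReal.tsum_prod', ENNReal.tsum_comm]
  refine ENNReal.tsum_le_tsum fun k => ?_
  -- For fixed `k` only the indices within two of `k` contribute, at most five; truncated
  -- subtraction at small `k` only shortens the list.
  rw [tsum_eq_sum (s := Finset.Icc (k - 2) (k + 2))]
  · calc ∑ j ∈ Finset.Icc (k - 2) (k + 2), P.pairingBound K g (j, k)
        ≤ (Finset.Icc (k - 2) (k + 2)).card • (‖bilinL2‖ₑ * K * ‖P.blockL2 k g‖ₑ) := by
          refine Finset.sum_le_card_nsmul _ _ _ fun j _ => ?_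
          unfold pairingBound
          split_ifs
          · exact le_rfl
          · positivity
      _ ≤ 5 • (‖bilinL2‖ₑ * K * ‖P.blockL2 k g‖ₑ) := by
          refine nsmul_le_nsmul_left (by positivity) ?_
          rw [Nat.card_Icc]
          omega
      _ = _ := by rw [nsmul_eq_mul]; push_cast; ring
  · intro j hj
    rw [Finset.mem_Icc] at hj
    exact if_neg (by dsimp only; omega)

theorem enorm_pairingTerm_le (ha : Continuous a) {K : ℝ≥0}
    (hK : ∀ j s, ‖P.heatMode ha j s‖ ≤ K) (s : ℝ≥0) (g : Lp ℂ 2 (volume : Measure Plane))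
    (jk : ℕ × ℕ) : ‖P.pairingTerm ha s g jk‖ₑ ≤ P.pairingBound K g jk := by
  unfold pairingBound
  split_ifs with h
  · have h1 := bilinL2.le_opNorm₂ (𝓕⁻ (P.heatMode ha jk.1 s)) (P.blockL2 jk.2 g)
    rw [norm_fourierInv_L2] at h1
    have h2 : ‖P.pairingTerm ha s g jk‖ ≤ ‖bilinL2‖ * K * ‖P.blockL2 jk.2 g‖ :=
      h1.trans (by gcongr; exact hK _ _)
    rw [← ofReal_norm]
    refine (ENNReal.ofReal_le_ofReal h2).trans (le_of_eq ?_)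
    rw [ENNReal.ofReal_mul (by positivity), ENNReal.ofReal_mul (by positivity),
      ofReal_norm (P.blockL2 jk.2 g), ENNReal.ofReal_coe_nnreal, ofReal_norm bilinL2]
  · rw [pairingTerm, blockL2, bilinL2_eq_zero_of_symbols P (by omega) (P.coeFn_heatMode ha jk.1 s),
      enorm_zero]

/-- The pairing of the heat evolution at time `s` with `g`. -/
noncomputable def heatPairing (ha : Continuous a) (s : ℝ≥0) (g : Lp ℂ 2 (volume : Measure Plane)) :
    ℂ :=
  ∑' jk, P.pairingTerm ha s g jk

theorem summable_pairingBound {K : ℝ≥0} {g : Lp ℂ 2 (volume : Measure Plane)}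
    (hg : besovOneENorm P (g : 𝓢'(Plane, ℂ)) < ⊤) :
    ∑' jk, P.pairingBound K g jk ≠ ⊤ :=
  ((P.tsum_pairingBound_le K g).trans_lt (ENNReal.mul_lt_top (ENNReal.mul_lt_top (by simp)
    (ENNReal.mul_lt_top enorm_lt_top ENNReal.coe_lt_top)) hg)).ne

theorem norm_pairingTerm_le (ha : Continuous a) {K : ℝ≥0}
    (hK : ∀ j s, ‖P.heatMode ha j s‖ ≤ K) {g : Lp ℂ 2 (volume : Measure Plane)}
    (hg : besovOneENorm P (g : 𝓢'(Plane, ℂ)) < ⊤) (s : ℝ≥0) (jk : ℕ × ℕ) :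
    ‖P.pairingTerm ha s g jk‖ ≤ (P.pairingBound K g jk).toReal := by
  rw [← toReal_enorm]
  exact ENNReal.toReal_mono (ENNReal.ne_top_of_tsum_ne_top (P.summable_pairingBound hg) jk)
    (P.enorm_pairingTerm_le ha hK s g jk)

theorem enorm_heatPairing_le (ha : Continuous a) {K : ℝ≥0}
    (hK : ∀ j s, ‖P.heatMode ha j s‖ ≤ K) (s : ℝ≥0) (g : Lp ℂ 2 (volume : Measure Plane)) :
    ‖P.heatPairing ha s g‖ₑ ≤ 5 * (‖bilinL2‖ₑ * K) * besovOneENorm P (g : 𝓢'(Plane, ℂ)) :=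
  enorm_tsum_le_tsum_enorm.trans ((ENNReal.tsum_le_tsum (P.enorm_pairingTerm_le ha hK s g)).trans
    (P.tsum_pairingBound_le K g))

/-- Weierstrass test: each term is continuous in `s`, and the majorant does not depend on `s`.
Continuity at `s = 0` is the source of the weak-* convergence. -/
theorem continuous_heatPairing (ha : Continuous a) {K : ℝ≥0}
    (hK : ∀ j s, ‖P.heatMode ha j s‖ ≤ K) {g : Lp ℂ 2 (volume : Measure Plane)}
    (hg : besovOneENorm P (g : 𝓢'(Plane, ℂ)) < ⊤) :
    Continuous fun s => P.heatPairing ha s g :=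
  continuous_tsum (fun jk => P.continuous_pairingTerm_left ha g jk)
    (ENNReal.summable_toReal (P.summable_pairingBound hg))
    fun jk s => P.norm_pairingTerm_le ha hK hg s jk

/-- An almost everywhere limit of finite partial sums, each a continuous function of the measurable
pair `(σ t, g t)`. -/
theorem aestronglyMeasurable_heatPairing (ha : Continuous a) {K : ℝ≥0}
    (hK : ∀ j s, ‖P.heatMode ha j s‖ ≤ K) {μ : Measure ℝ} {σ : ℝ → ℝ≥0} (hσ : Continuous σ)
    {g : ℝ → Lp ℂ 2 (volume : Measure Plane)} (hg : AEStronglyMeasurable g μ)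
    (hg1 : ∀ᵐ t ∂μ, besovOneENorm P (g t : 𝓢'(Plane, ℂ)) < ⊤) :
    AEStronglyMeasurable (fun t => P.heatPairing ha (σ t) (g t)) μ := by
  refine aestronglyMeasurable_of_tendsto_ae (atTop : Filter (Finset (ℕ × ℕ)))
    (f := fun F t => ∑ jk ∈ F, P.pairingTerm ha (σ t) (g t) jk) (fun F => ?_) ?_
  · refine Finset.aestronglyMeasurable_fun_sum _ fun jk _ => ?_
    exact Continuous.comp_aestronglyMeasurable (g := fun z : ℝ≥0 × Lp ℂ 2 (volume : Measure Plane) =>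
      P.pairingTerm ha z.1 z.2 jk) (f := fun t => (σ t, g t)) (P.continuous_pairingTerm ha jk)
      (hσ.aestronglyMeasurable.prodMk hg)
  · filter_upwards [hg1] with t ht
    exact (Summable.of_norm_bounded (ENNReal.summable_toReal (P.summable_pairingBound ht))
      fun jk => P.norm_pairingTerm_le ha hK ht (σ t) jk).hasSum

end LittlewoodPaley

/-! ### Heat flows in the Besov space and weak-* convergence. -/

/-- The functions `v t`, `t > 0`, have the Fourier transforms `exp(-4π²νt|ξ|²) a(ξ)`: they are the
heat evolution with viscosity `ν` of a function with Fourier transform `a`. -/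
structure IsHeatFlow (a : Plane → ℂ) (ν : ℝ) (v : ℝ → Plane → ℝ) : Prop where
  integrable : ∀ t, 0 < t → Integrable (v t)
  fourier_eq : ∀ t, 0 < t → ∀ ξ,
    𝓕 (fun x => (v t x : ℂ)) ξ = heatSymbol (ν * t).toNNReal ξ * a ξ

/-- The stationary vorticity is the flow of viscosity zero, so approximations and limit are covered
by the same formulas. -/
theorem IsSingularVortex.isHeatFlow_const {M : ℝ} {w : Plane → ℝ} (h : IsSingularVortex M w) :
    IsHeatFlow (𝓕 fun x => (w x : ℂ)) 0 fun _ => w :=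
  ⟨fun _ _ => h.integrable, fun t _ ξ => by
    rw [zero_mul, Real.toNNReal_zero, heatSymbol_zero, one_mul]⟩

theorem IsSingularVortex.isHeatFlow_heatEvolution {M : ℝ} {w : Plane → ℝ}
    (h : IsSingularVortex M w) {ν : ℝ} (hν : 0 < ν) :
    IsHeatFlow (𝓕 fun x => (w x : ℂ)) ν (heatEvolution ν w) := by
  have e : ∀ t, 0 < t → heatEvolution ν w t = heatAverage (ν * t) w := fun t ht =>
    funext (heatEvolution_of_pos ν w ht)
  refine ⟨fun t ht => ?_, fun t ht ξ => ?_⟩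
  · rw [e t ht]
    exact h.integrable_heatAverage (mul_pos hν ht)
  · rw [e t ht, fourier_heatAverage h.integrable (mul_pos hν ht), heatSymbol,
      Real.coe_toNNReal _ (mul_pos hν ht).le]

theorem continuous_fourier_of_integrable {f : Plane → ℂ} (hf : Integrable f) : Continuous (𝓕 f) :=
  VectorFourier.fourierIntegral_continuous Real.continuous_fourierChar
    (innerSL ℝ (E := Plane)).continuous₂ hf

theorem ae_timeMeasure_pos (T : ℝ) : ∀ᵐ t ∂(timeMeasure T), 0 < t := by
  filter_upwards [ae_restrict_mem (μ := volume) (measurableSet_Ioo (a := (0 : ℝ)) (b := T))]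
    with t ht using ht.1

namespace IsHeatFlow

variable {P : LittlewoodPaley} {a : Plane → ℂ} {ν : ℝ} {v : ℝ → Plane → ℝ}

theorem block_eq (hv : IsHeatFlow a ν v) (ha : Continuous a) {t : ℝ} (ht : 0 < t) (j : ℕ) :
    P.block j (funDist (v t)) =
      ((𝓕⁻ (P.heatMode ha j (ν * t).toNNReal) : Lp ℂ 2 (volume : Measure Plane)) :
        𝓢'(Plane, ℂ)) := by
  refine block_funDist P j (hv.integrable t ht) _ ?_
  filter_upwards [P.coeFn_heatMode ha j (ν * t).toNNReal] with ξ hξ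
  rw [hξ, hv.fourier_eq t ht]

theorem besovInftyENorm_le (hv : IsHeatFlow a ν v) (ha : Continuous a) {K : ℝ≥0}
    (hK : ∀ j s, ‖P.heatMode ha j s‖ ≤ K) {t : ℝ} (ht : 0 < t) :
    besovInftyENorm P (funDist (v t)) ≤ K := by
  refine iSup_le fun j => ?_
  rw [hv.block_eq ha ht, distL2ENorm_coe, ← ofReal_norm, LittlewoodPaley.norm_fourierInv_L2,
    ← ENNReal.ofReal_coe_nnreal]
  exact ENNReal.ofReal_le_ofReal (hK _ _)

theorem besovPairing_eq (hv : IsHeatFlow a ν v) (ha : Continuous a) {t : ℝ} (ht : 0 < t)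
    (g : Lp ℂ 2 (volume : Measure Plane)) :
    besovPairing P (funDist (v t)) (g : 𝓢'(Plane, ℂ)) =
      P.heatPairing ha (ν * t).toNNReal g := by
  refine tsum_congr fun jk => ?_
  rw [hv.block_eq ha ht, P.block_toTemperedDistribution, distL2Rep_coe, distL2Rep_coe,
    LittlewoodPaley.pairingTerm, bilinL2_apply, LittlewoodPaley.blockL2]

theorem besovTimeENorm_top_le (hv : IsHeatFlow a ν v) (ha : Continuous a) {K : ℝ≥0}
    (hK : ∀ j s, ‖P.heatMode ha j s‖ ≤ K) (T : ℝ) : besovTimeENorm P ⊤ T v ≤ K :=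
  eLpNorm_top_le_of_le ((ae_timeMeasure_pos T).mono fun _ ht => hv.besovInftyENorm_le ha hK ht)

theorem aestronglyMeasurable_besovPairing (hv : IsHeatFlow a ν v) (ha : Continuous a) {K : ℝ≥0}
    (hK : ∀ j s, ‖P.heatMode ha j s‖ ≤ K) {T : ℝ} {g : ℝ → Lp ℂ 2 (volume : Measure Plane)}
    (hg : AEStronglyMeasurable g (timeMeasure T))
    (hg1 : ∀ᵐ t ∂(timeMeasure T), besovOneENorm P (g t : 𝓢'(Plane, ℂ)) < ⊤) :
    AEStronglyMeasurable (fun t => besovPairing P (funDist (v t)) (g t : 𝓢'(Plane, ℂ)))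
      (timeMeasure T) := by
  refine (P.aestronglyMeasurable_heatPairing ha hK (σ := fun t => (ν * t).toNNReal)
    (by fun_prop) hg hg1).congr ?_
  filter_upwards [ae_timeMeasure_pos T] with t ht
  rw [hv.besovPairing_eq ha ht]

theorem memTimeBesov (hv : IsHeatFlow a ν v) (ha : Continuous a) {K : ℝ≥0}
    (hK : ∀ j s, ‖P.heatMode ha j s‖ ≤ K) (q : ℝ≥0∞) (T : ℝ) : MemTimeBesov P q T v := by
  refine ⟨(ae_timeMeasure_pos T).mono fun t ht =>
    (representsFun_funDist (hv.integrable t ht)).1, fun g hg => ?_, ?_⟩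
  · exact hv.aestronglyMeasurable_besovPairing ha hK aestronglyMeasurable_const
      (ae_of_all _ fun _ => hg)
  · refine (eLpNorm_le_of_ae_enorm_bound (C := K) ((ae_timeMeasure_pos T).mono fun t ht =>
      hv.besovInftyENorm_le ha hK ht)).trans_lt ?_
    rw [smul_eq_mul]
    exact ENNReal.mul_lt_top ENNReal.coe_lt_top
      (ENNReal.rpow_lt_top_of_nonneg (by positivity) (measure_ne_top _ _))

/-- At each time the pairing converges by continuity in `s` as `νt → 0`. The majorant is a constant
times the `B⁰_{2,1}` norm of `g t`, integrable in time because `(0,T)` has finite measure and `q' ≥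
1`. -/
theorem tendstoWeakStarBesov {ι : Type*} {l : Filter ι} [l.IsCountablyGenerated] {νs : ι → ℝ}
    {ws : ι → ℝ → Plane → ℝ} {w : ℝ → Plane → ℝ} (ha : Continuous a) {K : ℝ≥0}
    (hK : ∀ j s, ‖P.heatMode ha j s‖ ≤ K) (hws : ∀ᶠ i in l, IsHeatFlow a (νs i) (ws i))
    (hw : IsHeatFlow a 0 w) (hνs : Tendsto νs l (𝓝 0)) (q : ℝ≥0∞) (T : ℝ) :
    TendstoWeakStarBesov P q T l ws w := by
  refine ⟨hws.mono fun i hi => hi.memTimeBesov ha hK q T, hw.memTimeBesov ha hK q T,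
    fun q' hq g hg hgq => ?_⟩
  have hmeas := P.aemeasurable_besovOneENorm hg
  have hone : 1 ≤ q' := by
    have := hq.symm
    exact ENNReal.HolderConjugate.one_le q' q
  have hint : ∫⁻ t, besovOneENorm P (g t : 𝓢'(Plane, ℂ)) ∂(timeMeasure T) < ⊤ := by
    have h := eLpNorm_le_eLpNorm_mul_rpow_measure_univ hone hmeas.aestronglyMeasurable
    rw [eLpNorm_one_eq_lintegral_enorm] at h
    refine h.trans_lt (ENNReal.mul_lt_top hgq ?_)
    refine ENNReal.rpow_lt_top_of_nonneg ?_ (measure_ne_top _ _)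
    rw [ENNReal.toReal_one, div_one, sub_nonneg, one_div]
    rcases eq_or_ne q' ⊤ with rfl | hq'
    · simp
    · exact inv_le_one_of_one_le₀ (by simpa using ENNReal.toReal_mono hq' hone)
  have hfin := ae_lt_top' hmeas hint.ne
  set c : ℝ≥0∞ := 5 * (‖bilinL2‖ₑ * K) with hc
  have hctop : c < ⊤ := ENNReal.mul_lt_top (by simp)
    (ENNReal.mul_lt_top enorm_lt_top ENNReal.coe_lt_top)
  refine tendsto_integral_filter_of_dominated_convergence
    (fun t => (c * besovOneENorm P (g t : 𝓢'(Plane, ℂ))).toReal)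
    (hws.mono fun i hi => hi.aestronglyMeasurable_besovPairing ha hK hg hfin)
    (hws.mono fun i hi => ?_) ?_ ?_
  · filter_upwards [ae_timeMeasure_pos T, hfin] with t ht hgt
    rw [hi.besovPairing_eq ha ht, ← toReal_enorm]
    exact ENNReal.toReal_mono (ENNReal.mul_lt_top hctop hgt).ne (P.enorm_heatPairing_le ha hK _ _)
  · refine integrable_toReal_of_lintegral_ne_top (hmeas.const_mul c) ?_
    rw [lintegral_const_mul' _ _ hctop.ne]
    exact (ENNReal.mul_lt_top hctop hint).ne
  · filter_upwards [ae_timeMeasure_pos T, hfin] with t ht hgt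
    rw [hw.besovPairing_eq ha ht]
    refine Tendsto.congr' (hws.mono fun i hi => (hi.besovPairing_eq ha ht (g t)).symm) ?_
    exact ((P.continuous_heatPairing ha hK hgt).tendsto _).comp
      ((continuous_real_toNNReal.tendsto _).comp (hνs.mul_const t))

end IsHeatFlow

/-! ### Application to the given initial vorticity. -/

theorem isSingularVortex_div_norm {φ : Plane → ℝ} (hφ : Continuous φ)
    (hradial : ∀ x y : Plane, ‖x‖ = ‖y‖ → φ x = φ y)
    (hsupp : tsupport φ ⊆ Metric.closedBall 0 1) :
    ∃ M, IsSingularVortex M fun x => φ x / ‖x‖ := by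
  have hc : HasCompactSupport φ := (isCompact_closedBall 0 1).of_isClosed_subset
    (isClosed_tsupport φ) hsupp
  obtain ⟨M, hM⟩ := hc.exists_bound_of_continuous hφ
  refine ⟨M, (norm_nonneg _).trans (hM 0), fun x => ?_, fun x hx => ?_, fun x y hxy => ?_,
    fun x hx => hφ.continuousAt.div continuous_norm.continuousAt (norm_ne_zero_iff.2 hx)⟩
  · rw [abs_div, abs_norm, div_eq_mul_inv]
    exact mul_le_mul_of_nonneg_right (hM x) (by positivity)
  · rw [image_eq_zero_of_notMem_tsupport fun h => absurd (hsupp h) (by simpa using hx), zero_div]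
  · rw [hradial x y hxy, hxy]

theorem exists_norm_fourier_div_norm_le {φ : Plane → ℝ} (hφ : ContDiff ℝ ∞ φ)
    (hc : HasCompactSupport φ) (hi : Integrable fun x => φ x / ‖x‖) :
    ∃ C, ∀ ξ, ‖ξ‖ * ‖𝓕 (fun x => ((φ x / ‖x‖ : ℝ) : ℂ)) ξ‖ ≤ C := by
  let f : 𝓢(Plane, ℂ) := (hc.comp_left (g := ((↑) : ℝ → ℂ)) rfl).toSchwartzMap
    (Complex.ofRealCLM.contDiff.comp hφ)
  have e : (fun x => ((φ x / ‖x‖ : ℝ) : ℂ)) = fun x => ((‖x‖⁻¹ : ℝ) : ℂ) * f x := by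
    funext x
    change _ = ((‖x‖⁻¹ : ℝ) : ℂ) * (φ x : ℂ)
    push_cast
    ring
  obtain ⟨C, -, hC⟩ := exists_norm_fourier_inv_norm_mul_le f (e ▸ hi.ofReal)
  exact ⟨C, fun ξ => by rw [e]; exact hC ξ⟩

theorem proposition6p3 (φ : Plane → ℝ) (hφ : ContDiff ℝ ∞ φ)
    (hφ_radial : ∀ x y : Plane, ‖x‖ = ‖y‖ → φ x = φ y)
    (hφ_supp : tsupport φ ⊆ Metric.closedBall 0 1)
    (hφ_one : ∀ x ∈ Metric.ball (0 : Plane) (1 / 2), φ x = 1)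
    (ω₀ : Plane → ℝ) (hω₀ : ∀ x, ω₀ x = φ x / ‖x‖)
    (T : ℝ) (hT : 0 < T) (P : LittlewoodPaley) :
    -- the initial vorticity belongs to the Besov space
    MemBesov P ω₀ ∧
    -- the stationary vorticity is a viscosity solution of the Euler equations
    (∀ p : ℝ≥0∞, 4 / 3 ≤ p → p < 2 → IsViscositySolution p T ω₀ (fun _ => ω₀)) ∧
    -- the heat evolutions are bounded uniformly in the viscosity
    (∃ C : ℝ≥0, ∀ ν : ℝ, 0 < ν →
      MemTimeBesov P ⊤ T (heatEvolution ν ω₀) ∧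
      besovTimeENorm P ⊤ T (heatEvolution ν ω₀) ≤ C) ∧
    -- the heat evolutions converge weak-* to the initial vorticity
    TendstoWeakStarBesov P ⊤ T (𝓝[>] (0 : ℝ)) (fun ν => heatEvolution ν ω₀) (fun _ => ω₀) ∧
    -- the heat evolutions and the stationary vorticity satisfy the hypotheses of the conjecture
    (∀ p : ℝ≥0∞, 4 / 3 ≤ p → p < 2 →
      ∀ νs : ℕ → ℝ, (∀ k, 0 < νs k) → Tendsto νs atTop (𝓝 0) →
        EyinkHypotheses P p T ω₀ νs (fun k => heatEvolution (νs k) ω₀) (fun _ => ω₀)) := by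
  obtain rfl : ω₀ = fun x => φ x / ‖x‖ := funext hω₀
  obtain ⟨M, h⟩ := isSingularVortex_div_norm hφ.continuous hφ_radial hφ_supp
  set ω₀ : Plane → ℝ := fun x => φ x / ‖x‖
  have hc : HasCompactSupport φ := (isCompact_closedBall 0 1).of_isClosed_subset
    (isClosed_tsupport φ) hφ_supp
  obtain ⟨C, hC⟩ := exists_norm_fourier_div_norm_le hφ hc h.integrable
  have ha : Continuous (𝓕 fun x => (ω₀ x : ℂ)) := continuous_fourier_of_integrable h.integrable.ofReal
  obtain ⟨K, hK⟩ := P.exists_norm_heatMode_le ha (norm_fourier_le_integral_norm _) hC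
  have hstat := h.isHeatFlow_const
  -- The stationary flow takes the value `ω₀` at every time, so the block bound evaluated at time
  -- one gives the Besov norm of `ω₀`.
  refine ⟨⟨(representsFun_funDist h.integrable).1,
    (hstat.besovInftyENorm_le ha hK one_pos).trans_lt ENNReal.coe_lt_top⟩, fun p hp hp2 => ?_,
    ⟨K, fun ν hν => ?_⟩, ?_, fun p hp hp2 νs hpos hνs => ?_⟩
  · exact ⟨fun k => 1 / ((k : ℝ) + 1), _, h.isVanishingViscosityLimit hp hp2 hT
      (fun k => by positivity) tendsto_one_div_add_atTop_nhds_zero_nat⟩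
  · have hflow := h.isHeatFlow_heatEvolution hν
    exact ⟨hflow.memTimeBesov ha hK ⊤ T, hflow.besovTimeENorm_top_le ha hK T⟩
  · exact IsHeatFlow.tendstoWeakStarBesov (l := 𝓝[>] 0) (νs := fun ν => ν) ha hK
      (eventually_mem_nhdsWithin.mono fun ν hν => h.isHeatFlow_heatEvolution hν) hstat
      (tendsto_id.mono_left nhdsWithin_le_nhds) ⊤ T
  · exact ⟨h.isVanishingViscosityLimit hp hp2 hT hpos hνs, hstat.memTimeBesov ha hK 2 T,
      IsHeatFlow.tendstoWeakStarBesov ha hK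
        (Eventually.of_forall fun k => h.isHeatFlow_heatEvolution (hpos k)) hstat hνs 2 T⟩
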